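/- Let $\mathbf H^3=\mathbf C\times(0,\infty)$ be hyperbolic $3$-space, with the hyperbolic metric $d$ given by $\cosh d\big((z,t),(w,s)\big)=1+\frac{|z-w|^2+(t-s)^2}{2ts}$, and let $I$ be the group of all isometries of $\mathbf H^3$. A \emph{nice lattice} is a discrete torsion-free subgroup $\Gamma\subset I$ (one that acts properly discontinuously on $\mathbf H^3$ and has no nontrivial element of finite order) whose quotient $\mathbf H^3/\Gamma$ is compact. A \emph{compact hyperbolic $3$-manifold} is a quotient $M=\mathbf H^3/\Gamma$ by a nice lattice, with covering map $\pi:\mathbf H^3\to M$, the smooth structure that makes $\pi$ a local diffeomorphism, and the metric $d_M(a,b)=\inf\{d(x,y):\pi(x)=a,\ \pi(y)=b\}$, for which $\pi$ is a local isometry. A map $f:X_1\to X_2$ of metric spaces is \emph{BL} (bi-Lipschitz) if it is a bijection and there is $K\ge 1$ such that $K^{-1}d_1(x,y)\le d_2(f(x),f(y))\le K\,d_1(x,y)$ for all $x,y\in X_1$. \textbf{Theorem (Mostow).} Let $M_1=\mathbf H^3/\Gamma_1$ and $M_2=\mathbf H^3/\Gamma_2$ be compact hyperbolic $3$-manifolds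 with covering maps $\pi_1,\pi_2$. (1) If $f:M_1\to M_2$ is BL, then there is an isometry (distance-preserving bijection) $g:M_1\to M_2$. Moreover, $f$ has an equivariant lift, that is, a BL map $H:\mathbf H^3\to\mathbf H^3$ with $\pi_2\circ H=f\circ\pi_1$ and $H\Gamma_1H^{-1}=\Gamma_2$; and every equivariant lift $H$ of $f$ extends continuously to a homeomorphism $h$ of the ideal boundary $\mathbf C\cup\{\infty\}$ of $\mathbf H^3$ which is a (possibly orientation-reversing) Möbius transformation, that is, of the form $z\mapsto\frac{az+b}{cz+d}$ or $z\mapsto\frac{a\bar z+b}{c\bar z+d}$ with $a,b,c,d\in\mathbf C$, $ad-bc\neq 0$. (2) If $M_1$ and $M_2$ are diffeomorphic, then they are isometric. -/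

import Mathlib

open Set Filter Topology Manifold
open scoped ContDiff MatrixGroups

noncomputable section

/-! ### Hyperbolic 3-space -/

/-- The upper half-space `ℂ × (0, ∞)`, the underlying set of hyperbolic `3`-space. -/
@[ext]
structure Hyp3 where
  /-- the horizontal coordinate -/
  z : ℂ
  /-- the height -/
  t : ℝ
  t_pos : 0 < t

namespace Hyp3

/-- The inclusion of hyperbolic space in `ℂ × ℝ`. -/
def coord (p : Hyp3) : ℂ × ℝ := (p.z, p.t)

instance : Nonempty Hyp3 := ⟨⟨0, 1, one_pos⟩⟩

instance : TopologicalSpace Hyp3 := TopologicalSpace.induced coord inferInstance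

theorem coord_injective : Function.Injective coord := by
  intro p q h
  simp only [coord, Prod.mk.injEq] at h
  exact Hyp3.ext h.1 h.2

theorem range_coord : range coord = {x : ℂ × ℝ | 0 < x.2} := by
  ext x
  constructor
  · rintro ⟨p, rfl⟩
    exact p.t_pos
  · intro hx
    exact ⟨⟨x.1, x.2, hx⟩, rfl⟩

theorem isOpenEmbedding_coord : IsOpenEmbedding coord where
  eq_induced := rfl
  injective := coord_injective
  isOpen_range := by
    rw [range_coord]
    exact isOpen_lt continuous_const continuous_snd

theorem continuous_z : Continuous Hyp3.z :=
  continuous_fst.comp isOpenEmbedding_coord.continuous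

theorem continuous_t : Continuous Hyp3.t :=
  continuous_snd.comp isOpenEmbedding_coord.continuous

/-- The hyperbolic distance (of the Riemannian metric `(|dz|² + dt²) / t²`): it satisfies
`sinh (d / 2) = |p - q| / (2 √(p.t q.t))`, with `|p - q|` the Euclidean distance. -/
instance : Dist Hyp3 :=
  ⟨fun p q => 2 * Real.arsinh
    (√(‖p.z - q.z‖ ^ 2 + (p.t - q.t) ^ 2) / (2 * √(p.t * q.t)))⟩

theorem dist_def (p q : Hyp3) : dist p q = 2 * Real.arsinh
    (√(‖p.z - q.z‖ ^ 2 + (p.t - q.t) ^ 2) / (2 * √(p.t * q.t))) := rfl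

theorem dist_eq_planar (p q : Hyp3) (x : ℝ) : dist p q =
    dist (UpperHalfPlane.mk ⟨x, p.t⟩ p.t_pos)
      (UpperHalfPlane.mk ⟨x + ‖p.z - q.z‖, q.t⟩ q.t_pos) := by
  rw [UpperHalfPlane.dist_eq, dist_def, Complex.dist_eq_re_im]
  simp

theorem planar_mono {t s : ℝ} (ht : 0 < t) (hs : 0 < s) {a b : ℝ} (ha : 0 ≤ a) (hab : a ≤ b) :
    dist (UpperHalfPlane.mk ⟨0, t⟩ ht) (UpperHalfPlane.mk ⟨0 + a, s⟩ hs) ≤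
      dist (UpperHalfPlane.mk ⟨0, t⟩ ht) (UpperHalfPlane.mk ⟨b, s⟩ hs) := by
  rw [UpperHalfPlane.dist_eq, UpperHalfPlane.dist_eq, Complex.dist_eq_re_im,
    Complex.dist_eq_re_im]
  simp only [UpperHalfPlane.mk_im, zero_add, zero_sub, neg_sq]
  gcongr

protected theorem dist_triangle (p q r : Hyp3) : dist p r ≤ dist p q + dist q r := by
  rw [dist_eq_planar p r 0, dist_eq_planar p q 0, dist_eq_planar q r (0 + ‖p.z - q.z‖)]
  refine le_trans (planar_mono p.t_pos r.t_pos (norm_nonneg _) ?_) (dist_triangle _ _ _)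
  rw [zero_add]
  exact norm_sub_le_norm_sub_add_norm_sub _ _ _

theorem cosh_dist (p q : Hyp3) : Real.cosh (dist p q) =
    (‖p.z - q.z‖ ^ 2 + p.t ^ 2 + q.t ^ 2) / (2 * p.t * q.t) := by
  rw [dist_eq_planar p q 0, UpperHalfPlane.cosh_dist']
  simp

/-- The hyperbolic metric, before its topology is identified with the Euclidean one. -/
@[reducible]
def metricSpaceAux : MetricSpace Hyp3 where
  dist := dist
  dist_self p := by simp [dist_def]
  dist_comm p q := by
    rw [dist_def, dist_def, norm_sub_rev, mul_comm p.t]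
    congr 4
    ring
  dist_triangle := Hyp3.dist_triangle
  eq_of_dist_eq_zero {p q} h := by
    have h1 := cosh_dist p q
    rw [h, Real.cosh_zero, eq_div_iff (by have := p.t_pos; have := q.t_pos; positivity)] at h1
    have hz : ‖p.z - q.z‖ = 0 := by nlinarith [sq_nonneg ‖p.z - q.z‖, sq_nonneg (p.t - q.t)]
    have ht : p.t - q.t = 0 := by nlinarith [sq_nonneg ‖p.z - q.z‖, sq_nonneg (p.t - q.t)]
    exact Hyp3.ext (sub_eq_zero.1 (norm_eq_zero.1 hz)) (sub_eq_zero.1 ht)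

theorem euclidean_le (p q : Hyp3) :
    dist p.coord q.coord ≤ q.t * (Real.exp (dist p q) - 1) := by
  have h := UpperHalfPlane.dist_coe_le (UpperHalfPlane.mk ⟨0, p.t⟩ p.t_pos)
    (UpperHalfPlane.mk ⟨0 + ‖p.z - q.z‖, q.t⟩ q.t_pos)
  rw [← dist_eq_planar p q 0] at h
  refine le_trans ?_ h
  rw [Prod.dist_eq]
  refine max_le ?_ ?_
  · have := Complex.abs_re_le_norm ((⟨0, p.t⟩ : ℂ) - ⟨0 + ‖p.z - q.z‖, q.t⟩)
    simpa [dist_eq_norm, coord] using this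
  · have := Complex.abs_im_le_norm ((⟨0, p.t⟩ : ℂ) - ⟨0 + ‖p.z - q.z‖, q.t⟩)
    simpa [dist_eq_norm, coord] using this

/-- Hyperbolic `3`-space as a metric space; its topology is the Euclidean one. -/
instance : MetricSpace Hyp3 :=
  metricSpaceAux.replaceTopology <| by
    refine le_antisymm (continuous_id_iff_le.1 ?_) ?_
    · refine (@continuous_iff_continuous_dist Hyp3 Hyp3
        metricSpaceAux.toPseudoMetricSpace _ _).2 ?_
      have h0 : ∀ x : Hyp3 × Hyp3, 2 * √(x.1.t * x.2.t) ≠ 0 := fun x => by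
        have := x.1.t_pos
        have := x.2.t_pos
        positivity
      have hz := continuous_z
      have ht := continuous_t
      change Continuous fun x : Hyp3 × Hyp3 => 2 * Real.arsinh
        (√(‖x.1.z - x.2.z‖ ^ 2 + (x.1.t - x.2.t) ^ 2) / (2 * √(x.1.t * x.2.t)))
      refine continuous_const.mul (Continuous.arsinh (Continuous.div ?_ ?_ h0)) <;> fun_prop
    · let : MetricSpace Hyp3 := metricSpaceAux
      refine le_of_nhds_le_nhds fun p => ?_
      rw [nhds_induced]
      refine (Metric.nhds_basis_ball.le_basis_iff (Metric.nhds_basis_ball.comap _)).2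
        fun R hR => ?_
      have h1 : 1 < R / p.t + 1 := lt_add_of_pos_left _ (div_pos hR p.t_pos)
      have h0 : 0 < R / p.t + 1 := one_pos.trans h1
      refine ⟨Real.log (R / p.t + 1), Real.log_pos h1, fun q hq => ?_⟩
      refine (euclidean_le q p).trans_lt ?_
      rwa [← lt_div_iff₀' p.t_pos, sub_lt_iff_lt_add, ← Real.lt_log_iff_exp_lt h0]

instance : LocallyCompactSpace Hyp3 := isOpenEmbedding_coord.locallyCompactSpace

/-- Hyperbolic space is a manifold with the single chart `coord`. -/
instance : ChartedSpace (ℂ × ℝ) Hyp3 := isOpenEmbedding_coord.singletonChartedSpace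

instance : IsManifold 𝓘(ℝ, ℂ × ℝ) ∞ Hyp3 := isOpenEmbedding_coord.isManifold_singleton

/-- The group of all isometries of hyperbolic space acts on it. -/
instance : MulAction (Hyp3 ≃ᵢ Hyp3) Hyp3 where
  smul φ p := φ p
  one_smul _ := rfl
  mul_smul _ _ _ := rfl

theorem smul_def (φ : Hyp3 ≃ᵢ Hyp3) (p : Hyp3) : φ • p = φ p := rfl

instance : IsIsometricSMul (Hyp3 ≃ᵢ Hyp3) Hyp3 := ⟨fun φ => φ.isometry⟩

theorem contDiffOn_cosh (p : Hyp3) : ContDiffOn ℝ ∞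
    (fun x : ℂ × ℝ => (‖x.1 - p.z‖ ^ 2 + x.2 ^ 2 + p.t ^ 2) / (2 * x.2 * p.t)) (range coord) := by
  rw [range_coord]
  refine ContDiffOn.div ?_ ?_ ?_
  · have : ContDiff ℝ ∞ fun x : ℂ × ℝ => ‖x.1 - p.z‖ ^ 2 :=
      (contDiff_fst.sub contDiff_const).norm_sq ℝ
    exact ((this.add (contDiff_snd.pow 2)).add contDiff_const).contDiffOn
  · exact ((contDiff_const.mul contDiff_snd).mul contDiff_const).contDiffOn
  · intro x hx
    have : 0 < x.2 := hx
    have := p.t_pos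
    positivity

/-- Isometries of hyperbolic space are smooth. -/
theorem contDiffOn_isometry (φ : Hyp3 ≃ᵢ Hyp3) (F : ℂ × ℝ → ℂ × ℝ)
    (hF : ∀ p : Hyp3, F p.coord = (φ p).coord) : ContDiffOn ℝ ∞ F (range coord) := by
  have key : ∀ a : Hyp3, ContDiffOn ℝ ∞ (fun x : ℂ × ℝ =>
      (‖(F x).1 - a.z‖ ^ 2 + (F x).2 ^ 2 + a.t ^ 2) / (2 * (F x).2 * a.t)) (range coord) := by
    intro a
    refine (contDiffOn_cosh (φ.symm a)).congr ?_
    rintro _ ⟨p, rfl⟩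
    rw [hF]
    change (‖(φ p).z - a.z‖ ^ 2 + (φ p).t ^ 2 + a.t ^ 2) / (2 * (φ p).t * a.t) =
      (‖p.z - (φ.symm a).z‖ ^ 2 + p.t ^ 2 + (φ.symm a).t ^ 2) / (2 * p.t * (φ.symm a).t)
    rw [← cosh_dist, ← cosh_dist, ← φ.dist_eq p, φ.apply_symm_apply]
  have c0 := key ⟨0, 1, one_pos⟩
  have c1 := key ⟨1, 1, one_pos⟩
  have c2 := key ⟨Complex.I, 1, one_pos⟩
  have c3 := key ⟨0, 2, two_pos⟩
  have hpos : ∀ x ∈ range coord, 0 < (F x).2 := by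
    rintro _ ⟨p, rfl⟩
    rw [hF]
    exact (φ p).t_pos
  have hB : ContDiffOn ℝ ∞ (fun x => ((F x).2)⁻¹) (range coord) := by
    refine (((contDiffOn_const (c := (4 : ℝ))).mul c3).sub
      ((contDiffOn_const (c := (2 : ℝ))).mul c0) |>.div_const 3).congr fun x hx => ?_
    have := hpos x hx
    simp only
    field_simp
    ring
  have hT : ContDiffOn ℝ ∞ (fun x => (F x).2) (range coord) := by
    refine (hB.inv fun x hx => (inv_pos.2 (hpos x hx)).ne').congr fun x _ => ?_
    simp
  have hre : ContDiffOn ℝ ∞ (fun x => (F x).1.re) (range coord) := by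
    refine ((hT.mul (c0.sub c1)).add (contDiffOn_const (c := (1 / 2 : ℝ)))).congr
      fun x hx => ?_
    have := hpos x hx
    simp only [Complex.sq_norm, Complex.normSq_apply, Complex.sub_re, Complex.sub_im,
      Complex.one_re, Complex.one_im, Complex.zero_re, Complex.zero_im]
    field_simp
    ring
  have him : ContDiffOn ℝ ∞ (fun x => (F x).1.im) (range coord) := by
    refine ((hT.mul (c0.sub c2)).add (contDiffOn_const (c := (1 / 2 : ℝ)))).congr
      fun x hx => ?_
    have := hpos x hx
    simp only [Complex.sq_norm, Complex.normSq_apply, Complex.sub_re, Complex.sub_im,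
      Complex.I_re, Complex.I_im, Complex.zero_re, Complex.zero_im]
    field_simp
    ring
  have hz : ContDiffOn ℝ ∞ (fun x => (F x).1) (range coord) := by
    refine ((Complex.ofRealCLM.contDiff.comp_contDiffOn hre).add
      ((Complex.ofRealCLM.contDiff.comp_contDiffOn him).mul
        (contDiffOn_const (c := Complex.I)))).congr fun x _ => ?_
    simp [Complex.re_add_im]
  exact hz.prodMk hT

end Hyp3

/-! ### Compact hyperbolic 3-manifolds -/

/-- A co-compact torsion-free lattice in the isometry group of hyperbolic `3`-space: a subgroup
that is discrete (it acts properly discontinuously), has no nontrivial element of finite order,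
and has a compact quotient. -/
structure NiceLattice where
  /-- the group of isometries -/
  Γ : Subgroup (Hyp3 ≃ᵢ Hyp3)
  discrete : ProperlyDiscontinuousSMul Γ Hyp3
  torsionFree : ∀ γ ∈ Γ, IsOfFinOrder γ → γ = 1
  cocompact : CompactSpace (MulAction.orbitRel.Quotient Γ Hyp3)

namespace NiceLattice

variable (L : NiceLattice)

instance : ProperlyDiscontinuousSMul L.Γ Hyp3 := L.discrete

instance : IsIsometricSMul L.Γ Hyp3 := ⟨fun γ => γ.1.isometry⟩

/-- The action is free. -/
instance : IsCancelSMul L.Γ Hyp3 where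
  left_cancel' g _ _ h := smul_left_cancel g h
  right_cancel' a b p h := by
    have hfin : Finite (MulAction.stabilizer L.Γ p) :=
      (ProperlyDiscontinuousSMul.finite_stabilizer' L.Γ p).to_subtype
    have hmem : b⁻¹ * a ∈ MulAction.stabilizer L.Γ p := by
      rw [MulAction.mem_stabilizer_iff, mul_smul, h, inv_smul_smul]
    have h1 : IsOfFinOrder (⟨b⁻¹ * a, hmem⟩ : MulAction.stabilizer L.Γ p) :=
      isOfFinOrder_of_finite _
    have h2 : IsOfFinOrder (b⁻¹ * a) :=
      (MulAction.stabilizer L.Γ p).subtype.isOfFinOrder h1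
    have h3 : IsOfFinOrder ((b⁻¹ * a : L.Γ) : Hyp3 ≃ᵢ Hyp3) := L.Γ.subtype.isOfFinOrder h2
    have h4 : b⁻¹ * a = 1 := Subtype.ext (L.torsionFree _ (b⁻¹ * a).2 h3)
    exact (inv_mul_eq_one.1 h4).symm

/-- The compact hyperbolic `3`-manifold `Hyp3 / Γ`. -/
def Manifold : Type := MulAction.orbitRel.Quotient L.Γ Hyp3

/-- The universal covering map from hyperbolic space to its quotient. -/
def proj (p : Hyp3) : L.Manifold := Quotient.mk (MulAction.orbitRel L.Γ Hyp3) p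

/-- The quotient topology. -/
instance : TopologicalSpace L.Manifold :=
  inferInstanceAs (TopologicalSpace (MulAction.orbitRel.Quotient L.Γ Hyp3))

instance : CompactSpace L.Manifold := L.cocompact

instance : T2Space L.Manifold :=
  inferInstanceAs (T2Space (Quotient (MulAction.orbitRel L.Γ Hyp3)))

/-- The smooth structure whose charts are local inverses of the covering map. -/
instance : ChartedSpace (ℂ × ℝ) L.Manifold :=
  inferInstanceAs (ChartedSpace (ℂ × ℝ) (MulAction.orbitRel.Quotient L.Γ Hyp3))

theorem isQuotientCoveringMap_proj : IsQuotientCoveringMap L.proj L.Γ :=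
  isQuotientCoveringMap_quotientMk_of_properlyDiscontinuousSMul

theorem proj_surjective : Function.Surjective L.proj := Quotient.mk_surjective

theorem proj_eq_iff {p q : Hyp3} : L.proj p = L.proj q ↔ ∃ γ : L.Γ, γ • q = p :=
  L.isQuotientCoveringMap_proj.apply_eq_iff_mem_orbit

theorem proj_smul (γ : L.Γ) (p : Hyp3) : L.proj (γ • p) = L.proj p :=
  L.isQuotientCoveringMap_proj.map_smul γ

theorem continuous_proj : Continuous L.proj := L.isQuotientCoveringMap_proj.continuous

theorem isOpenMap_proj : IsOpenMap L.proj :=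
  L.isQuotientCoveringMap_proj.isCoveringMap.isLocalHomeomorph.isOpenMap

instance : IsManifold 𝓘(ℝ, ℂ × ℝ) ∞ L.Manifold := by
  have hloc : IsLocalHomeomorph L.proj :=
    L.isQuotientCoveringMap_proj.isCoveringMap.isLocalHomeomorph
  set c := Hyp3.isOpenEmbedding_coord.toOpenPartialHomeomorph Hyp3.coord with hc
  have hcsymm : ∀ p : Hyp3, c.symm p.coord = p := fun p => c.left_inv (by simp [c])
  have hccoe : ∀ p : Hyp3, c p = p.coord := fun p => rfl
  have key : ∀ a b : Hyp3, ContDiffOn ℝ ∞ (((hloc.localInverseAt a).trans c).symm.trans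
      ((hloc.localInverseAt b).trans c)) (((hloc.localInverseAt a).trans c).symm.trans
      ((hloc.localInverseAt b).trans c)).source := by
    intro a b
    have hf : ∀ u, (((hloc.localInverseAt a).trans c).symm.trans
        ((hloc.localInverseAt b).trans c)) u =
        (hloc.localInverseAt b (L.proj (c.symm u))).coord := by
      intro u
      simp [hccoe]
    intro u hu
    have hu' := hu
    simp only [OpenPartialHomeomorph.trans_source, OpenPartialHomeomorph.symm_source,
      OpenPartialHomeomorph.trans_target, mem_inter_iff, mem_preimage,
      OpenPartialHomeomorph.coe_trans_symm, Function.comp_apply,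
      IsLocalHomeomorph.localInverseAt_symm] at hu'
    obtain ⟨⟨hut, -⟩, hus, -⟩ := hu'
    have hur : u ∈ range Hyp3.coord := by simpa [c] using hut
    obtain ⟨p, rfl⟩ := hur
    rw [hcsymm] at hus
    obtain ⟨γ, hγ⟩ := L.proj_eq_iff.1 (hloc.apply_localInverseAt_of_mem hus)
    have hsm := Hyp3.contDiffOn_isometry γ.1 (fun v => (γ.1 (c.symm v)).coord)
      (fun q => by simp only [hcsymm])
    have hsm' := (hsm p.coord (mem_range_self p)).contDiffAt
      (Hyp3.isOpenEmbedding_coord.isOpen_range.mem_nhds (mem_range_self p))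
    refine (hsm'.congr_of_eventuallyEq ?_).contDiffWithinAt
    have hev : ∀ᶠ q in 𝓝 p, γ • q ∈ (hloc.localInverseAt b).target := by
      refine (continuous_const_smul γ).continuousAt
        ((hloc.localInverseAt b).open_target.mem_nhds ?_)
      rw [hγ]
      exact (hloc.localInverseAt b).map_source hus
    rw [EventuallyEq, ← Hyp3.isOpenEmbedding_coord.map_nhds_eq, eventually_map]
    filter_upwards [hev] with q hq
    rw [hf, hcsymm]
    have h1 : hloc.localInverseAt b (L.proj (γ • q)) = γ • q := by
      have := (hloc.localInverseAt b).right_inv hq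
      rwa [hloc.localInverseAt_symm] at this
    rw [L.proj_smul] at h1
    rw [h1]
    rfl
  refine isManifold_of_contDiffOn _ _ _ ?_
  rintro _ _ ⟨x, rfl⟩ ⟨y, rfl⟩
  simp only [modelWithCornersSelf_coe, modelWithCornersSelf_coe_symm, range_id, inter_univ,
    preimage_id, Function.comp_id, Function.id_comp]
  exact key _ _

/-- The distance in the quotient is the distance between fibres of the covering map; this is the
path metric for which the covering map is a local isometry. -/
instance : Dist L.Manifold :=
  ⟨fun a b => sInf (image2 dist (L.proj ⁻¹' {a}) (L.proj ⁻¹' {b}))⟩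

theorem dist_eq_infDist (p : Hyp3) (b : L.Manifold) :
    dist (L.proj p) b = Metric.infDist p (L.proj ⁻¹' {b}) := by
  obtain ⟨q₀, rfl⟩ := L.proj_surjective b
  have hne : (L.proj ⁻¹' {L.proj q₀}).Nonempty := ⟨q₀, rfl⟩
  apply le_antisymm
  · refine (Metric.le_infDist hne).2 fun q hq => ?_
    refine csInf_le ⟨0, ?_⟩ ⟨p, rfl, q, hq, rfl⟩
    rintro _ ⟨_, -, _, -, rfl⟩
    exact dist_nonneg
  · refine le_csInf ⟨_, p, rfl, q₀, rfl, rfl⟩ ?_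
    rintro _ ⟨p', hp', q', hq', rfl⟩
    obtain ⟨γ, rfl⟩ := L.proj_eq_iff.1 (show L.proj p = L.proj p' from hp'.symm)
    rw [← dist_smul γ p' q']
    refine Metric.infDist_le_dist_of_mem ?_
    rw [mem_preimage, L.proj_smul]
    exact hq'

theorem ball_proj (p : Hyp3) (r : ℝ) :
    {b | dist (L.proj p) b < r} = L.proj '' Metric.ball p r := by
  ext b
  obtain ⟨q₀, rfl⟩ := L.proj_surjective b
  have hne : (L.proj ⁻¹' {L.proj q₀}).Nonempty := ⟨q₀, rfl⟩
  rw [mem_ofPred_eq, dist_eq_infDist, Metric.infDist_lt_iff hne]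
  constructor
  · rintro ⟨q, hq, h⟩
    exact ⟨q, by rwa [Metric.mem_ball'], hq⟩
  · rintro ⟨q, hq, h⟩
    exact ⟨q, h, by rwa [Metric.mem_ball'] at hq⟩

/-- The quotient metric, before its topology is identified with the quotient topology. -/
@[reducible]
def metricSpaceAux : MetricSpace L.Manifold where
  dist := dist
  dist_self a := by
    obtain ⟨p, rfl⟩ := L.proj_surjective a
    rw [dist_eq_infDist]
    exact Metric.infDist_zero_of_mem rfl
  dist_comm a b := by
    change sInf _ = sInf _
    rw [image2_swap]
    simp only [dist_comm]
  dist_triangle a b c := by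
    obtain ⟨p, rfl⟩ := L.proj_surjective a
    obtain ⟨q₀, rfl⟩ := L.proj_surjective b
    have hne : (L.proj ⁻¹' {L.proj q₀}).Nonempty := ⟨q₀, rfl⟩
    rw [← sub_le_iff_le_add, dist_eq_infDist L p (L.proj q₀)]
    refine (Metric.le_infDist hne).2 fun q hq => ?_
    have hq' : L.proj q = L.proj q₀ := hq
    rw [← hq', dist_eq_infDist, dist_eq_infDist, sub_le_iff_le_add']
    exact Metric.infDist_le_infDist_add_dist
  eq_of_dist_eq_zero {a b} h := by
    obtain ⟨p, rfl⟩ := L.proj_surjective a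
    rw [dist_eq_infDist] at h
    have hcl : IsClosed (L.proj ⁻¹' {b}) := isClosed_singleton.preimage L.continuous_proj
    obtain ⟨q, rfl⟩ := L.proj_surjective b
    exact (hcl.mem_iff_infDist_zero ⟨q, rfl⟩).2 h

/-- The metric of a compact hyperbolic `3`-manifold; its topology is the quotient topology. -/
instance : MetricSpace L.Manifold :=
  L.metricSpaceAux.replaceTopology <| by
    refine TopologicalSpace.ext_nhds fun a => ?_
    obtain ⟨p, rfl⟩ := L.proj_surjective a
    rw [← L.isOpenMap_proj.map_nhds_eq L.continuous_proj.continuousAt]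
    have h1 := (Metric.nhds_basis_ball (x := p)).map L.proj
    have h2 := @Metric.nhds_basis_ball L.Manifold L.metricSpaceAux.toPseudoMetricSpace (L.proj p)
    refine h1.eq_of_same_basis (h2.congr (fun _ => Iff.rfl) fun r _ => ?_)
    rw [← ball_proj]
    ext b
    exact iff_of_eq (congrArg (· < r) (L.metricSpaceAux.dist_comm b (L.proj p)))

end NiceLattice

/-! ### Bi-Lipschitz maps, lifts and their boundary values -/

/-- A bijection of metric spaces that distorts distances by a factor of at most some `K ≥ 1`. -/
def IsBL {X Y : Type*} [MetricSpace X] [MetricSpace Y] (f : X → Y) : Prop :=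
  Function.Bijective f ∧ ∃ K : ℝ, 1 ≤ K ∧
    ∀ x y, K⁻¹ * dist x y ≤ dist (f x) (f y) ∧ dist (f x) (f y) ≤ K * dist x y

/-- `H` conjugates the first lattice to the second: `H Γ₁ H⁻¹ = Γ₂` (for a bijection `H`). -/
def Conjugates (L₁ L₂ : NiceLattice) (H : Hyp3 → Hyp3) : Prop :=
  (∀ γ₁ ∈ L₁.Γ, ∃ γ₂ ∈ L₂.Γ, H ∘ γ₁ = γ₂ ∘ H) ∧
    ∀ γ₂ ∈ L₂.Γ, ∃ γ₁ ∈ L₁.Γ, H ∘ γ₁ = γ₂ ∘ H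

/-- An equivariant bi-Lipschitz lift to hyperbolic space of a map between the quotients. -/
structure IsEquivariantLift {L₁ L₂ : NiceLattice} (f : L₁.Manifold → L₂.Manifold)
    (H : Hyp3 → Hyp3) : Prop where
  isBL : IsBL H
  lifts : ∀ p, L₂.proj (H p) = f (L₁.proj p)
  conjugates : Conjugates L₁ L₂ H

/-- Hyperbolic space inside the one-point compactification of `ℂ × ℝ`. -/
def interiorPoint (p : Hyp3) : OnePoint (ℂ × ℝ) := (p.coord : OnePoint (ℂ × ℝ))

/-- The Riemann sphere `ℂ ∪ {∞}` as the ideal boundary of hyperbolic space, inside the one-point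
compactification of `ℂ × ℝ`. -/
def boundaryPoint : OnePoint ℂ → OnePoint (ℂ × ℝ) := OnePoint.map fun z => (z, 0)

/-- `h` is the continuous extension of `H` to the ideal boundary: as `p` in hyperbolic space tends
to an ideal point `ξ`, the point `H p` tends to `h ξ`. -/
def IsBoundaryExtension (H : Hyp3 → Hyp3) (h : OnePoint ℂ ≃ₜ OnePoint ℂ) : Prop :=
  ∀ ξ : OnePoint ℂ, Tendsto (fun p => interiorPoint (H p))
    (comap interiorPoint (𝓝 (boundaryPoint ξ))) (𝓝 (boundaryPoint (h ξ)))

/-- A Möbius transformation of the Riemann sphere, possibly reversing the orientation: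
`w ↦ (a w + b) / (c w + d)` with `w = z` or `w = conj z`, where `a d - b c ≠ 0`. -/
def IsMoebius (h : OnePoint ℂ → OnePoint ℂ) : Prop :=
  ∃ A : GL (Fin 2) ℂ, (∀ ξ, h ξ = A • ξ) ∨
    ∀ ξ, h ξ = A • OnePoint.map (starRingEnd ℂ) ξ

end

/-! Lift `f` to a bi-Lipschitz map `H` of hyperbolic space that conjugates one lattice to the other.
It suffices to find an isometry `Φ` with the boundary values of `H`. An isometry is determined by
its boundary values, so `Φ` inherits the equivariance of `H` and descends to the quotients
(`BiLip.conjugates_isometry`, `Conjugates.nonempty_isometryEquiv`); and the boundary map of `H`,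
being that of an isometry, is Möbius.

Boundary values exist because a bounded hyperbolic step at distance `d` from the base point has
Euclidean length `O(exp (-d))` in the ball model (`ball_dist_le`), while `H` shrinks `d` at most by
the factor `K`, up to an additive constant. Along a vertical geodesic these lengths form a geometric
series. The resulting Hölder estimates are uniform over `K`-bi-Lipschitz maps that move the base
point a bounded amount, so boundary values are continuous in the map and the ideal point together.
Such maps have limits (`BiLip.exists_ultralimit`), and this compactness makes the planar boundary
map `h` quasisymmetric, once `∞` has been normalised to be fixed.

A quasisymmetric map is differentiable almost everywhere, and its derivative `A` is nonzero at some
point `z` (`exists_hasFDerivAt_ne_zero`). One such point is enough: no ergodicity is used. The maps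
`η ↦ (h (z + r η) - h z) / r` tend to `A` as `r → 0`. By cocompactness `(z, r)` is at a bounded
distance from the orbit of the base point, so by equivariance each zoom of `H` is `e_r ∘ H ∘ k_r`
with isometries `e_r`, `k_r` that stay bounded. A limit shows that, up to isometries on both sides,
the boundary map of `H` is the real-linear map `A` (`BiLip.exists_linear_bdry`).

Finally `A` conjugates isometries to isometries. A cocompact lattice has no common fixed point at
infinity (`NiceLattice.exists_bdry_ne`), so one of these isometries does not fix `∞`; it acts as an
inversion up to similarities, and this forces `A` to be a similarity (`exists_norm_eq_of_conj`). A
similarity of the plane extends to an isometry of hyperbolic space. Part (2) reduces to part (1),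
since smooth maps between compact manifolds are Lipschitz. -/

noncomputable section

namespace Hyp3

/-! ### Elementary hyperbolic geometry -/

/-- The base point `(0, 1)`. -/
def base : Hyp3 := ⟨0, 1, one_pos⟩

@[simp] theorem base_z : base.z = 0 := rfl
@[simp] theorem base_t : base.t = 1 := rfl

theorem dist_le_iff_cosh_le {p q : Hyp3} {r : ℝ} (hr : 0 ≤ r) :
    dist p q ≤ r ↔ Real.cosh (dist p q) ≤ Real.cosh r := by
  rw [Real.cosh_le_cosh, abs_of_nonneg dist_nonneg, abs_of_nonneg hr]

theorem dist_eq_of_cosh_eq {p q p' q' : Hyp3}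
    (h : Real.cosh (dist p q) = Real.cosh (dist p' q')) : dist p q = dist p' q' :=
  le_antisymm ((dist_le_iff_cosh_le dist_nonneg).2 h.le) ((dist_le_iff_cosh_le dist_nonneg).2 h.ge)

theorem height_le (p q : Hyp3) : p.t ≤ q.t * Real.exp (dist p q) := by
  have h := euclidean_le p q
  have h2 : dist p.t q.t ≤ dist p.coord q.coord := le_max_right _ _
  rw [Real.dist_eq] at h2
  have := le_abs_self (p.t - q.t)
  linarith

theorem norm_z_sub_le (p q : Hyp3) : ‖p.z - q.z‖ ≤ q.t * Real.exp (dist p q) := by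
  have h := euclidean_le p q
  have h2 : dist p.z q.z ≤ dist p.coord q.coord := le_max_left _ _
  rw [dist_eq_norm] at h2
  have := q.t_pos
  linarith

theorem neg_log_height_le_dist (p : Hyp3) : -Real.log p.t ≤ dist p base := by
  have h := height_le base p
  rw [dist_comm, base_t] at h
  have h1 : p.t⁻¹ ≤ Real.exp (dist p base) := by
    rw [inv_le_iff_one_le_mul₀ p.t_pos, mul_comm]
    exact h
  rw [← Real.log_inv]
  exact (Real.log_le_iff_le_exp (inv_pos.2 p.t_pos)).2 h1

theorem dist_vertical_le {p q : Hyp3} (hz : p.z = q.z) {c : ℝ} (hc : 0 ≤ c)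
    (h1 : p.t ≤ q.t * Real.exp c) (h2 : q.t ≤ p.t * Real.exp c) : dist p q ≤ c := by
  have hp := p.t_pos
  have hq := q.t_pos
  rw [dist_le_iff_cosh_le hc, cosh_dist, hz, sub_self, norm_zero, Real.cosh_eq, Real.exp_neg,
    div_le_div_iff₀ (by positivity) (by positivity)]
  have he := Real.exp_pos c
  -- Expanding this product of nonnegative factors gives the bound on the cosine `(p.t / q.t + q.t /
  -- p.t) / 2` of the vertical distance.
  have key : 0 ≤ (q.t * Real.exp c - p.t) * (p.t * Real.exp c - q.t) :=
    mul_nonneg (by linarith) (by linarith)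
  have h3 : (p.t ^ 2 + q.t ^ 2) * Real.exp c ≤ p.t * q.t * (Real.exp c ^ 2 + 1) := by nlinarith
  have h4 : (p.t ^ 2 + q.t ^ 2) ≤ p.t * q.t * (Real.exp c + (Real.exp c)⁻¹) := by
    rw [← mul_le_mul_iff_left₀ he]
    calc _ ≤ p.t * q.t * (Real.exp c ^ 2 + 1) := h3
      _ = _ := by field_simp
  nlinarith

/-- Here `cosh (dist p q) ≤ 3 / 2 ≤ cosh 1`. At height `t`, horizontal distance `t` is the natural
unit. -/
theorem dist_horizontal_le {p q : Hyp3} (ht : p.t = q.t) (h : ‖p.z - q.z‖ ≤ p.t) :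
    dist p q ≤ 1 := by
  have hp := p.t_pos
  rw [dist_le_iff_cosh_le zero_le_one, cosh_dist, ← ht]
  have h1 : (1 : ℝ) + 1 ^ 2 / 2 ≤ Real.cosh 1 := by
    have h2 := Real.cosh_sq' (1 / 2 : ℝ)
    have h3 := Real.cosh_two_mul (1 / 2 : ℝ)
    have h4 : (1 / 2 : ℝ) ≤ Real.sinh (1 / 2) := Real.self_le_sinh_iff.2 (by norm_num)
    rw [mul_div_cancel₀ _ (two_ne_zero' ℝ)] at h3
    nlinarith
  refine le_trans ?_ h1
  rw [div_le_iff₀ (by positivity)]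
  nlinarith [norm_nonneg (p.z - q.z)]

/-- A hyperbolic ball lies in a coordinate box whose heights are bounded below by a positive number,
hence in a compact set of the half-space. -/
instance : ProperSpace Hyp3 where
  isCompact_closedBall p R := by
    set e := Real.exp R
    have he : 0 < e := Real.exp_pos R
    have hK : IsCompact (Metric.closedBall p.z (p.t * e) ×ˢ Icc (p.t * e⁻¹) (p.t * e)) :=
      (isCompact_closedBall _ _).prod isCompact_Icc
    have hK' : IsCompact (coord ⁻¹' (Metric.closedBall p.z (p.t * e) ×ˢ
        Icc (p.t * e⁻¹) (p.t * e))) := by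
      refine isOpenEmbedding_coord.isInducing.isCompact_preimage_iff ?_ |>.2 hK
      rintro ⟨z, t⟩ ⟨-, ht⟩
      rw [range_coord]
      exact lt_of_lt_of_le (mul_pos p.t_pos (inv_pos.2 he)) ht.1
    refine hK'.of_isClosed_subset Metric.isClosed_closedBall fun q hq => ?_
    rw [Metric.mem_closedBall] at hq
    have hexp : Real.exp (dist q p) ≤ e := Real.exp_le_exp.2 hq
    have hp := p.t_pos
    have hq0 := q.t_pos
    refine ⟨?_, ?_, ?_⟩
    · rw [Metric.mem_closedBall, dist_eq_norm]
      exact (norm_z_sub_le q p).trans (by gcongr)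
    · change p.t * e⁻¹ ≤ q.t
      rw [← div_eq_mul_inv, div_le_iff₀ he]
      refine (height_le p q).trans ?_
      rw [dist_comm]
      gcongr
    · exact (height_le q p).trans (by gcongr)

/-! ### Explicit isometries: extensions of similarities, and the inversion -/

/-- The isometry of hyperbolic space that extends a similarity of `ℂ`. -/
def similarity (Ψ : ℂ ≃ ℂ) (l : ℝ) (hl : 0 < l) (hΨ : ∀ z w, ‖Ψ z - Ψ w‖ = l * ‖z - w‖) :
    Hyp3 ≃ᵢ Hyp3 where
  toFun p := ⟨Ψ p.z, l * p.t, mul_pos hl p.t_pos⟩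
  invFun p := ⟨Ψ.symm p.z, l⁻¹ * p.t, mul_pos (inv_pos.2 hl) p.t_pos⟩
  left_inv p := by
    ext <;> simp [hl.ne']
  right_inv p := by
    ext <;> simp [hl.ne']
  isometry_toFun := by
    refine Isometry.of_dist_eq fun p q => dist_eq_of_cosh_eq ?_
    have hp := p.t_pos
    have hq := q.t_pos
    simp only [cosh_dist, hΨ]
    field_simp

section similarity

variable (Ψ : ℂ ≃ ℂ) (l : ℝ) (hl : 0 < l) (hΨ : ∀ z w, ‖Ψ z - Ψ w‖ = l * ‖z - w‖)

@[simp] theorem similarity_z (p : Hyp3) : (similarity Ψ l hl hΨ p).z = Ψ p.z := rfl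
@[simp] theorem similarity_t (p : Hyp3) : (similarity Ψ l hl hΨ p).t = l * p.t := rfl

end similarity

/-- The homothety of `ℂ` that carries `0` and `1` to `p.z` and `p.z + p.t`. -/
def homothety (p : Hyp3) : ℂ ≃ ℂ where
  toFun z := p.z + p.t * z
  invFun z := (z - p.z) / p.t
  left_inv z := by
    have : (p.t : ℂ) ≠ 0 := Complex.ofReal_ne_zero.2 p.t_pos.ne'
    simp [this]
  right_inv z := by
    have : (p.t : ℂ) ≠ 0 := Complex.ofReal_ne_zero.2 p.t_pos.ne'
    field_simp
    ring

/-- The orientation-preserving isometry fixing `∞` without rotation that carries the base point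
to `p`. -/
def fromBase (p : Hyp3) : Hyp3 ≃ᵢ Hyp3 :=
  similarity (homothety p) p.t p.t_pos fun z w => by
    change ‖p.z + p.t * z - (p.z + p.t * w)‖ = _
    rw [add_sub_add_left_eq_sub, ← mul_sub, norm_mul, Complex.norm_real,
      Real.norm_of_nonneg p.t_pos.le]

@[simp] theorem fromBase_base (p : Hyp3) : fromBase p base = p := by
  ext <;> simp [fromBase, homothety]

@[simp] theorem fromBase_symm_self (p : Hyp3) : (fromBase p).symm p = base := by
  rw [IsometryEquiv.symm_apply_eq, fromBase_base]

theorem normSq_pos (p : Hyp3) : 0 < ‖p.z‖ ^ 2 + p.t ^ 2 := by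
  have := p.t_pos
  positivity

/-- The inversion in the unit hemisphere, on points. -/
def inversionFun (p : Hyp3) : Hyp3 :=
  ⟨p.z / ((‖p.z‖ ^ 2 + p.t ^ 2 : ℝ) : ℂ), p.t / (‖p.z‖ ^ 2 + p.t ^ 2),
    div_pos p.t_pos p.normSq_pos⟩

theorem inversionFun_normSq (p : Hyp3) :
    ‖(inversionFun p).z‖ ^ 2 + (inversionFun p).t ^ 2 = (‖p.z‖ ^ 2 + p.t ^ 2)⁻¹ := by
  have h := p.normSq_pos
  simp only [inversionFun, norm_div, Complex.norm_real, Real.norm_of_nonneg h.le]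
  field_simp

theorem inversionFun_inversionFun (p : Hyp3) : inversionFun (inversionFun p) = p := by
  have h := p.normSq_pos
  have h' : ((‖p.z‖ ^ 2 + p.t ^ 2 : ℝ) : ℂ) ≠ 0 := Complex.ofReal_ne_zero.2 h.ne'
  ext
  · change (inversionFun p).z / ((_ : ℝ) : ℂ) = p.z
    rw [inversionFun_normSq, Complex.ofReal_inv]
    simp only [inversionFun]
    field_simp
  · change (inversionFun p).t / _ = p.t
    rw [inversionFun_normSq]
    simp only [inversionFun]
    field_simp

theorem norm_sub_sq_complex (z w : ℂ) :
    ‖z - w‖ ^ 2 = ‖z‖ ^ 2 + ‖w‖ ^ 2 - 2 * (z.re * w.re + z.im * w.im) := by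
  simp only [Complex.sq_norm, Complex.normSq_apply, Complex.sub_re, Complex.sub_im]
  ring

/-- The inversion in the unit hemisphere. -/
def inversion : Hyp3 ≃ᵢ Hyp3 where
  toFun := inversionFun
  invFun := inversionFun
  left_inv := inversionFun_inversionFun
  right_inv := inversionFun_inversionFun
  isometry_toFun := by
    refine Isometry.of_dist_eq fun p q => dist_eq_of_cosh_eq ?_
    have hp := p.t_pos
    have hq := q.t_pos
    have hp2 := p.normSq_pos
    have hq2 := q.normSq_pos
    rw [cosh_dist, cosh_dist, norm_sub_sq_complex, norm_sub_sq_complex p.z]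
    have e1 : ‖(inversionFun p).z‖ ^ 2 + ‖(inversionFun q).z‖ ^ 2 -
        2 * ((inversionFun p).z.re * (inversionFun q).z.re +
          (inversionFun p).z.im * (inversionFun q).z.im) + (inversionFun p).t ^ 2 +
        (inversionFun q).t ^ 2 = (‖p.z‖ ^ 2 + p.t ^ 2)⁻¹ + (‖q.z‖ ^ 2 + q.t ^ 2)⁻¹ -
        2 * ((inversionFun p).z.re * (inversionFun q).z.re +
          (inversionFun p).z.im * (inversionFun q).z.im) := by
      rw [← inversionFun_normSq, ← inversionFun_normSq]
      ring
    rw [e1]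
    simp only [inversionFun, Complex.div_ofReal_re, Complex.div_ofReal_im]
    field_simp
    ring

theorem inversion_apply (p : Hyp3) : inversion p = inversionFun p := rfl

theorem inversion_inversion (p : Hyp3) : inversion (inversion p) = p :=
  inversionFun_inversionFun p

theorem inversion_base : inversion base = base := by
  ext <;> simp [inversion_apply, inversionFun]

/-! ### The ball model -/

/-- The inversion that carries the closed half-space to a closed ball, in coordinates. -/
def ballCoord (x : ℂ × ℝ) : ℂ × ℝ :=
  (x.1 / ((‖x.1‖ ^ 2 + (x.2 + 1) ^ 2 : ℝ) : ℂ), (x.2 + 1) / (‖x.1‖ ^ 2 + (x.2 + 1) ^ 2))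

/-- The position in the ball model (a ball tangent to the plane at the image of `∞`). -/
def ball (p : Hyp3) : ℂ × ℝ := ballCoord p.coord

/-- The position in the ball model of an ideal point. -/
def idealBall : OnePoint ℂ → ℂ × ℝ
  | none => 0
  | some z => ballCoord (z, 0)

@[simp] theorem idealBall_infty : idealBall OnePoint.infty = 0 := rfl
theorem idealBall_coe (z : ℂ) : idealBall (z : OnePoint ℂ) = ballCoord (z, 0) := rfl

theorem ball_def (p : Hyp3) : ball p =
    (p.z / ((‖p.z‖ ^ 2 + (p.t + 1) ^ 2 : ℝ) : ℂ), (p.t + 1) / (‖p.z‖ ^ 2 + (p.t + 1) ^ 2)) := rfl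

theorem ball_denom_pos (p : Hyp3) : 0 < ‖p.z‖ ^ 2 + (p.t + 1) ^ 2 := by
  have := p.t_pos
  positivity

/-- The model is the ball of radius `1 / 2` about `(0, 1 / 2)`, with `∞` at its lowest point, and
the inversion is its reflection in the equatorial plane. Questions at `∞` can thereby be moved to
`0`. -/
theorem ball_inversion (p : Hyp3) : ball (inversion p) = ((ball p).1, 1 - (ball p).2) := by
  have hN := p.ball_denom_pos
  have hM := p.normSq_pos
  have ht := p.t_pos
  have key : ‖(inversion p).z‖ ^ 2 + ((inversion p).t + 1) ^ 2 =
      (‖p.z‖ ^ 2 + (p.t + 1) ^ 2) / (‖p.z‖ ^ 2 + p.t ^ 2) := by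
    have h := inversionFun_normSq p
    rw [inversion_apply]
    have h2 : (inversionFun p).t = p.t / (‖p.z‖ ^ 2 + p.t ^ 2) := rfl
    have : ‖(inversionFun p).z‖ ^ 2 + ((inversionFun p).t + 1) ^ 2 =
      ‖(inversionFun p).z‖ ^ 2 + (inversionFun p).t ^ 2 + 2 * (inversionFun p).t + 1 := by ring
    rw [this, h, h2]
    field_simp
    ring
  have hM' : ((‖p.z‖ ^ 2 + p.t ^ 2 : ℝ) : ℂ) ≠ 0 := Complex.ofReal_ne_zero.2 hM.ne'
  have hN' : ((‖p.z‖ ^ 2 + (p.t + 1) ^ 2 : ℝ) : ℂ) ≠ 0 := Complex.ofReal_ne_zero.2 hN.ne'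
  rw [ball_def, key, ball_def]
  refine Prod.ext ?_ ?_
  · simp only [inversion_apply, inversionFun, Complex.ofReal_div]
    field_simp
  · simp only [inversion_apply, inversionFun]
    field_simp
    ring

/-- The defect of the ball model from its bounding sphere. -/
theorem ball_defect (p : Hyp3) : (ball p).2 - (‖(ball p).1‖ ^ 2 + (ball p).2 ^ 2) =
    p.t / (‖p.z‖ ^ 2 + (p.t + 1) ^ 2) := by
  have hN := p.ball_denom_pos
  rw [ball_def]
  simp only [norm_div, Complex.norm_real, Real.norm_of_nonneg hN.le]
  field_simp
  ring

theorem four_mul_cosh_sq (p : Hyp3) : ‖p.z‖ ^ 2 + (p.t + 1) ^ 2 =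
    4 * p.t * Real.cosh (dist p base / 2) ^ 2 := by
  have h := cosh_dist p base
  have h2 := Real.cosh_sq' (dist p base / 2)
  have h3 := Real.cosh_two_mul (dist p base / 2)
  rw [mul_div_cancel₀ _ (two_ne_zero' ℝ)] at h3
  have ht := p.t_pos
  simp only [base_z, sub_zero, base_t] at h
  rw [h3, eq_div_iff (by positivity)] at h
  nlinarith

/-- The defect equals `1 / (4 cosh² (d / 2))`, where `d` is the distance to the base point. Its
decay forces limits of points going to infinity onto the bounding sphere. -/
theorem ball_defect_le (p : Hyp3) : (ball p).2 - (‖(ball p).1‖ ^ 2 + (ball p).2 ^ 2) ≤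
    Real.exp (-dist p base) := by
  have ht := p.t_pos
  rw [ball_defect, four_mul_cosh_sq]
  have hc : Real.exp (dist p base / 2) / 2 ≤ Real.cosh (dist p base / 2) := by
    rw [Real.cosh_eq]
    have := Real.exp_pos (-(dist p base / 2))
    linarith
  have hc2 : Real.exp (dist p base) ≤ 4 * Real.cosh (dist p base / 2) ^ 2 := by
    have : Real.exp (dist p base) = Real.exp (dist p base / 2) ^ 2 := by
      rw [← Real.exp_nat_mul]
      congr 1
      push_cast
      ring
    rw [this]
    nlinarith [Real.exp_pos (dist p base / 2)]
  have hpos : 0 < 4 * p.t * Real.cosh (dist p base / 2) ^ 2 := by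
    have := Real.cosh_pos (dist p base / 2)
    positivity
  rw [Real.exp_neg, div_le_iff₀ hpos, inv_mul_eq_div, le_div_iff₀ (Real.exp_pos _)]
  nlinarith

theorem ball_defect_nonneg (p : Hyp3) :
    0 ≤ (ball p).2 - (‖(ball p).1‖ ^ 2 + (ball p).2 ^ 2) := by
  rw [ball_defect]
  exact div_nonneg p.t_pos.le p.ball_denom_pos.le

theorem norm_sub_inversion_sq (z w : ℂ) (x y : ℝ) (hN : 0 < ‖z‖ ^ 2 + x ^ 2)
    (hM : 0 < ‖w‖ ^ 2 + y ^ 2) :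
    ‖z / ((‖z‖ ^ 2 + x ^ 2 : ℝ) : ℂ) - w / ((‖w‖ ^ 2 + y ^ 2 : ℝ) : ℂ)‖ ^ 2 +
      (x / (‖z‖ ^ 2 + x ^ 2) - y / (‖w‖ ^ 2 + y ^ 2)) ^ 2 =
      (‖z - w‖ ^ 2 + (x - y) ^ 2) / ((‖z‖ ^ 2 + x ^ 2) * (‖w‖ ^ 2 + y ^ 2)) := by
  rw [norm_sub_sq_complex, norm_sub_sq_complex z w]
  simp only [norm_div, Complex.norm_real, Real.norm_of_nonneg hN.le, Real.norm_of_nonneg hM.le,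
    Complex.div_ofReal_re, Complex.div_ofReal_im]
  field_simp
  ring

theorem prod_dist_sq_le (a b : ℂ × ℝ) : dist a b ^ 2 ≤ ‖a.1 - b.1‖ ^ 2 + (a.2 - b.2) ^ 2 := by
  rw [Prod.dist_eq, dist_eq_norm, Real.dist_eq]
  rcases max_choice ‖a.1 - b.1‖ |a.2 - b.2| with h | h <;> rw [h]
  · nlinarith [sq_nonneg (a.2 - b.2)]
  · rw [sq_abs]
    nlinarith [sq_nonneg ‖a.1 - b.1‖]

theorem sinh_half_sq (p q : Hyp3) : ‖p.z - q.z‖ ^ 2 + (p.t - q.t) ^ 2 =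
    4 * p.t * q.t * Real.sinh (dist p q / 2) ^ 2 := by
  have h := cosh_dist p q
  have h2 := Real.cosh_sq' (dist p q / 2)
  have h3 := Real.cosh_two_mul (dist p q / 2)
  rw [mul_div_cancel₀ _ (two_ne_zero' ℝ)] at h3
  have hp := p.t_pos
  have hq := q.t_pos
  rw [h3, h2, eq_div_iff (by positivity)] at h
  nlinarith

/-- The Euclidean distance of the images is exactly `sinh (d(p,q) / 2) / (2 cosh (d(p,o) / 2) cosh
(d(q,o) / 2))` with `o` the base point, the product norm being no larger. This is the source of all
the Hölder estimates below. -/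
theorem ball_dist_le {p q : Hyp3} {c : ℝ} (h : dist p q ≤ c) :
    dist (ball p) (ball q) ≤ Real.exp c * Real.exp (-dist p base) := by
  have hp := p.t_pos
  have hq := q.t_pos
  set P := Real.cosh (dist p base / 2)
  set Q := Real.cosh (dist q base / 2)
  set s := Real.sinh (dist p q / 2)
  have hP : Real.exp (dist p base / 2) / 2 ≤ P := by
    simp only [P, Real.cosh_eq]
    have := Real.exp_pos (-(dist p base / 2))
    linarith
  have hQ : Real.exp (dist q base / 2) / 2 ≤ Q := by
    simp only [Q, Real.cosh_eq]
    have := Real.exp_pos (-(dist q base / 2))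
    linarith
  have hs0 : 0 ≤ s := Real.sinh_nonneg_iff.2 (by positivity)
  have hs : s ≤ Real.exp (dist p q / 2) / 2 := by
    simp only [s, Real.sinh_eq]
    have := Real.exp_pos (-(dist p q / 2))
    linarith
  have hP0 : 0 < P := Real.cosh_pos _
  have hQ0 : 0 < Q := Real.cosh_pos _
  have hsq : dist (ball p) (ball q) ^ 2 ≤ (s / (2 * P * Q)) ^ 2 := by
    refine (prod_dist_sq_le _ _).trans (le_of_eq ?_)
    rw [ball_def, ball_def, norm_sub_inversion_sq _ _ _ _ p.ball_denom_pos q.ball_denom_pos,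
      add_sub_add_right_eq_sub, sinh_half_sq, four_mul_cosh_sq, four_mul_cosh_sq]
    simp only [P, Q, s]
    field_simp
    ring
  have h1 : dist (ball p) (ball q) ≤ s / (2 * P * Q) :=
    le_of_sq_le_sq hsq (by positivity)
  refine h1.trans ?_
  rw [div_le_iff₀ (by positivity)]
  have e1 : Real.exp c * Real.exp (-dist p base) * (2 * (Real.exp (dist p base / 2) / 2) *
      (Real.exp (dist q base / 2) / 2)) =
      Real.exp (c - dist p base / 2 + dist q base / 2) / 2 := by
    rw [show c - dist p base / 2 + dist q base / 2 =
      c + -dist p base + dist p base / 2 + dist q base / 2 by ring, Real.exp_add, Real.exp_add,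
      Real.exp_add]
    ring
  calc s ≤ Real.exp (dist p q / 2) / 2 := hs
    _ ≤ Real.exp (c - dist p base / 2 + dist q base / 2) / 2 := by
      have := dist_triangle p q base
      gcongr
      linarith
    _ = _ := e1.symm
    _ ≤ _ := by gcongr

end Hyp3
end

noncomputable section

namespace Hyp3

/-! ### Neighbourhoods of ideal points -/

/-- The filter of neighbourhoods of an ideal point, in hyperbolic space. -/
def atIdeal (ξ : OnePoint ℂ) : Filter Hyp3 := comap interiorPoint (𝓝 (boundaryPoint ξ))

theorem atIdeal_coe (z : ℂ) : atIdeal z = comap coord (𝓝 (z, 0)) := by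
  have h : interiorPoint = (fun x : ℂ × ℝ => (x : OnePoint (ℂ × ℝ))) ∘ coord := rfl
  have h2 : boundaryPoint z = (((z, 0) : ℂ × ℝ) : OnePoint (ℂ × ℝ)) := rfl
  rw [atIdeal, h, ← comap_comap, h2, OnePoint.comap_coe_nhds]

theorem atIdeal_infty : atIdeal OnePoint.infty = comap (fun p => ‖coord p‖) atTop := by
  have h : interiorPoint = (fun x : ℂ × ℝ => (x : OnePoint (ℂ × ℝ))) ∘ coord := rfl
  have h2 : boundaryPoint OnePoint.infty = OnePoint.infty := rfl
  rw [atIdeal, h, ← comap_comap, h2, OnePoint.comap_coe_nhds_infty,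
    coclosedCompact_eq_cocompact, ← Metric.cobounded_eq_cocompact, ← comap_norm_atTop, comap_comap]
  rfl

theorem tendsto_atIdeal_coe {α : Type*} {l : Filter α} {u : α → Hyp3} {z : ℂ} :
    Tendsto u l (atIdeal z) ↔
      Tendsto (fun i => (u i).z) l (𝓝 z) ∧ Tendsto (fun i => (u i).t) l (𝓝 0) := by
  rw [atIdeal_coe, tendsto_comap_iff, nhds_prod_eq, tendsto_prod_iff']
  rfl

theorem tendsto_atIdeal_infty {α : Type*} {l : Filter α} {u : α → Hyp3} :
    Tendsto u l (atIdeal OnePoint.infty) ↔ Tendsto (fun i => ‖(u i).coord‖) l atTop := by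
  rw [atIdeal_infty, tendsto_comap_iff]
  rfl

/-- The inverse of `ballCoord`. -/
def ballCoordInv (x : ℂ × ℝ) : ℂ × ℝ :=
  (x.1 / ((‖x.1‖ ^ 2 + x.2 ^ 2 : ℝ) : ℂ), x.2 / (‖x.1‖ ^ 2 + x.2 ^ 2) - 1)

theorem ballCoordInv_ballCoord {x : ℂ × ℝ} (hx : 0 ≤ x.2) : ballCoordInv (ballCoord x) = x := by
  have hN : 0 < ‖x.1‖ ^ 2 + (x.2 + 1) ^ 2 := by positivity
  have hN' : ((‖x.1‖ ^ 2 + (x.2 + 1) ^ 2 : ℝ) : ℂ) ≠ 0 := Complex.ofReal_ne_zero.2 hN.ne'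
  have key : ‖(ballCoord x).1‖ ^ 2 + (ballCoord x).2 ^ 2 =
      (‖x.1‖ ^ 2 + (x.2 + 1) ^ 2)⁻¹ := by
    simp only [ballCoord, norm_div, Complex.norm_real, Real.norm_of_nonneg hN.le]
    field_simp
  rw [ballCoordInv, key]
  refine Prod.ext ?_ ?_
  · simp only [ballCoord, Complex.ofReal_inv]
    field_simp
  · simp only [ballCoord]
    field_simp
    ring

theorem continuousAt_ballCoord {x : ℂ × ℝ} (hx : 0 ≤ x.2) : ContinuousAt ballCoord x := by
  have hN : 0 < ‖x.1‖ ^ 2 + (x.2 + 1) ^ 2 := by positivity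
  have hN' : ((‖x.1‖ ^ 2 + (x.2 + 1) ^ 2 : ℝ) : ℂ) ≠ 0 := Complex.ofReal_ne_zero.2 hN.ne'
  have hc : Continuous fun x : ℂ × ℝ => ‖x.1‖ ^ 2 + (x.2 + 1) ^ 2 := by fun_prop
  refine ContinuousAt.prodMk ?_ ?_
  · exact continuousAt_fst.div (Complex.continuous_ofReal.continuousAt.comp hc.continuousAt) hN'
  · exact (continuousAt_snd.add continuousAt_const).div hc.continuousAt hN.ne'

theorem continuousAt_ballCoordInv {x : ℂ × ℝ} (hN : 0 < ‖x.1‖ ^ 2 + x.2 ^ 2) :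
    ContinuousAt ballCoordInv x := by
  have hN' : ((‖x.1‖ ^ 2 + x.2 ^ 2 : ℝ) : ℂ) ≠ 0 := Complex.ofReal_ne_zero.2 hN.ne'
  have hc : Continuous fun x : ℂ × ℝ => ‖x.1‖ ^ 2 + x.2 ^ 2 := by fun_prop
  refine ContinuousAt.prodMk ?_ ?_
  · exact continuousAt_fst.div (Complex.continuous_ofReal.continuousAt.comp hc.continuousAt) hN'
  · exact (continuousAt_snd.div hc.continuousAt hN.ne').sub continuousAt_const

theorem norm_ballCoord_sq {x : ℂ × ℝ} (hx : 0 ≤ x.2) :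
    ‖(ballCoord x).1‖ ^ 2 + (ballCoord x).2 ^ 2 = (‖x.1‖ ^ 2 + (x.2 + 1) ^ 2)⁻¹ := by
  have hN : 0 < ‖x.1‖ ^ 2 + (x.2 + 1) ^ 2 := by positivity
  simp only [ballCoord, norm_div, Complex.norm_real, Real.norm_of_nonneg hN.le]
  field_simp

theorem norm_ballCoord_le {x : ℂ × ℝ} (hx : 0 ≤ x.2) (hx0 : 0 < ‖x‖) :
    ‖ballCoord x‖ ≤ ‖x‖⁻¹ := by
  have h := prod_dist_sq_le (ballCoord x) 0
  simp only [dist_zero_right, Prod.fst_zero, Prod.snd_zero, sub_zero] at h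
  rw [norm_ballCoord_sq hx] at h
  refine le_of_sq_le_sq (h.trans ?_) (by positivity)
  rw [inv_pow]
  refine inv_anti₀ (by positivity) ?_
  have h2 := prod_dist_sq_le x 0
  simp only [dist_zero_right, Prod.fst_zero, Prod.snd_zero, sub_zero] at h2
  nlinarith

theorem le_norm_of_norm_ballCoord_le {x : ℂ × ℝ} (hx : 0 ≤ x.2) :
    (2 * ‖ballCoord x‖)⁻¹ - 1 ≤ ‖x‖ := by
  have h1 : ‖(ballCoord x).1‖ ≤ ‖ballCoord x‖ := le_max_left _ _
  have h2 : |(ballCoord x).2| ≤ ‖ballCoord x‖ := le_max_right _ _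
  have h3 : ‖x.1‖ ≤ ‖x‖ := le_max_left _ _
  have h4 : |x.2| ≤ ‖x‖ := le_max_right _ _
  have h := norm_ballCoord_sq hx
  set b := ‖ballCoord x‖
  have hb : (‖x.1‖ ^ 2 + (x.2 + 1) ^ 2)⁻¹ ≤ 2 * b ^ 2 := by
    rw [← h, ← sq_abs (ballCoord x).2]
    nlinarith [norm_nonneg (ballCoord x).1, abs_nonneg (ballCoord x).2]
  have hN : 0 < ‖x.1‖ ^ 2 + (x.2 + 1) ^ 2 := by positivity
  have hN2 : ‖x.1‖ ^ 2 + (x.2 + 1) ^ 2 ≤ 2 * (‖x‖ + 1) ^ 2 := by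
    rw [abs_of_nonneg hx] at h4
    nlinarith [norm_nonneg x.1]
  have hb0 : 0 < b := by
    by_contra hcon
    have : b = 0 := le_antisymm (not_lt.1 hcon) (norm_nonneg _)
    rw [this] at hb
    have := inv_pos.2 hN
    linarith
  rw [inv_le_iff_one_le_mul₀ hN] at hb
  rw [sub_le_iff_le_add, inv_le_iff_one_le_mul₀ (by positivity)]
  have h5 : 1 ≤ (2 * b * (‖x‖ + 1)) ^ 2 := by nlinarith [sq_nonneg b]
  have h6 : 0 ≤ 2 * b * (‖x‖ + 1) := by positivity
  nlinarith

/-- In the ball all ideal points, `∞` included, are points of a compact sphere, so convergence to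
them can be tested with Cauchy sequences and a single metric. At `∞` this is the two-sided
comparison of `‖ball p‖` with the inverse of `‖p.coord‖`; elsewhere `ballCoord` has a continuous
inverse. -/
theorem atIdeal_eq_comap_ball (ξ : OnePoint ℂ) :
    atIdeal ξ = comap ball (𝓝 (idealBall ξ)) := by
  induction ξ using OnePoint.rec with
  | infty =>
    refine le_antisymm (tendsto_iff_comap.1 ?_) ?_
    · rw [idealBall_infty]
      have h1 : Tendsto (fun p : Hyp3 => ‖coord p‖) (atIdeal OnePoint.infty) atTop := by
        rw [atIdeal_infty]
        exact tendsto_comap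
      refine squeeze_zero_norm' ?_ h1.inv_tendsto_atTop
      filter_upwards [h1.eventually_gt_atTop 0] with p hp
      exact norm_ballCoord_le p.t_pos.le hp
    · rw [atIdeal_infty, ← tendsto_iff_comap, idealBall_infty]
      have h1 : Tendsto (fun p : Hyp3 => ‖ball p‖) (comap ball (𝓝 0)) (𝓝 0) :=
        tendsto_norm_zero.comp tendsto_comap
      have hpos : ∀ p : Hyp3, 0 < ‖ball p‖ := fun p => by
        refine norm_pos_iff.2 fun h => ?_
        have h2 : (p.t + 1) / (‖p.z‖ ^ 2 + (p.t + 1) ^ 2) = 0 := congrArg Prod.snd h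
        have := p.t_pos
        have := p.ball_denom_pos
        have : 0 < (p.t + 1) / (‖p.z‖ ^ 2 + (p.t + 1) ^ 2) := by positivity
        linarith
      have h2 : Tendsto (fun p : Hyp3 => (2 * ‖ball p‖)⁻¹ - 1) (comap ball (𝓝 0)) atTop := by
        refine tendsto_atTop_add_const_right _ _ (Tendsto.inv_tendsto_nhdsGT_zero ?_)
        refine tendsto_nhdsWithin_iff.2 ⟨by simpa using h1.const_mul 2, ?_⟩
        exact Eventually.of_forall fun p => mul_pos two_pos (hpos p)
      exact tendsto_atTop_mono (fun p => le_norm_of_norm_ballCoord_le p.t_pos.le) h2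
  | coe z =>
    rw [atIdeal_coe, idealBall_coe]
    refine le_antisymm (tendsto_iff_comap.1 ?_) (tendsto_iff_comap.1 ?_)
    · exact (continuousAt_ballCoord (x := (z, 0)) le_rfl).tendsto.comp tendsto_comap
    · have h := (continuousAt_ballCoordInv (x := ballCoord (z, 0)) ?_).tendsto.comp
        (tendsto_comap (f := ball))
      · rw [ballCoordInv_ballCoord le_rfl] at h
        refine h.congr fun p => ?_
        exact ballCoordInv_ballCoord p.t_pos.le
      · rw [norm_ballCoord_sq le_rfl]
        positivity

theorem tendsto_atIdeal_iff_ball {α : Type*} {l : Filter α} {u : α → Hyp3} {ξ : OnePoint ℂ} :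
    Tendsto u l (atIdeal ξ) ↔ Tendsto (fun i => ball (u i)) l (𝓝 (idealBall ξ)) := by
  rw [atIdeal_eq_comap_ball, tendsto_comap_iff]
  rfl

/-- The point `(z, t)` for positive `t` (and `(z, 1)` otherwise). -/
def above (z : ℂ) (t : ℝ) : Hyp3 := if h : 0 < t then ⟨z, t, h⟩ else ⟨z, 1, one_pos⟩

@[simp] theorem above_z (z : ℂ) (t : ℝ) : (above z t).z = z := by
  unfold above
  split_ifs <;> rfl

theorem above_t (z : ℂ) {t : ℝ} (ht : 0 < t) : (above z t).t = t := by
  simp [above, ht]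

theorem above_eta (p : Hyp3) : above p.z p.t = p := by
  ext
  · simp
  · exact above_t _ p.t_pos

theorem tendsto_above (z : ℂ) : Tendsto (above z) (𝓝[>] 0) (atIdeal z) := by
  refine tendsto_atIdeal_coe.2 ⟨by simp, ?_⟩
  refine (tendsto_nhdsWithin_of_tendsto_nhds tendsto_id).congr' ?_
  filter_upwards [self_mem_nhdsWithin] with t ht
  exact (above_t z ht).symm

instance (ξ : OnePoint ℂ) : (atIdeal ξ).NeBot := by
  induction ξ using OnePoint.rec with
  | infty =>
    have : Tendsto (above 0) atTop (atIdeal OnePoint.infty) := by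
      refine tendsto_atIdeal_infty.2 (tendsto_atTop_mono' _ ?_ tendsto_id)
      filter_upwards [eventually_gt_atTop 0] with t ht
      have h : |(above 0 t).t| ≤ ‖(above 0 t).coord‖ := le_max_right _ _
      rw [above_t 0 ht] at h
      exact (le_abs_self t).trans h
    exact this.neBot
  | coe z => exact (tendsto_above z).neBot

/-- The hypothesis is the equation of the bounding sphere, and `w / y` is the stereographic
projection from its lowest point. -/
theorem mem_range_idealBall {x : ℂ × ℝ} (hx : x.2 = ‖x.1‖ ^ 2 + x.2 ^ 2) :
    x ∈ range idealBall := by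
  obtain ⟨w, y⟩ := x
  simp only at hx
  by_cases hy : y = 0
  · refine ⟨OnePoint.infty, ?_⟩
    subst hy
    have : ‖w‖ ^ 2 = 0 := by nlinarith
    have hw : w = 0 := by simpa using this
    rw [hw]
    rfl
  · refine ⟨((w / (y : ℂ) : ℂ) : OnePoint ℂ), ?_⟩
    have hy' : (y : ℂ) ≠ 0 := Complex.ofReal_ne_zero.2 hy
    have key : ‖w / (y : ℂ)‖ ^ 2 + (0 + 1) ^ 2 = y⁻¹ := by
      rw [norm_div, Complex.norm_real, div_pow, Real.norm_eq_abs, sq_abs]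
      field_simp
      linarith
    rw [idealBall_coe, ballCoord]
    simp only
    rw [key]
    refine Prod.ext ?_ ?_
    · simp only [Complex.ofReal_inv]
      field_simp
    · simp

theorem idealBall_injective : Function.Injective idealBall := by
  have hpos : ∀ z : ℂ, (idealBall z).2 ≠ 0 := fun z => by
    rw [idealBall_coe]
    simp only [ballCoord]
    positivity
  intro ξ η h
  induction ξ using OnePoint.rec with
  | infty =>
    induction η using OnePoint.rec with
    | infty => rfl
    | coe w => exact absurd (congrArg Prod.snd h).symm (hpos w)
  | coe z =>
    induction η using OnePoint.rec with
    | infty => exact absurd (congrArg Prod.snd h) (hpos z)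
    | coe w =>
      rw [idealBall_coe, idealBall_coe] at h
      have := congrArg ballCoordInv h
      rw [ballCoordInv_ballCoord le_rfl, ballCoordInv_ballCoord le_rfl] at this
      exact congrArg (fun x : ℂ × ℝ => (x.1 : OnePoint ℂ)) this

theorem continuous_idealBall : Continuous idealBall := by
  refine continuous_iff_continuousAt.2 fun ξ => ?_
  induction ξ using OnePoint.rec with
  | infty =>
    rw [OnePoint.continuousAt_infty', coclosedCompact_eq_cocompact,
      ← Metric.cobounded_eq_cocompact, idealBall_infty]
    refine squeeze_zero_norm' ?_ (tendsto_norm_cobounded_atTop.inv_tendsto_atTop)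
    filter_upwards [tendsto_norm_cobounded_atTop.eventually_gt_atTop 0] with z hz
    have h : ‖((z, 0) : ℂ × ℝ)‖ = ‖z‖ := by simp [Prod.norm_def]
    have := norm_ballCoord_le (x := (z, 0)) le_rfl (by rwa [h])
    rwa [h] at this
  | coe z =>
    rw [OnePoint.continuousAt_coe]
    exact (continuousAt_ballCoord (x := (z, 0)) le_rfl).comp
      (f := fun z : ℂ => ((z, 0) : ℂ × ℝ)) (by fun_prop)

theorem isClosedEmbedding_idealBall : IsClosedEmbedding idealBall :=
  continuous_idealBall.isClosedEmbedding idealBall_injective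

theorem eq_of_tendsto_atIdeal {α : Type*} {l : Filter α} [l.NeBot] {u : α → Hyp3}
    {ξ η : OnePoint ℂ} (h1 : Tendsto u l (atIdeal ξ)) (h2 : Tendsto u l (atIdeal η)) : ξ = η :=
  idealBall_injective (tendsto_nhds_unique (tendsto_atIdeal_iff_ball.1 h1)
    (tendsto_atIdeal_iff_ball.1 h2))

end Hyp3
end

noncomputable section

namespace Hyp3

/-! ### Boundary values of bi-Lipschitz maps -/

/-- A bijection that is Lipschitz, together with its inverse, with constant `K`. -/
structure BiLip (K : ℝ) (H : Hyp3 ≃ Hyp3) : Prop where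
  one_le : 1 ≤ K
  le : ∀ p q, dist (H p) (H q) ≤ K * dist p q
  ge : ∀ p q, dist p q ≤ K * dist (H p) (H q)

namespace BiLip

variable {K : ℝ} {H : Hyp3 ≃ Hyp3}

theorem pos (hH : BiLip K H) : 0 < K := zero_lt_one.trans_le hH.one_le

theorem symm (hH : BiLip K H) : BiLip K H.symm where
  one_le := hH.one_le
  le p q := by simpa using hH.ge (H.symm p) (H.symm q)
  ge p q := by simpa using hH.le (H.symm p) (H.symm q)

theorem of_isometry (φ : Hyp3 ≃ᵢ Hyp3) : BiLip 1 φ.toEquiv where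
  one_le := le_rfl
  le p q := by rw [one_mul]; exact (φ.dist_eq p q).le
  ge p q := by rw [one_mul]; exact (φ.dist_eq p q).ge

theorem trans_isometry (hH : BiLip K H) (φ : Hyp3 ≃ᵢ Hyp3) : BiLip K (H.trans φ.toEquiv) where
  one_le := hH.one_le
  le p q := (φ.dist_eq _ _).trans_le (hH.le p q)
  ge p q := (hH.ge p q).trans_eq (congrArg (K * ·) (φ.dist_eq _ _).symm)

theorem isometry_trans (hH : BiLip K H) (φ : Hyp3 ≃ᵢ Hyp3) : BiLip K (φ.toEquiv.trans H) where
  one_le := hH.one_le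
  le p q := (hH.le (φ p) (φ q)).trans_eq (congrArg (K * ·) (φ.dist_eq p q))
  ge p q := (φ.dist_eq p q).symm.trans_le (hH.ge (φ p) (φ q))

protected theorem continuous (hH : BiLip K H) : Continuous H :=
  (LipschitzWith.of_dist_le_mul (K := ⟨K, hH.pos.le⟩) hH.le).continuous

/-- A bi-Lipschitz map with constant one, as an isometry. -/
def toIsometry (hH : BiLip 1 H) : Hyp3 ≃ᵢ Hyp3 where
  toEquiv := H
  isometry_toFun := Isometry.of_dist_eq fun p q =>
    le_antisymm (by simpa using hH.le p q) (by simpa using hH.ge p q)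

theorem dist_base_ge (hH : BiLip K H) {R : ℝ} (hR : dist (H base) base ≤ R) (p : Hyp3) :
    dist p base / K - R ≤ dist (H p) base := by
  have h1 : dist p base / K ≤ dist (H p) (H base) := by
    rw [div_le_iff₀' hH.pos]
    exact hH.ge p base
  have h2 := dist_triangle_right (H p) (H base) base
  have h3 := dist_triangle (H p) base (H base)
  rw [dist_comm base] at h3
  linarith

/-- A point of height `t` is at distance at least `-log t` from the base point, and `H` divides this
by at most `K`. The Hölder exponent `1 / K` arises here. -/
theorem exp_neg_dist_le (hH : BiLip K H) {R : ℝ} (hR : dist (H base) base ≤ R) (p : Hyp3) :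
    Real.exp (-dist (H p) base) ≤ Real.exp R * p.t ^ (1 / K) := by
  rw [Real.rpow_def_of_pos p.t_pos, ← Real.exp_add, Real.exp_le_exp]
  have h1 := hH.dist_base_ge hR p
  have h2 := neg_log_height_le_dist p
  have h3 : -Real.log p.t / K ≤ dist p base / K := by
    have := hH.pos
    gcongr
  have h4 : Real.log p.t * (1 / K) = -(-Real.log p.t / K) := by ring
  linarith

theorem ball_dist_step (hH : BiLip K H) {R : ℝ} (hR : dist (H base) base ≤ R) {p q : Hyp3}
    (h : dist p q ≤ 1) :
    dist (ball (H p)) (ball (H q)) ≤ Real.exp (K + R) * p.t ^ (1 / K) := by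
  have h1 : dist (H p) (H q) ≤ K := (hH.le p q).trans (by have := hH.pos; nlinarith)
  refine (ball_dist_le h1).trans ?_
  rw [Real.exp_add, mul_assoc]
  gcongr
  exact hH.exp_neg_dist_le hR p

end BiLip

/-! ### Hölder estimates and existence of boundary values -/

/-- The constant in the Hölder estimate for boundary values. -/
def holderConst (K R : ℝ) : ℝ := Real.exp (K + R) / (1 - Real.exp (-(1 / K)))

/-- The constant is the sum of a geometric series of ratio `exp (-1 / K)`; this self-similarity
closes the induction over unit steps. -/
theorem holderConst_spec {K : ℝ} (R : ℝ) (hK : 0 < K) :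
    Real.exp (K + R) + holderConst K R * Real.exp (-(1 / K)) = holderConst K R := by
  have : Real.exp (-(1 / K)) < 1 := by
    rw [Real.exp_lt_one_iff]
    have : 0 < 1 / K := by positivity
    linarith
  have h : 1 - Real.exp (-(1 / K)) ≠ 0 := by linarith
  rw [holderConst]
  field_simp
  ring

theorem exp_le_holderConst {K : ℝ} (R : ℝ) (hK : 0 < K) :
    Real.exp (K + R) ≤ holderConst K R := by
  have h : Real.exp (-(1 / K)) < 1 := by
    rw [Real.exp_lt_one_iff]
    have : 0 < 1 / K := by positivity
    linarith
  have h2 := Real.exp_pos (-(1 / K))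
  rw [holderConst, le_div_iff₀ (by linarith)]
  nlinarith [Real.exp_pos (K + R)]

theorem holderConst_pos {K : ℝ} (R : ℝ) (hK : 0 < K) : 0 < holderConst K R :=
  (Real.exp_pos _).trans_le (exp_le_holderConst R hK)

namespace BiLip

variable {K : ℝ} {H : Hyp3 ≃ Hyp3}

theorem ball_dist_vertical (hH : BiLip K H) {R : ℝ} (hR : dist (H base) base ≤ R) (z : ℂ)
    {t τ : ℝ} (ht : 0 < t) (htτ : t ≤ τ) :
    dist (ball (H (above z τ))) (ball (H (above z t))) ≤ holderConst K R * τ ^ (1 / K) := by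
  have hK := hH.pos
  -- Descend from height `τ` to `t` by unit hyperbolic steps, each dividing the height by `e` and so
  -- the error `τ ^ (1 / K)` by `exp (1 / K)`. The number `n` bounds `log (τ / t)`, and `τ` varies
  -- because the induction hypothesis is applied at `τ / e`.
  have main : ∀ n : ℕ, ∀ τ, t ≤ τ → τ * Real.exp (-n) ≤ t →
      dist (ball (H (above z τ))) (ball (H (above z t))) ≤ holderConst K R * τ ^ (1 / K) := by
    intro n
    induction n with
    | zero =>
      intro τ h1 h2
      have : τ = t := le_antisymm (by simpa using h2) h1
      rw [this, dist_self]
      exact mul_nonneg (holderConst_pos R hK).le (Real.rpow_nonneg ht.le _)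
    | succ n ih =>
      intro τ h1 h2
      have hτ : 0 < τ := ht.trans_le h1
      have he : Real.exp (-1) * Real.exp 1 = 1 := by rw [← Real.exp_add]; simp
      have he1 : 1 ≤ Real.exp 1 := Real.one_le_exp zero_le_one
      by_cases hc : τ * Real.exp (-1) ≤ t
      · have hd : dist (above z τ) (above z t) ≤ 1 := by
          refine dist_vertical_le (by simp) zero_le_one ?_ ?_
          · rw [above_t z hτ, above_t z ht]
            nlinarith [Real.exp_pos 1]
          · rw [above_t z hτ, above_t z ht]
            nlinarith
        refine (hH.ball_dist_step hR hd).trans ?_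
        rw [above_t z hτ]
        have := exp_le_holderConst R hK
        gcongr
      · push Not at hc
        have hτ' : 0 < τ * Real.exp (-1) := by positivity
        have hd : dist (above z τ) (above z (τ * Real.exp (-1))) ≤ 1 := by
          refine dist_vertical_le (by simp) zero_le_one ?_ ?_
          · rw [above_t z hτ, above_t z hτ', mul_assoc, he, mul_one]
          · rw [above_t z hτ, above_t z hτ']
            gcongr
            norm_num
        have h3 := ih (τ * Real.exp (-1)) hc.le (by
          rw [mul_assoc, ← Real.exp_add]
          convert h2 using 3
          push_cast
          ring)
        refine (dist_triangle _ _ _).trans ((add_le_add (hH.ball_dist_step hR hd) h3).trans ?_)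
        have e1 : (τ * Real.exp (-1)) ^ (1 / K) = τ ^ (1 / K) * Real.exp (-(1 / K)) := by
          rw [Real.mul_rpow hτ.le (Real.exp_pos _).le, ← Real.exp_mul]
          congr 2
          ring
        rw [above_t z hτ, e1]
        refine le_of_eq ?_
        have := holderConst_spec R hK
        calc _ = (Real.exp (K + R) + holderConst K R * Real.exp (-(1 / K))) * τ ^ (1 / K) := by
              ring
          _ = _ := by rw [this]
  obtain ⟨n, hn⟩ := exists_nat_ge (Real.log (τ / t))
  have hτ : 0 < τ := ht.trans_le htτ
  refine main n τ htτ ?_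
  rw [Real.log_le_iff_le_exp (by positivity), div_le_iff₀ ht] at hn
  rw [Real.exp_neg, ← div_eq_mul_inv, div_le_iff₀ (Real.exp_pos _), mul_comm]
  exact hn

/-- Rise from `p` to height `τ`, cross over, and descend to `q`. At height `τ` the crossing is a
single step of length at most one, so each of the three legs costs at most `holderConst K R * τ ^ (1
/ K)`. -/
theorem ball_dist_le_of_low (hH : BiLip K H) {R : ℝ} (hR : dist (H base) base ≤ R) {p q : Hyp3}
    {τ : ℝ} (hp : p.t ≤ τ) (hq : q.t ≤ τ) (hpq : ‖p.z - q.z‖ ≤ τ) :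
    dist (ball (H p)) (ball (H q)) ≤ 3 * holderConst K R * τ ^ (1 / K) := by
  have hτ : 0 < τ := p.t_pos.trans_le hp
  have h1 := hH.ball_dist_vertical hR p.z p.t_pos hp
  have h2 := hH.ball_dist_vertical hR q.z q.t_pos hq
  rw [above_eta] at h1 h2
  have hd : dist (above p.z τ) (above q.z τ) ≤ 1 := by
    refine dist_horizontal_le ?_ ?_
    · rw [above_t _ hτ, above_t _ hτ]
    · rwa [above_t _ hτ, above_z, above_z]
  have h3 := hH.ball_dist_step hR hd
  rw [above_t _ hτ] at h3
  have h4 := exp_le_holderConst R hH.pos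
  have h5 : Real.exp (K + R) * τ ^ (1 / K) ≤ holderConst K R * τ ^ (1 / K) := by gcongr
  have h6 := dist_triangle4 (ball (H p)) (ball (H (above p.z τ))) (ball (H (above q.z τ)))
    (ball (H q))
  rw [dist_comm (ball (H p)) (ball (H (above p.z τ)))] at h6
  linarith

theorem ball_dist_above (hH : BiLip K H) {R : ℝ} (hR : dist (H base) base ≤ R) {z w : ℂ}
    {τ : ℝ} (hτ : 0 < τ) (hzw : ‖z - w‖ ≤ τ) :
    dist (ball (H (above z τ))) (ball (H (above w τ))) ≤ 3 * holderConst K R * τ ^ (1 / K) := by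
  refine hH.ball_dist_le_of_low hR ?_ ?_ (by simpa using hzw)
  · rw [above_t _ hτ]
  · rw [above_t _ hτ]

/-- Near `z` the images are Cauchy in the ball, by `ball_dist_le_of_low`. The limit lies on the
bounding sphere because the defect of the images tends to zero. -/
theorem exists_tendsto_coe (hH : BiLip K H) (z : ℂ) :
    ∃ η, Tendsto H (atIdeal z) (atIdeal η) := by
  set R := dist (H base) base with hRdef
  have hR : dist (H base) base ≤ R := le_rfl
  have hK := hH.pos
  have hlow : ∀ τ : ℝ, 0 < τ → ∀ᶠ p in atIdeal z, p.t < τ ∧ ‖p.z - z‖ < τ / 2 := by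
    intro τ hτ
    have h := (tendsto_atIdeal_coe (u := id) (z := z)).1 tendsto_id
    have h1 := h.1.eventually (Metric.ball_mem_nhds z (half_pos hτ))
    filter_upwards [h1, h.2.eventually (gt_mem_nhds hτ)] with p hp1 hp2
    exact ⟨hp2, by simpa [dist_eq_norm] using hp1⟩
  have hpow : Tendsto (fun τ : ℝ => 3 * holderConst K R * τ ^ (1 / K)) (𝓝[>] 0) (𝓝 0) := by
    have h1 : Tendsto (fun τ : ℝ => τ ^ (1 / K)) (𝓝[>] 0) (𝓝 ((0 : ℝ) ^ (1 / K))) :=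
      ((Real.continuousAt_rpow_const 0 (1 / K) (Or.inr (by positivity))).tendsto).mono_left
        nhdsWithin_le_nhds
    rw [Real.zero_rpow (by positivity)] at h1
    simpa using h1.const_mul (3 * holderConst K R)
  have hcauchy : Cauchy (map (fun p => ball (H p)) (atIdeal z)) := by
    refine Metric.cauchy_iff.2 ⟨inferInstance, fun ε hε => ?_⟩
    obtain ⟨τ, hτε, hτ⟩ := ((hpow.eventually (gt_mem_nhds hε)).and self_mem_nhdsWithin).exists
    refine ⟨_, image_mem_map (hlow τ hτ), ?_⟩
    rintro _ ⟨p, hp, rfl⟩ _ ⟨q, hq, rfl⟩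
    refine (hH.ball_dist_le_of_low hR hp.1.le hq.1.le ?_).trans_lt hτε
    have h := norm_sub_le_norm_sub_add_norm_sub p.z z q.z
    have h2 := hq.2
    rw [norm_sub_rev] at h2
    linarith [hp.2]
  obtain ⟨x, hx⟩ := CompleteSpace.complete hcauchy
  have hx' : Tendsto (fun p => ball (H p)) (atIdeal z) (𝓝 x) := hx
  have hxs : x ∈ range idealBall := by
    refine mem_range_idealBall (sub_eq_zero.1 ?_)
    have hc : Continuous fun x : ℂ × ℝ => x.2 - (‖x.1‖ ^ 2 + x.2 ^ 2) := by fun_prop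
    refine tendsto_nhds_unique ((hc.tendsto x).comp hx') ?_
    have ht : Tendsto (fun p : Hyp3 => p.t) (atIdeal z) (𝓝 0) :=
      ((tendsto_atIdeal_coe (u := id) (z := z)).1 tendsto_id).2
    have h1 : Tendsto (fun p : Hyp3 => Real.exp R * p.t ^ (1 / K)) (atIdeal z) (𝓝 0) := by
      have := ((Real.continuousAt_rpow_const 0 (1 / K) (Or.inr (by positivity))).tendsto.comp
        ht).const_mul (Real.exp R)
      rw [Real.zero_rpow (by positivity), mul_zero] at this
      exact this
    exact squeeze_zero (fun p => ball_defect_nonneg _)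
      (fun p => (ball_defect_le _).trans (hH.exp_neg_dist_le hR p)) h1
  obtain ⟨η, rfl⟩ := hxs
  exact ⟨η, tendsto_atIdeal_iff_ball.2 hx'⟩

end BiLip

/-! ### The boundary map and its continuity -/

theorem tendsto_inversion_infty : Tendsto inversion (atIdeal OnePoint.infty) (atIdeal (0 : ℂ)) := by
  rw [tendsto_atIdeal_iff_ball]
  have h := (tendsto_atIdeal_iff_ball (u := id) (ξ := OnePoint.infty)).1 tendsto_id
  have hc : Continuous fun x : ℂ × ℝ => (x.1, 1 - x.2) := by fun_prop
  have h2 := (hc.tendsto _).comp h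
  convert h2 using 2
  · exact ball_inversion _
  · simp [idealBall_coe, ballCoord]

theorem BiLip.exists_tendsto {K : ℝ} {H : Hyp3 ≃ Hyp3} (hH : BiLip K H) (ξ : OnePoint ℂ) :
    ∃ η, Tendsto H (atIdeal ξ) (atIdeal η) := by
  induction ξ using OnePoint.rec with
  | infty =>
    obtain ⟨η, hη⟩ := (hH.isometry_trans inversion).exists_tendsto_coe 0
    refine ⟨η, (hη.comp tendsto_inversion_infty).congr fun p => ?_⟩
    exact congrArg H (inversion_inversion p)
  | coe z => exact hH.exists_tendsto_coe z

open Classical in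
/-- The boundary value map of a self-map of hyperbolic space, where it exists. -/
def bdry (H : Hyp3 → Hyp3) (ξ : OnePoint ℂ) : OnePoint ℂ :=
  if h : ∃ η, Tendsto H (atIdeal ξ) (atIdeal η) then h.choose else ξ

theorem bdry_eq {H : Hyp3 → Hyp3} {ξ η : OnePoint ℂ} (h : Tendsto H (atIdeal ξ) (atIdeal η)) :
    bdry H ξ = η := by
  have hex : ∃ η, Tendsto H (atIdeal ξ) (atIdeal η) := ⟨η, h⟩
  rw [bdry, dif_pos hex]
  exact eq_of_tendsto_atIdeal hex.choose_spec h

theorem BiLip.tendsto_bdry {K : ℝ} {H : Hyp3 ≃ Hyp3} (hH : BiLip K H) (ξ : OnePoint ℂ) :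
    Tendsto H (atIdeal ξ) (atIdeal (bdry H ξ)) := by
  obtain ⟨η, h⟩ := hH.exists_tendsto ξ
  rwa [bdry_eq h]

theorem tendsto_bdry_isometry (φ : Hyp3 ≃ᵢ Hyp3) (ξ : OnePoint ℂ) :
    Tendsto φ (atIdeal ξ) (atIdeal (bdry φ ξ)) :=
  (BiLip.of_isometry φ).tendsto_bdry ξ

theorem bdry_id (ξ : OnePoint ℂ) : bdry id ξ = ξ := bdry_eq tendsto_id

theorem bdry_comp {H G : Hyp3 → Hyp3} {ξ : OnePoint ℂ}
    (hG : Tendsto G (atIdeal ξ) (atIdeal (bdry G ξ)))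
    (hH : Tendsto H (atIdeal (bdry G ξ)) (atIdeal (bdry H (bdry G ξ)))) :
    bdry (H ∘ G) ξ = bdry H (bdry G ξ) :=
  bdry_eq (hH.comp hG)

theorem BiLip.bdry_symm_bdry {K : ℝ} {H : Hyp3 ≃ Hyp3} (hH : BiLip K H) (ξ : OnePoint ℂ) :
    bdry H.symm (bdry H ξ) = ξ := by
  rw [← bdry_comp (hH.tendsto_bdry ξ) (hH.symm.tendsto_bdry _), Equiv.symm_comp_self, bdry_id]

theorem BiLip.bdry_bdry_symm {K : ℝ} {H : Hyp3 ≃ Hyp3} (hH : BiLip K H) (ξ : OnePoint ℂ) :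
    bdry H (bdry H.symm ξ) = ξ := hH.symm.bdry_symm_bdry ξ

theorem bdry_symm_bdry_isometry (φ : Hyp3 ≃ᵢ Hyp3) (ξ : OnePoint ℂ) :
    bdry φ.symm (bdry φ ξ) = ξ := (BiLip.of_isometry φ).bdry_symm_bdry ξ

theorem bdry_bdry_symm_isometry (φ : Hyp3 ≃ᵢ Hyp3) (ξ : OnePoint ℂ) :
    bdry φ (bdry φ.symm ξ) = ξ := (BiLip.of_isometry φ).bdry_bdry_symm ξ

theorem BiLip.bdry_injective {K : ℝ} {H : Hyp3 ≃ Hyp3} (hH : BiLip K H) :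
    Function.Injective (bdry H) :=
  Function.LeftInverse.injective hH.bdry_symm_bdry

theorem bdry_inversion_infty : bdry inversion OnePoint.infty = (0 : ℂ) :=
  bdry_eq tendsto_inversion_infty

theorem bdry_inversion_zero : bdry inversion (0 : ℂ) = OnePoint.infty := by
  rw [← bdry_inversion_infty, ← bdry_comp (tendsto_bdry_isometry _ _) (tendsto_bdry_isometry _ _)]
  have : (inversion ∘ inversion : Hyp3 → Hyp3) = id := funext inversion_inversion
  rw [this, bdry_id]

theorem BiLip.ball_dist_bdry {K : ℝ} {H : Hyp3 ≃ Hyp3} (hH : BiLip K H) {R : ℝ}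
    (hR : dist (H base) base ≤ R) (z : ℂ) {τ : ℝ} (hτ : 0 < τ) :
    dist (idealBall (bdry H z)) (ball (H (above z τ))) ≤ 3 * holderConst K R * τ ^ (1 / K) := by
  have h := (tendsto_atIdeal_iff_ball.1 (hH.tendsto_bdry z)).comp (tendsto_above z)
  refine le_of_tendsto (h.dist tendsto_const_nhds) ?_
  filter_upwards [Ioc_mem_nhdsGT hτ] with t ht
  refine hH.ball_dist_le_of_low hR ?_ ?_ (by simpa using hτ.le)
  · rw [above_t _ ht.1]
    exact ht.2
  · rw [above_t _ hτ]

theorem continuous_ball : Continuous ball := by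
  refine continuous_iff_continuousAt.2 fun p => ?_
  exact (continuousAt_ballCoord (x := p.coord) p.t_pos.le).comp
    isOpenEmbedding_coord.continuous.continuousAt

/-- Boundary values depend continuously on the map and the ideal point, within the maps that are
bi-Lipschitz with a given constant. -/
theorem tendsto_bdry_of_tendsto_coe {ι : Type*} {l : Filter ι} {K R : ℝ} {F : ι → Hyp3 ≃ Hyp3}
    {H : Hyp3 ≃ Hyp3} (hF : ∀ᶠ i in l, BiLip K (F i)) (hFR : ∀ᶠ i in l, dist (F i base) base ≤ R)
    (hH : BiLip K H) (hHR : dist (H base) base ≤ R)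
    (hlim : ∀ p, Tendsto (fun i => F i p) l (𝓝 (H p)))
    {z : ℂ} {u : ι → ℂ} (hu : Tendsto u l (𝓝 z)) :
    Tendsto (fun i => bdry (F i) (u i)) l (𝓝 (bdry H z)) := by
  rw [isClosedEmbedding_idealBall.isInducing.tendsto_nhds_iff, Metric.tendsto_nhds]
  intro ε hε
  have hK := hH.pos
  have hpow : Tendsto (fun τ : ℝ => 3 * holderConst K R * τ ^ (1 / K)) (𝓝[>] 0) (𝓝 0) := by
    have h1 : Tendsto (fun τ : ℝ => τ ^ (1 / K)) (𝓝[>] 0) (𝓝 ((0 : ℝ) ^ (1 / K))) :=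
      ((Real.continuousAt_rpow_const 0 (1 / K) (Or.inr (by positivity))).tendsto).mono_left
        nhdsWithin_le_nhds
    rw [Real.zero_rpow (by positivity)] at h1
    simpa using h1.const_mul (3 * holderConst K R)
  -- The height `τ` is fixed first, so that all vertical and horizontal legs cost less than `ε / 4`
  -- uniformly in the index. Pointwise convergence of the maps is then needed only at the one point
  -- `above z τ`.
  obtain ⟨τ, hτε, hτ⟩ := ((hpow.eventually (gt_mem_nhds (show 0 < ε / 4 by linarith))).and
    self_mem_nhdsWithin).exists
  have hτ : 0 < τ := hτ
  have h3 := ((continuous_ball.tendsto _).comp (hlim (above z τ))).eventually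
    (Metric.ball_mem_nhds _ (show 0 < ε / 4 by linarith))
  filter_upwards [hF, hFR, h3, hu.eventually (Metric.ball_mem_nhds z hτ)] with i hi hiR h3 hz
  rw [dist_eq_norm] at hz
  have e1 := hi.ball_dist_bdry hiR (u i) hτ
  have e2 := hi.ball_dist_above hiR hτ hz.le
  have e4 := hH.ball_dist_bdry hHR z hτ
  rw [dist_comm] at e4
  have e3 : dist (ball (F i (above z τ))) (ball (H (above z τ))) < ε / 4 := h3
  have := dist_triangle4 (idealBall (bdry (F i) (u i))) (ball (F i (above (u i) τ)))
    (ball (F i (above z τ))) (idealBall (bdry H z))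
  have := dist_triangle (ball (F i (above z τ))) (ball (H (above z τ))) (idealBall (bdry H z))
  simp only [Function.comp_apply]
  linarith

/-- The inversion exchanges `∞` with `0` and fixes the base point, so precomposing with it reduces
to the finite case with the same `K` and `R`. -/
theorem tendsto_bdry_of_tendsto_infty {ι : Type*} {l : Filter ι} {K R : ℝ} {F : ι → Hyp3 ≃ Hyp3}
    {H : Hyp3 ≃ Hyp3} (hF : ∀ᶠ i in l, BiLip K (F i)) (hFR : ∀ᶠ i in l, dist (F i base) base ≤ R)
    (hH : BiLip K H) (hHR : dist (H base) base ≤ R)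
    (hlim : ∀ p, Tendsto (fun i => F i p) l (𝓝 (H p))) :
    Tendsto (fun i => bdry (F i) OnePoint.infty) l (𝓝 (bdry H OnePoint.infty)) := by
  have hcomp : ∀ G : Hyp3 ≃ Hyp3, BiLip K G →
      bdry (inversion.toEquiv.trans G) (0 : ℂ) = bdry G OnePoint.infty := by
    intro G hG
    rw [← bdry_inversion_zero]
    exact bdry_comp (tendsto_bdry_isometry _ _) (hG.tendsto_bdry _)
  have h := tendsto_bdry_of_tendsto_coe (l := l) (K := K) (R := R)
    (F := fun i => inversion.toEquiv.trans (F i)) (H := inversion.toEquiv.trans H)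
    (hF.mono fun i hi => hi.isometry_trans inversion)
    (hFR.mono fun i hi => by simpa [inversion_base] using hi)
    (hH.isometry_trans inversion) (by simpa [inversion_base] using hHR)
    (fun p => hlim (inversion p)) (z := 0) (u := fun _ => 0) tendsto_const_nhds
  rw [hcomp H hH] at h
  exact h.congr' (hF.mono fun i hi => hcomp _ hi)

theorem BiLip.continuous_bdry {K : ℝ} {H : Hyp3 ≃ Hyp3} (hH : BiLip K H) :
    Continuous (bdry H) := by
  have hfin : ∀ {G : Hyp3 ≃ Hyp3}, BiLip K G → ∀ z : ℂ, ContinuousAt (bdry G) z := by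
    intro G hG z
    rw [OnePoint.continuousAt_coe]
    exact tendsto_bdry_of_tendsto_coe (F := fun _ => G) (l := 𝓝 z)
      (Eventually.of_forall fun _ => hG)
      (Eventually.of_forall fun _ => le_rfl) hG le_rfl (fun p => tendsto_const_nhds) tendsto_id
  refine continuous_iff_continuousAt.2 fun ξ => ?_
  induction ξ using OnePoint.rec with
  | coe z => exact hfin hH z
  | infty =>
    -- The boundary map of `H` is that of `H ∘ inversion`, continuous at `0`, after that of the
    -- inversion, which is visibly continuous in the ball.
    have hinv : ContinuousAt (bdry inversion) OnePoint.infty := by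
      rw [ContinuousAt, isClosedEmbedding_idealBall.isInducing.tendsto_nhds_iff]
      have hc : Continuous fun x : ℂ × ℝ => (x.1, 1 - x.2) := by fun_prop
      have key : ∀ ξ, idealBall (bdry inversion ξ) = ((idealBall ξ).1, 1 - (idealBall ξ).2) := by
        intro ξ
        have h1 := tendsto_atIdeal_iff_ball.1 (tendsto_bdry_isometry inversion ξ)
        have h2 := (hc.tendsto _).comp
          ((tendsto_atIdeal_iff_ball (u := id) (ξ := ξ)).1 tendsto_id)
        exact tendsto_nhds_unique h1 (h2.congr fun p => (ball_inversion p).symm)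
      have h3 := ((hc.comp continuous_idealBall).tendsto OnePoint.infty).congr
        fun ξ => (key ξ).symm
      rw [key]
      exact h3
    have h2 := hfin (hH.isometry_trans inversion) 0
    rw [← bdry_inversion_infty] at h2
    refine (ContinuousAt.comp h2 hinv).congr (Eventually.of_forall fun ξ => ?_)
    change bdry (H ∘ inversion) (bdry inversion ξ) = bdry H ξ
    have h4 := bdry_comp (H := H ∘ inversion) (tendsto_bdry_isometry inversion ξ)
      ((hH.isometry_trans inversion).tendsto_bdry _)
    rw [← h4]
    congr 1
    exact funext fun p => congrArg H (inversion_inversion p)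

/-- The boundary homeomorphism of a bi-Lipschitz bijection. -/
def BiLip.bdryHomeo {K : ℝ} {H : Hyp3 ≃ Hyp3} (hH : BiLip K H) : OnePoint ℂ ≃ₜ OnePoint ℂ where
  toFun := bdry H
  invFun := bdry H.symm
  left_inv := hH.bdry_symm_bdry
  right_inv := hH.bdry_bdry_symm
  continuous_toFun := hH.continuous_bdry
  continuous_invFun := hH.symm.continuous_bdry

theorem BiLip.isBoundaryExtension {K : ℝ} {H : Hyp3 ≃ Hyp3} (hH : BiLip K H) :
    IsBoundaryExtension H hH.bdryHomeo := fun ξ => by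
  have h := hH.tendsto_bdry ξ
  rw [atIdeal, atIdeal, tendsto_comap_iff] at h
  exact h

/-- Compactness: bi-Lipschitz maps that move the base point a bounded amount have pointwise limits
along ultrafilters. -/
theorem BiLip.exists_ultralimit {ι : Type*} (l : Ultrafilter ι) {K R : ℝ} {F : ι → Hyp3 ≃ Hyp3}
    (hF : ∀ᶠ i in l, BiLip K (F i)) (hFR : ∀ᶠ i in l, dist (F i base) base ≤ R) :
    ∃ H : Hyp3 ≃ Hyp3, BiLip K H ∧ ∀ p, Tendsto (fun i => F i p) l (𝓝 (H p)) := by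
  have lim : ∀ {G : ι → Hyp3 ≃ Hyp3} {R : ℝ}, (∀ᶠ i in l, BiLip K (G i)) →
      (∀ᶠ i in l, dist (G i base) base ≤ R) → ∀ p, ∃ q, Tendsto (fun i => G i p) l (𝓝 q) := by
    intro G R hG hGR p
    have hmem : ∀ᶠ i in l, G i p ∈ Metric.closedBall base (K * dist p base + R) := by
      filter_upwards [hG, hGR] with i h1 h2
      rw [Metric.mem_closedBall]
      linarith [dist_triangle (G i p) (G i base) base, h1.le p base]
    obtain ⟨q, -, hq⟩ := (isCompact_closedBall base (K * dist p base + R)).ultrafilter_le_nhds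
      (l.map fun i => G i p) (le_principal_iff.2 hmem)
    exact ⟨q, hq⟩
  -- The inverse maps also move the base point a bounded amount. Their limit is the inverse of the
  -- limit, which is therefore a bijection.
  have hsymm : ∀ᶠ i in l, BiLip K (F i).symm := hF.mono fun i hi => hi.symm
  have hsymmR : ∀ᶠ i in l, dist ((F i).symm base) base ≤ K * R := by
    filter_upwards [hF, hFR] with i h1 h2
    have h3 := h1.ge ((F i).symm base) base
    rw [Equiv.apply_symm_apply, dist_comm base] at h3
    have := h1.pos
    exact h3.trans (by gcongr)
  choose f hf using lim hF hFR
  choose g hg using lim hsymm hsymmR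
  have hfle : ∀ p q, dist (f p) (f q) ≤ K * dist p q := fun p q =>
    le_of_tendsto ((hf p).dist (hf q)) (hF.mono fun i hi => hi.le p q)
  have hfge : ∀ p q, dist p q ≤ K * dist (f p) (f q) := fun p q =>
    ge_of_tendsto (((hf p).dist (hf q)).const_mul K) (hF.mono fun i hi => hi.ge p q)
  have hgf : ∀ p, g (f p) = p := by
    intro p
    refine tendsto_nhds_unique (f := fun i => (F i).symm (f p)) (hg (f p)) ?_
    rw [tendsto_iff_dist_tendsto_zero]
    have h1 := (tendsto_iff_dist_tendsto_zero.1 (hf p)).const_mul K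
    rw [mul_zero] at h1
    refine squeeze_zero' (Eventually.of_forall fun _ => dist_nonneg) ?_ h1
    filter_upwards [hF] with i hi
    have := hi.ge ((F i).symm (f p)) p
    rwa [Equiv.apply_symm_apply, dist_comm (f p)] at this
  have hfg : ∀ p, f (g p) = p := by
    intro p
    refine tendsto_nhds_unique (f := fun i => F i (g p)) (hf (g p)) ?_
    rw [tendsto_iff_dist_tendsto_zero]
    have h1 := (tendsto_iff_dist_tendsto_zero.1 (hg p)).const_mul K
    rw [mul_zero] at h1
    refine squeeze_zero' (Eventually.of_forall fun _ => dist_nonneg) ?_ h1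
    filter_upwards [hF] with i hi
    have := hi.le (g p) ((F i).symm p)
    rwa [Equiv.apply_symm_apply, dist_comm (g p)] at this
  obtain ⟨i, hi⟩ := hF.exists
  exact ⟨⟨f, g, hgf, hfg⟩, ⟨hi.one_le, hfle, hfge⟩, hf⟩

end Hyp3
end

noncomputable section

namespace Hyp3

/-! ### Isometries and their boundary values -/

section similarity

variable (Ψ : ℂ ≃ ℂ) (l : ℝ) (hl : 0 < l) (hΨ : ∀ z w, ‖Ψ z - Ψ w‖ = l * ‖z - w‖)

theorem bdry_similarity_coe (z : ℂ) : bdry (similarity Ψ l hl hΨ) z = Ψ z := by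
  have hc : Continuous Ψ := (LipschitzWith.of_dist_le_mul (K := ⟨l, hl.le⟩) fun z w => by
    rw [dist_eq_norm, dist_eq_norm, hΨ]
    rfl).continuous
  have h := (tendsto_atIdeal_coe (u := id) (z := z)).1 tendsto_id
  refine bdry_eq (tendsto_atIdeal_coe.2 ⟨(hc.tendsto z).comp h.1, ?_⟩)
  simpa using h.2.const_mul l

theorem bdry_similarity_infty :
    bdry (similarity Ψ l hl hΨ) OnePoint.infty = OnePoint.infty := by
  by_contra hne
  obtain ⟨z, hz⟩ := OnePoint.ne_infty_iff_exists.1 hne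
  have h := bdry_similarity_coe Ψ l hl hΨ (Ψ.symm z)
  rw [Equiv.apply_symm_apply, hz] at h
  exact OnePoint.coe_ne_infty _ ((BiLip.of_isometry (similarity Ψ l hl hΨ)).bdry_injective h)

end similarity

theorem bdry_trans (φ ψ : Hyp3 ≃ᵢ Hyp3) (ξ : OnePoint ℂ) :
    bdry (φ.trans ψ) ξ = bdry ψ (bdry φ ξ) :=
  bdry_comp (tendsto_bdry_isometry φ ξ) (tendsto_bdry_isometry ψ _)

theorem bdry_inversion_coe {z : ℂ} (hz : z ≠ 0) :
    bdry inversion z = ((starRingEnd ℂ z)⁻¹ : ℂ) := by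
  have hz' : ‖z‖ ≠ 0 := norm_ne_zero_iff.2 hz
  have h := (tendsto_atIdeal_coe (u := id) (z := z)).1 tendsto_id
  have hN : Tendsto (fun p : Hyp3 => ‖p.z‖ ^ 2 + p.t ^ 2) (atIdeal z) (𝓝 (‖z‖ ^ 2)) := by
    have := (h.1.norm.pow 2).add (h.2.pow 2)
    simpa using this
  refine bdry_eq (tendsto_atIdeal_coe.2 ⟨?_, ?_⟩)
  · have h2 := h.1.div ((Complex.continuous_ofReal.tendsto _).comp hN) (by simpa using hz)
    have e : z / ((‖z‖ ^ 2 : ℝ) : ℂ) = (starRingEnd ℂ z)⁻¹ := by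
      rw [← Complex.normSq_eq_norm_sq, ← Complex.mul_conj]
      have : starRingEnd ℂ z ≠ 0 := by simpa using hz
      field_simp
    rw [e] at h2
    exact h2
  · have h2 := h.2.div hN (by positivity)
    rw [zero_div] at h2
    exact h2

/-- The Busemann functions at `∞`. -/
theorem tendsto_cosh_dist_div (a b : Hyp3) :
    Tendsto (fun p => Real.cosh (dist p a) / Real.cosh (dist p b)) (atIdeal OnePoint.infty)
      (𝓝 (b.t / a.t)) := by
  -- At `0` the common factor `p.t` cancels from the quotient and the limit can be read off; the
  -- inversion then transports the result to `∞`.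
  have key : ∀ a b : Hyp3, Tendsto (fun p => Real.cosh (dist p a) / Real.cosh (dist p b))
      (atIdeal (0 : ℂ)) (𝓝 (((‖a.z‖ ^ 2 + a.t ^ 2) / (2 * a.t)) /
        ((‖b.z‖ ^ 2 + b.t ^ 2) / (2 * b.t)))) := by
    intro a b
    have h := (tendsto_atIdeal_coe (u := id) (z := 0)).1 tendsto_id
    have hN : ∀ a : Hyp3, Tendsto (fun p : Hyp3 => (‖p.z - a.z‖ ^ 2 + p.t ^ 2 + a.t ^ 2) /
        (2 * a.t)) (atIdeal (0 : ℂ)) (𝓝 ((‖a.z‖ ^ 2 + a.t ^ 2) / (2 * a.t))) := by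
      intro a
      have := ((((h.1.sub_const a.z).norm.pow 2).add (h.2.pow 2)).add_const (a.t ^ 2)).div_const
        (2 * a.t)
      simpa using this
    have hb := b.normSq_pos
    have hb' := b.t_pos
    refine ((hN a).div (hN b) (by positivity)).congr fun p => ?_
    have hp := p.t_pos
    have ha := a.t_pos
    have hpb : 0 < ‖p.z - b.z‖ ^ 2 + p.t ^ 2 + b.t ^ 2 := by positivity
    rw [cosh_dist, cosh_dist, Pi.div_apply]
    field_simp
  have h := (key (inversion a) (inversion b)).comp tendsto_inversion_infty
  have ha := a.t_pos
  have hb := b.t_pos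
  have ha2 := a.normSq_pos
  have hb2 := b.normSq_pos
  have e : ∀ a : Hyp3, (‖(inversion a).z‖ ^ 2 + (inversion a).t ^ 2) / (2 * (inversion a).t) =
      (2 * a.t)⁻¹ := by
    intro a
    have ha := a.t_pos
    have ha2 := a.normSq_pos
    rw [inversion_apply, inversionFun_normSq]
    simp only [inversionFun]
    field_simp
  rw [e, e] at h
  convert h using 2
  · simp [inversion.dist_eq]
  · field_simp

/-- An isometry that fixes `∞` extends a similarity of `ℂ`. -/
theorem exists_eq_similarity (φ : Hyp3 ≃ᵢ Hyp3) (hφ : bdry φ OnePoint.infty = OnePoint.infty) :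
    ∃ (Ψ : ℂ ≃ ℂ) (l : ℝ) (hl : 0 < l) (hΨ : ∀ z w, ‖Ψ z - Ψ w‖ = l * ‖z - w‖),
      φ = similarity Ψ l hl hΨ := by
  have hlim : Tendsto φ (atIdeal OnePoint.infty) (atIdeal OnePoint.infty) := by
    have := tendsto_bdry_isometry φ OnePoint.infty
    rwa [hφ] at this
  set l := (φ base).t with hl
  have hl0 : 0 < l := (φ base).t_pos
  -- Quotients of heights are limits of quotients of hyperbolic cosines at `∞`. Since `φ` preserves
  -- distances and fixes `∞`, it multiplies all heights by one factor.
  have ht : ∀ a, (φ a).t = l * a.t := by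
    intro a
    have h1 := (tendsto_cosh_dist_div (φ base) (φ a)).comp hlim
    have h2 := tendsto_cosh_dist_div base a
    have h3 := tendsto_nhds_unique (h1.congr fun p => by simp [φ.dist_eq]) h2
    rw [base_t, div_one, div_eq_iff hl0.ne'] at h3
    rw [h3, mul_comm]
  have hz : ∀ a b, ‖(φ a).z - (φ b).z‖ = l * ‖a.z - b.z‖ := by
    intro a b
    have h1 : Real.cosh (dist (φ a) (φ b)) = Real.cosh (dist a b) := by rw [φ.dist_eq]
    have ha := a.t_pos
    have hb := b.t_pos
    rw [cosh_dist, cosh_dist, ht, ht, div_eq_div_iff (by positivity) (by positivity)] at h1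
    have h2 : ‖(φ a).z - (φ b).z‖ ^ 2 = (l * ‖a.z - b.z‖) ^ 2 := by
      have h3 : (2 * a.t * b.t) * (‖(φ a).z - (φ b).z‖ ^ 2 - (l * ‖a.z - b.z‖) ^ 2) = 0 := by
        linear_combination h1
      have := (mul_eq_zero.1 h3).resolve_left (by positivity)
      linarith
    exact (sq_eq_sq₀ (norm_nonneg _) (by positivity)).1 h2
  have hvert : ∀ a : Hyp3, (φ a).z = (φ (above a.z 1)).z := by
    intro a
    have := hz a (above a.z 1)
    rw [above_z, sub_self, norm_zero, mul_zero, norm_eq_zero, sub_eq_zero] at this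
    exact this
  have hinj : Function.Injective fun z => (φ (above z 1)).z := by
    intro z w h
    have := hz (above z 1) (above w 1)
    simp only at h
    rw [h, sub_self, norm_zero, above_z, above_z, eq_comm, mul_eq_zero, norm_eq_zero,
      sub_eq_zero] at this
    exact this.resolve_left hl0.ne'
  have hsurj : Function.Surjective fun z => (φ (above z 1)).z := by
    intro w
    refine ⟨(φ.symm (above w 1)).z, ?_⟩
    simp only
    rw [← hvert, φ.apply_symm_apply, above_z]
  refine ⟨Equiv.ofBijective _ ⟨hinj, hsurj⟩, l, hl0, fun z w => ?_, ?_⟩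
  · have := hz (above z 1) (above w 1)
    rwa [above_z, above_z] at this
  · refine IsometryEquiv.ext fun p => Hyp3.ext ?_ (ht p)
    exact hvert p

/-- An isometry is determined by its boundary values. -/
theorem eq_one_of_bdry_eq (φ : Hyp3 ≃ᵢ Hyp3) (h : ∀ ξ, bdry φ ξ = ξ) (p : Hyp3) : φ p = p := by
  obtain ⟨Ψ, l, hl, hΨ, rfl⟩ := exists_eq_similarity φ (h _)
  have hid : ∀ z, Ψ z = z := fun z => by
    have := h z
    rw [bdry_similarity_coe] at this
    exact OnePoint.coe_injective this
  have h1 := hΨ 1 0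
  rw [hid, hid, sub_zero, norm_one, mul_one] at h1
  ext
  · exact hid _
  · rw [similarity_t, ← h1, one_mul]

/-- The horizontal translations. -/
def translation (c : ℂ) : Hyp3 ≃ᵢ Hyp3 :=
  similarity (Equiv.addRight c) 1 one_pos fun z w => by simp

theorem bdry_translation_coe (c z : ℂ) : bdry (translation c) z = (z + c : ℂ) :=
  bdry_similarity_coe _ _ _ _ z

theorem bdry_translation_infty (c : ℂ) : bdry (translation c) OnePoint.infty = OnePoint.infty :=
  bdry_similarity_infty _ _ _ _

/-- An isometry that does not fix `∞` is an inversion up to a similarity and a translation. -/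
theorem exists_eq_inversion (φ : Hyp3 ≃ᵢ Hyp3) {c : ℂ} (hφ : bdry φ OnePoint.infty = c) :
    ∃ (Ψ : ℂ ≃ ℂ) (l : ℝ) (hl : 0 < l) (hΨ : ∀ z w, ‖Ψ z - Ψ w‖ = l * ‖z - w‖),
      φ = ((similarity Ψ l hl hΨ).trans inversion).trans (translation c) := by
  obtain ⟨Ψ, l, hl, hΨ, h⟩ := exists_eq_similarity
    ((φ.trans (translation c).symm).trans inversion) (by
      rw [bdry_trans, bdry_trans, hφ]
      have : bdry (translation c).symm c = (0 : ℂ) := by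
        rw [← bdry_symm_bdry_isometry (translation c) (0 : ℂ), bdry_translation_coe, zero_add]
      rw [this, bdry_inversion_zero])
  refine ⟨Ψ, l, hl, hΨ, ?_⟩
  rw [← h]
  refine IsometryEquiv.ext fun p => ?_
  simp [inversion_inversion]

/-- The distortion of Euclidean distances by an isometry that does not fix `∞`. -/
theorem exists_norm_bdry (φ : Hyp3 ≃ᵢ Hyp3) {c w : ℂ} (hc : bdry φ OnePoint.infty = c)
    (hw : bdry φ w = OnePoint.infty) :
    ∃ m : ℝ, 0 < m ∧ ∃ f : ℂ → ℂ, (∀ x, x ≠ w → bdry φ x = f x) ∧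
      (∀ x, x ≠ w → ‖f x - c‖ = m / ‖x - w‖) ∧
      ∀ x y, x ≠ w → y ≠ w → ‖f x - f y‖ = m * ‖x - y‖ / (‖x - w‖ * ‖y - w‖) := by
  obtain ⟨Ψ, l, hl, hΨ, rfl⟩ := exists_eq_inversion φ hc
  have hΨw : Ψ w = 0 := by
    by_contra hne
    rw [bdry_trans, bdry_trans, bdry_similarity_coe, bdry_inversion_coe hne,
      bdry_translation_coe] at hw
    exact OnePoint.coe_ne_infty _ hw
  have hne : ∀ x, x ≠ w → Ψ x ≠ 0 := fun x hx h => hx (Ψ.injective (h.trans hΨw.symm))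
  have hnorm : ∀ x, ‖Ψ x‖ = l * ‖x - w‖ := fun x => by rw [← hΨ, hΨw, sub_zero]
  refine ⟨l⁻¹, inv_pos.2 hl, fun x => (starRingEnd ℂ (Ψ x))⁻¹ + c, fun x hx => ?_, fun x hx => ?_,
    fun x y hx hy => ?_⟩
  · rw [bdry_trans, bdry_trans, bdry_similarity_coe, bdry_inversion_coe (hne x hx),
      bdry_translation_coe]
  · have : ‖x - w‖ ≠ 0 := norm_ne_zero_iff.2 (sub_ne_zero.2 hx)
    rw [add_sub_cancel_right, norm_inv, RCLike.norm_conj, hnorm]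
    field_simp
  · have h1 : ‖x - w‖ ≠ 0 := norm_ne_zero_iff.2 (sub_ne_zero.2 hx)
    have h2 : ‖y - w‖ ≠ 0 := norm_ne_zero_iff.2 (sub_ne_zero.2 hy)
    have hx' : starRingEnd ℂ (Ψ x) ≠ 0 := by simpa using hne x hx
    have hy' : starRingEnd ℂ (Ψ y) ≠ 0 := by simpa using hne y hy
    rw [add_sub_add_right_eq_sub, inv_sub_inv hx' hy', norm_div, norm_mul, ← map_sub,
      RCLike.norm_conj, RCLike.norm_conj, RCLike.norm_conj, hnorm, hnorm, hΨ, norm_sub_rev]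
    field_simp

/-- Normalised to fix `0` and to have scale one, `Ψ` becomes a linear isometry of the plane, that
is, a rotation, possibly after conjugation. -/
theorem similarity_eq_linear (Ψ : ℂ ≃ ℂ) (l : ℝ) (hl : 0 < l)
    (hΨ : ∀ z w, ‖Ψ z - Ψ w‖ = l * ‖z - w‖) :
    ∃ a b : ℂ, a ≠ 0 ∧ ((∀ z, Ψ z = a * z + b) ∨ ∀ z, Ψ z = a * starRingEnd ℂ z + b) := by
  have hlc : (l : ℂ) ≠ 0 := Complex.ofReal_ne_zero.2 hl.ne'
  let f : ℂ ≃ᵢ ℂ :=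
    { toFun := fun z => (Ψ z - Ψ 0) / l
      invFun := fun z => Ψ.symm (l * z + Ψ 0)
      left_inv := fun z => by
        simp only
        rw [mul_div_cancel₀ _ hlc, sub_add_cancel, Equiv.symm_apply_apply]
      right_inv := fun z => by
        simp only
        rw [Equiv.apply_symm_apply, add_sub_cancel_right, mul_div_cancel_left₀ _ hlc]
      isometry_toFun := Isometry.of_dist_eq fun z w => by
        rw [dist_eq_norm, dist_eq_norm, ← sub_div, sub_sub_sub_cancel_right, norm_div, hΨ,
          Complex.norm_real, Real.norm_of_nonneg hl.le, mul_div_cancel_left₀ _ hl.ne'] }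
  have hf0 : f 0 = 0 := by simp [f]
  have hfz : ∀ z, Ψ z = l * f z + Ψ 0 := fun z => by
    simp only [f, IsometryEquiv.coe_mk, Equiv.coe_fn_mk]
    field_simp
    ring
  obtain ⟨a, ha⟩ := linear_isometry_complex (f.toRealLinearIsometryEquivOfMapZero hf0)
  have hfe : ∀ z, f z = f.toRealLinearIsometryEquivOfMapZero hf0 z := fun z => rfl
  refine ⟨l * a, Ψ 0, mul_ne_zero hlc (by simp), ha.imp (fun h z => ?_) fun h z => ?_⟩
  · rw [hfz, hfe, h, rotation_apply]
    ring
  · rw [hfz, hfe, h, LinearIsometryEquiv.trans_apply, rotation_apply, Complex.conjLIE_apply]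
    ring

end Hyp3

/-! ### Möbius transformations -/

theorem OnePoint.map_conj_map_conj (ξ : OnePoint ℂ) :
    OnePoint.map (starRingEnd ℂ) (OnePoint.map (starRingEnd ℂ) ξ) = ξ := by
  cases ξ <;> simp

theorem IsMoebius.comp {f g : OnePoint ℂ → OnePoint ℂ} (hf : IsMoebius f) (hg : IsMoebius g) :
    IsMoebius (f ∘ g) := by
  obtain ⟨A, hA⟩ := hf
  obtain ⟨B, hB⟩ := hg
  rcases hA with hA | hA <;> rcases hB with hB | hB
  · exact ⟨A * B, Or.inl fun ξ => by rw [Function.comp_apply, hB, hA, mul_smul]⟩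
  · exact ⟨A * B, Or.inr fun ξ => by rw [Function.comp_apply, hB, hA, mul_smul]⟩
  · exact ⟨A * B.map (starRingEnd ℂ), Or.inr fun ξ => by
      rw [Function.comp_apply, hB, hA, OnePoint.map_smul, mul_smul]⟩
  · exact ⟨A * B.map (starRingEnd ℂ), Or.inl fun ξ => by
      rw [Function.comp_apply, hB, hA, OnePoint.map_smul, mul_smul, OnePoint.map_conj_map_conj]⟩

namespace Hyp3

theorem isMoebius_similarity (Ψ : ℂ ≃ ℂ) (l : ℝ) (hl : 0 < l)
    (hΨ : ∀ z w, ‖Ψ z - Ψ w‖ = l * ‖z - w‖) : IsMoebius (bdry (similarity Ψ l hl hΨ)) := by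
  obtain ⟨a, b, ha, h⟩ := similarity_eq_linear Ψ l hl hΨ
  refine ⟨Matrix.GeneralLinearGroup.mkOfDetNeZero !![a, b; 0, 1] (by simpa using ha),
    h.imp (fun h ξ => ?_) fun h ξ => ?_⟩
  · induction ξ using OnePoint.rec with
    | infty => simp [bdry_similarity_infty, OnePoint.smul_infty_eq_ite,
        Matrix.GeneralLinearGroup.mkOfDetNeZero]
    | coe z => simp [bdry_similarity_coe, OnePoint.smul_some_eq_ite,
        Matrix.GeneralLinearGroup.mkOfDetNeZero, h]
  · induction ξ using OnePoint.rec with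
    | infty => simp [bdry_similarity_infty, OnePoint.smul_infty_eq_ite,
        Matrix.GeneralLinearGroup.mkOfDetNeZero]
    | coe z => simp [bdry_similarity_coe, OnePoint.smul_some_eq_ite,
        Matrix.GeneralLinearGroup.mkOfDetNeZero, h]

theorem isMoebius_inversion : IsMoebius (bdry inversion) := by
  refine ⟨Matrix.GeneralLinearGroup.mkOfDetNeZero !![0, 1; 1, 0] (by simp), Or.inr fun ξ => ?_⟩
  induction ξ using OnePoint.rec with
  | infty => simp [bdry_inversion_infty, OnePoint.smul_infty_eq_ite,
      Matrix.GeneralLinearGroup.mkOfDetNeZero]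
  | coe z =>
    by_cases hz : z = 0
    · subst hz
      simp [bdry_inversion_zero, OnePoint.smul_some_eq_ite,
        Matrix.GeneralLinearGroup.mkOfDetNeZero]
    · simp [bdry_inversion_coe hz, OnePoint.smul_some_eq_ite,
        Matrix.GeneralLinearGroup.mkOfDetNeZero, hz]

theorem isMoebius_bdry (φ : Hyp3 ≃ᵢ Hyp3) : IsMoebius (bdry φ) := by
  by_cases hφ : bdry φ OnePoint.infty = OnePoint.infty
  · obtain ⟨Ψ, l, hl, hΨ, rfl⟩ := exists_eq_similarity φ hφ
    exact isMoebius_similarity Ψ l hl hΨ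
  · obtain ⟨c, hc⟩ := OnePoint.ne_infty_iff_exists.1 hφ
    obtain ⟨Ψ, l, hl, hΨ, h⟩ := exists_eq_inversion φ hc.symm
    have h2 : bdry φ = bdry (translation c) ∘ bdry inversion ∘ bdry (similarity Ψ l hl hΨ) := by
      funext ξ
      rw [h, bdry_trans, bdry_trans]
      rfl
    rw [h2]
    exact (isMoebius_similarity _ _ _ _).comp
      (isMoebius_inversion.comp (isMoebius_similarity Ψ l hl hΨ))

end Hyp3
end

noncomputable section

/-! ### Differentiability of quasisymmetric maps of the plane -/

/-! ### Stepanov's theorem -/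

section Stepanov

open MeasureTheory

variable {E F : Type*} [NormedAddCommGroup E] [NormedSpace ℝ E] [FiniteDimensional ℝ E]
  [MeasurableSpace E] [BorelSpace E] [NormedAddCommGroup F] [NormedSpace ℝ F]
  [FiniteDimensional ℝ F] (μ : Measure E) [μ.IsAddHaarMeasure]

/-- Near almost every point of a set, every point is close to the set. -/
theorem ae_eventually_exists_mem_near (S : Set E) :
    ∀ᵐ x ∂μ, x ∈ S → ∀ ε : ℝ, 0 < ε → ∀ᶠ y in 𝓝 x, ∃ y' ∈ S, ‖y - y'‖ ≤ ε * ‖y - x‖ := by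
  have h : ∀ n : ℕ, ∀ᵐ x ∂μ, x ∈ S →
      ∀ᶠ y in 𝓝 x, ∃ y' ∈ S, ‖y - y'‖ ≤ (n + 1 : ℝ)⁻¹ * ‖y - x‖ := by
    intro n
    -- Density is applied to balls centred at `y` of radius `‖y - x‖ / (n + 1)`. They need not
    -- contain `x`, but their `(n + 1)`-fold enlargements do; near a density point `x` they must
    -- therefore meet `S`.
    have h1 := ae_imp_of_ae_restrict
      (IsUnifLocDoublingMeasure.ae_tendsto_measure_inter_div μ S (n + 1 : ℝ))
    filter_upwards [h1] with x hx hxS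
    have hn : (0 : ℝ) < n + 1 := by positivity
    have hδ : Tendsto (fun y => (n + 1 : ℝ)⁻¹ * ‖y - x‖) (𝓝[≠] x) (𝓝[>] 0) := by
      refine tendsto_nhdsWithin_iff.2 ⟨?_, ?_⟩
      · have hc : Continuous fun y => (n + 1 : ℝ)⁻¹ * ‖y - x‖ := by fun_prop
        have := (hc.tendsto x).mono_left (nhdsWithin_le_nhds (s := {x}ᶜ))
        simpa using this
      · filter_upwards [self_mem_nhdsWithin] with y hy
        exact mul_pos (inv_pos.2 hn) (norm_pos_iff.2 (sub_ne_zero.2 hy))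
    have h2 := hx hxS (fun y => y) _ hδ (Eventually.of_forall fun y => by
      rw [Metric.mem_closedBall, dist_comm, dist_eq_norm, mul_inv_cancel_left₀ hn.ne'])
    have h3 := h2.eventually (lt_mem_nhds one_pos)
    rw [eventually_nhdsWithin_iff] at h3
    filter_upwards [h3] with y hy
    by_cases hyx : y = x
    · exact ⟨x, hxS, by simp [hyx]⟩
    · obtain ⟨y', hy', hy2⟩ : (S ∩ Metric.closedBall y ((n + 1 : ℝ)⁻¹ * ‖y - x‖)).Nonempty := by
        refine nonempty_iff_ne_empty.2 fun hemp => ?_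
        have := hy hyx
        rw [hemp] at this
        simp at this
      refine ⟨y', hy', ?_⟩
      rwa [Metric.mem_closedBall, dist_comm, dist_eq_norm] at hy2
  filter_upwards [ae_all_iff.2 h] with x hx hxS ε hε
  obtain ⟨n, hn⟩ := exists_nat_one_div_lt hε
  filter_upwards [hx n hxS] with y hy
  obtain ⟨y', h1, h2⟩ := hy
  refine ⟨y', h1, h2.trans ?_⟩
  rw [one_div] at hn
  gcongr

/-- **Stepanov's theorem**: a map that is Lipschitz at almost every point is differentiable at
almost every point. -/
theorem ae_differentiableAt_of_ae_lipschitz_at {f : E → F}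
    (hf : ∀ᵐ x ∂μ, ∃ M : ℝ, ∀ᶠ y in 𝓝 x, ‖f y - f x‖ ≤ M * ‖y - x‖) :
    ∀ᵐ x ∂μ, DifferentiableAt ℝ f x := by
  -- On `S n k` the bound with constant `n` holds at scale `1 / (n + 1)`, and the ball keeps any two
  -- points of the set within that scale, so `f` is Lipschitz there. Rademacher's theorem gives a
  -- derivative within the set, and density upgrades it to a full derivative.
  let S : ℕ → ℕ → Set E := fun n k =>
    {x | ∀ y, ‖y - x‖ < (n + 1 : ℝ)⁻¹ → ‖f y - f x‖ ≤ n * ‖y - x‖} ∩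
      Metric.ball (TopologicalSpace.denseSeq E k) ((n + 1 : ℝ)⁻¹ / 2)
  have hlip : ∀ n k : ℕ, LipschitzOnWith (n : NNReal) f (S n k) := by
    intro n k
    refine LipschitzOnWith.of_dist_le_mul fun x hx y hy => ?_
    rw [dist_eq_norm, dist_eq_norm]
    refine hy.1 x ?_
    have h1 := hx.2
    have h2 := hy.2
    rw [Metric.mem_ball] at h1 h2
    rw [← dist_eq_norm]
    linarith [dist_triangle_right x y (TopologicalSpace.denseSeq E k)]
  have h1 := ae_all_iff.2 fun n => ae_all_iff.2 fun k =>
    (hlip n k).ae_differentiableWithinAt_of_mem (μ := μ)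
  have h2 := ae_all_iff.2 fun n => ae_all_iff.2 fun k => ae_eventually_exists_mem_near μ (S n k)
  filter_upwards [hf, h1, h2] with x hx hx1 hx2
  obtain ⟨M, hM⟩ := hx
  obtain ⟨r, hr, hrM⟩ := Metric.eventually_nhds_iff.1 hM
  obtain ⟨n, hn⟩ := exists_nat_ge (max M r⁻¹)
  have hn1 : M ≤ n := (le_max_left _ _).trans hn
  have hn2 : (n + 1 : ℝ)⁻¹ ≤ r := by
    rw [inv_le_comm₀ (by positivity) hr]
    linarith [(le_max_right M r⁻¹).trans hn]
  have hpos : (0 : ℝ) < (n + 1 : ℝ)⁻¹ / 2 := by positivity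
  obtain ⟨k, hk⟩ : ∃ k, x ∈ Metric.ball (TopologicalSpace.denseSeq E k) ((n + 1 : ℝ)⁻¹ / 2) := by
    obtain ⟨k, hk⟩ := (TopologicalSpace.denseRange_denseSeq E).exists_dist_lt x hpos
    exact ⟨k, hk⟩
  have hxS : x ∈ S n k := by
    refine ⟨fun y hy => ?_, hk⟩
    refine (hrM (by rw [dist_eq_norm]; linarith)).trans ?_
    gcongr
  obtain ⟨D, hD⟩ := hx1 n k hxS
  refine ⟨D, ?_⟩
  rw [hasFDerivAt_iff_isLittleO, Asymptotics.isLittleO_iff]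
  intro ε hε
  -- Replacing `y` by a point `y'` of the set at distance `η ‖y - x‖` costs `n η` for `f` and `‖D‖
  -- η` for the derivative. The derivative within the set adds `2 η`, as `‖y' - x‖ ≤ 2 ‖y - x‖`.
  set η := min 1 (ε / (n + 2 + ‖D‖)) with hη
  have hden : (0 : ℝ) < n + 2 + ‖D‖ := by positivity
  have hη0 : 0 < η := lt_min one_pos (by positivity)
  have hη1 : η ≤ 1 := min_le_left _ _
  have hη2 : (n + 2 + ‖D‖) * η ≤ ε := by
    rw [← le_div_iff₀' hden]
    exact min_le_right _ _
  have h3 := hD.isLittleO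
  rw [Asymptotics.isLittleO_iff] at h3
  have h4 := h3 hη0
  rw [eventually_nhdsWithin_iff] at h4
  obtain ⟨ρ, hρ, hρ2⟩ := Metric.eventually_nhds_iff.1 h4
  have hnear : ∀ᶠ y in 𝓝 x, ‖y - x‖ < min (ρ / 2) (n + 1 : ℝ)⁻¹ := by
    have := Metric.ball_mem_nhds x (show 0 < min (ρ / 2) (n + 1 : ℝ)⁻¹ by positivity)
    filter_upwards [this] with y hy
    rwa [← dist_eq_norm]
  filter_upwards [hx2 n k hxS η hη0, hnear] with y hy hy2
  obtain ⟨y', hy'S, hy'⟩ := hy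
  have hy'x : ‖y' - x‖ ≤ 2 * ‖y - x‖ := by
    have := norm_sub_le_norm_sub_add_norm_sub y' y x
    rw [norm_sub_rev y' y] at this
    nlinarith [norm_nonneg (y - x)]
  have e1 : ‖f y - f y'‖ ≤ n * (η * ‖y - x‖) := by
    refine (hy'S.1 y ?_).trans (by gcongr)
    refine lt_of_le_of_lt ?_ (lt_of_lt_of_le hy2 (min_le_right _ _))
    nlinarith [norm_nonneg (y - x)]
  have e2 : ‖f y' - f x - D (y' - x)‖ ≤ η * (2 * ‖y - x‖) := by
    refine (hρ2 ?_ hy'S).trans (by gcongr)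
    rw [dist_eq_norm]
    have := lt_of_lt_of_le hy2 (min_le_left _ _)
    linarith
  have e3 : ‖D (y - y')‖ ≤ ‖D‖ * (η * ‖y - x‖) := (D.le_opNorm _).trans (by gcongr)
  have e4 : f y - f x - D (y - x) = (f y - f y') + (f y' - f x - D (y' - x)) - D (y - y') := by
    simp only [map_sub]
    abel
  rw [e4]
  calc _ ≤ ‖f y - f y'‖ + ‖f y' - f x - D (y' - x)‖ + ‖D (y - y')‖ :=
        (norm_sub_le _ _).trans (by gcongr; exact norm_add_le _ _)
    _ ≤ ((n + 2 + ‖D‖) * η) * ‖y - x‖ := by linarith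
    _ ≤ _ := by gcongr

end Stepanov

/-! ### Quasisymmetric maps have a nonzero derivative somewhere -/

section Quasisymmetric

open MeasureTheory

open scoped ENNReal NNReal

/-- A (weakly) quasisymmetric homeomorphism of the plane. -/
def IsQuasisymmetric (C : ℝ) (h : ℂ ≃ₜ ℂ) : Prop :=
  0 < C ∧ ∀ x y w, ‖y - x‖ ≤ ‖w - x‖ → ‖h y - h x‖ ≤ C * ‖h w - h x‖

namespace IsQuasisymmetric

variable {C : ℝ} {h : ℂ ≃ₜ ℂ}

/-- The pull-back of the area by a homeomorphism. -/
def areaPullback (h : ℂ ≃ₜ ℂ) : Measure ℂ := (volume : Measure ℂ).map h.symm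

theorem areaPullback_apply {s : Set ℂ} (hs : MeasurableSet s) :
    areaPullback h s = volume (h.symm ⁻¹' s) :=
  Measure.map_apply h.symm.continuous.measurable hs

instance : IsFiniteMeasureOnCompacts (areaPullback h) where
  lt_top_of_isCompact K hK := by
    rw [areaPullback_apply hK.measurableSet, ← h.image_eq_preimage_symm]
    exact (hK.image h.continuous).measure_lt_top

/-- By quasisymmetry the image of the ball about `x` contains the round ball of radius `‖h y - h x‖
/ C` about `h x`, so squared displacement is controlled by the area of the image. -/
theorem enorm_sq_le (hh : IsQuasisymmetric C h) {x y : ℂ} {r : ℝ} (hy : ‖y - x‖ ≤ r) :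
    ‖h y - h x‖ₑ ^ 2 ≤ ENNReal.ofReal C ^ 2 * areaPullback h (Metric.closedBall x r) := by
  have hC := hh.1
  have hsub : Metric.ball (h x) (‖h y - h x‖ / C) ⊆ h.symm ⁻¹' Metric.closedBall x r := by
    intro v hv
    by_contra hcon
    rw [mem_preimage, Metric.mem_closedBall, not_le, dist_eq_norm] at hcon
    have h1 := hh.2 x y (h.symm v) (by linarith)
    rw [h.apply_symm_apply] at h1
    rw [Metric.mem_ball, dist_eq_norm, lt_div_iff₀ hC] at hv
    linarith
  have h2 := measure_mono (μ := volume) hsub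
  rw [← areaPullback_apply Metric.isClosed_closedBall.measurableSet, Complex.volume_ball] at h2
  have h3 : ENNReal.ofReal (‖h y - h x‖ / C) ^ 2 ≤ areaPullback h (Metric.closedBall x r) := by
    refine le_trans ?_ h2
    refine le_mul_of_one_le_right' ?_
    rw [ENNReal.one_le_coe_iff, ← NNReal.coe_le_coe, NNReal.coe_one, NNReal.coe_real_pi]
    linarith [Real.two_le_pi]
  calc ‖h y - h x‖ₑ ^ 2 = ENNReal.ofReal C ^ 2 * ENNReal.ofReal (‖h y - h x‖ / C) ^ 2 := by
        rw [← mul_pow, ← ENNReal.ofReal_mul hC.le, mul_div_cancel₀ _ hC.ne', ofReal_norm]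
    _ ≤ _ := by gcongr

/-- The pulled-back area has a finite density almost everywhere. By `enorm_sq_le`, the map is
Lipschitz at each such point, and Stepanov's theorem applies. -/
theorem ae_differentiableAt (hh : IsQuasisymmetric C h) :
    ∀ᵐ x : ℂ, DifferentiableAt ℝ h x := by
  refine ae_differentiableAt_of_ae_lipschitz_at volume ?_
  filter_upwards [Besicovitch.ae_tendsto_rnDeriv (areaPullback h) volume,
    Measure.rnDeriv_lt_top (areaPullback h) volume] with x hx hlt
  obtain ⟨M, hM1, hM2⟩ := exists_between hlt
  have hM := hx.eventually (gt_mem_nhds hM1)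
  rw [eventually_nhdsWithin_iff] at hM
  obtain ⟨ρ, hρ, hρM⟩ := Metric.eventually_nhds_iff.1 hM
  set B : ℝ≥0∞ := ENNReal.ofReal C ^ 2 * (M * NNReal.pi) with hB
  have hBtop : B ≠ ⊤ := by
    refine ENNReal.mul_ne_top (ENNReal.pow_ne_top ENNReal.ofReal_ne_top) ?_
    exact ENNReal.mul_ne_top hM2.ne ENNReal.coe_ne_top
  refine ⟨√B.toReal, ?_⟩
  filter_upwards [Metric.ball_mem_nhds x hρ] with y hy
  rw [Metric.mem_ball, dist_eq_norm] at hy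
  by_cases hyx : y = x
  · simp [hyx]
  have hr : 0 < ‖y - x‖ := norm_pos_iff.2 (sub_ne_zero.2 hyx)
  have h1 := hρM (y := ‖y - x‖) (by simpa using hy) hr
  have h2 : areaPullback h (Metric.closedBall x ‖y - x‖) ≤
      M * (ENNReal.ofReal ‖y - x‖ ^ 2 * NNReal.pi) := by
    rw [← Complex.volume_closedBall x]
    refine (ENNReal.div_le_iff ?_ ?_).1 h1.le
    · exact (Metric.measure_closedBall_pos _ _ hr).ne'
    · exact measure_closedBall_lt_top.ne
  have h3 : ‖h y - h x‖ₑ ^ 2 ≤ B * ENNReal.ofReal ‖y - x‖ ^ 2 := by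
    refine (hh.enorm_sq_le le_rfl).trans ?_
    calc _ ≤ ENNReal.ofReal C ^ 2 * (M * (ENNReal.ofReal ‖y - x‖ ^ 2 * NNReal.pi)) := by gcongr
      _ = _ := by rw [hB]; ring
  have h4 : ‖h y - h x‖ ^ 2 ≤ B.toReal * ‖y - x‖ ^ 2 := by
    have := ENNReal.toReal_mono
      (ENNReal.mul_ne_top hBtop (ENNReal.pow_ne_top ENNReal.ofReal_ne_top)) h3
    simpa using this
  refine le_of_sq_le_sq ?_ (by positivity)
  rw [mul_pow, Real.sq_sqrt ENNReal.toReal_nonneg]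
  exact h4

/-- The horizontal difference quotients of `h`. -/
def diffQuot (h : ℂ ≃ₜ ℂ) (n : ℕ) (x : ℂ) : ℝ≥0∞ :=
  (n + 1 : ℕ) * ‖h (x + ((n + 1 : ℕ) : ℂ)⁻¹) - h x‖ₑ

theorem measurable_diffQuot (n : ℕ) : Measurable (diffQuot h n) := by
  have hc : Continuous fun x => h (x + ((n + 1 : ℕ) : ℂ)⁻¹) - h x := by fun_prop
  exact hc.measurable.enorm.const_mul _

/-- Exchange the order of integration over the pairs at distance at most `δ`. -/
theorem lintegral_areaPullback_le (R δ : ℝ) :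
    ∫⁻ x in Metric.closedBall 0 R, areaPullback h (Metric.closedBall x δ) ≤
      volume (Metric.closedBall (0 : ℂ) δ) * areaPullback h (Metric.closedBall 0 (R + δ)) := by
  set s : Set (ℂ × ℂ) := {p | dist p.2 p.1 ≤ δ ∧ p.1 ∈ Metric.closedBall 0 R} with hs
  have hsm : MeasurableSet s := by
    refine IsClosed.measurableSet ?_
    refine (isClosed_le (continuous_snd.dist continuous_fst) continuous_const).inter ?_
    exact Metric.isClosed_closedBall.preimage continuous_fst
  have h1 := Measure.prod_apply (μ := volume) (ν := areaPullback h) hsm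
  have h2 := Measure.prod_apply_symm (μ := volume) (ν := areaPullback h) hsm
  have h3 : ∫⁻ x in Metric.closedBall 0 R, areaPullback h (Metric.closedBall x δ) =
      ∫⁻ x, areaPullback h (Prod.mk x ⁻¹' s) := by
    rw [← lintegral_indicator Metric.isClosed_closedBall.measurableSet]
    refine lintegral_congr fun x => ?_
    by_cases hx : x ∈ Metric.closedBall 0 R
    · rw [indicator_of_mem hx]
      congr 1
      ext y
      simp only [hs, mem_preimage, mem_ofPred_eq, Metric.mem_closedBall]
      exact ⟨fun h => ⟨h, hx⟩, fun h => h.1⟩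
    · rw [indicator_of_notMem hx]
      have : Prod.mk x ⁻¹' s = ∅ := by
        ext y
        simp only [hs, mem_preimage, mem_ofPred_eq, mem_empty_iff_false, iff_false]
        exact fun h => hx h.2
      rw [this, measure_empty]
  rw [h3, ← h1, h2]
  calc _ ≤ ∫⁻ y, (Metric.closedBall (0 : ℂ) (R + δ)).indicator
        (fun _ => volume (Metric.closedBall (0 : ℂ) δ)) y ∂(areaPullback h) := by
        refine lintegral_mono fun y => ?_
        simp only
        by_cases hy : y ∈ Metric.closedBall (0 : ℂ) (R + δ)
        · rw [indicator_of_mem hy]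
          have hsub : (fun x => (x, y)) ⁻¹' s ⊆ Metric.closedBall y δ := fun x hx => by
            rw [Metric.mem_closedBall, dist_comm]
            exact hx.1
          refine (measure_mono hsub).trans (le_of_eq ?_)
          rw [Complex.volume_closedBall, Complex.volume_closedBall]
        · rw [indicator_of_notMem hy]
          have : (fun x => (x, y)) ⁻¹' s = ∅ := by
            ext x
            simp only [mem_empty_iff_false, iff_false]
            intro hx
            have h1 : dist y x ≤ δ := hx.1
            have h2 : dist x 0 ≤ R := hx.2
            refine hy ?_
            rw [Metric.mem_closedBall]
            linarith [dist_triangle y x 0]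
          rw [this, measure_empty]
    _ = _ := by
        rw [lintegral_indicator Metric.isClosed_closedBall.measurableSet, setLIntegral_const]

/-- The point is that the bound does not depend on `n`: the factor `(n + 1)²` of the squared
quotients cancels the area of a disc of radius `1 / (n + 1)`, up to `π`. -/
theorem lintegral_diffQuot_sq_le (hh : IsQuasisymmetric C h) (n : ℕ) :
    ∫⁻ x in Metric.closedBall 0 2, diffQuot h n x ^ 2 ≤
      ENNReal.ofReal C ^ 2 * NNReal.pi * areaPullback h (Metric.closedBall 0 3) := by
  set δ : ℝ := ((n + 1 : ℕ) : ℝ)⁻¹ with hδ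
  have hδ0 : 0 < δ := by positivity
  have hδ1 : δ ≤ 1 := inv_le_one_of_one_le₀ (by simp)
  have hnd : ((n + 1 : ℕ) : ℝ≥0∞) ^ 2 * ENNReal.ofReal δ ^ 2 = 1 := by
    rw [← mul_pow, ← ENNReal.ofReal_natCast, ← ENNReal.ofReal_mul (by positivity), hδ,
      mul_inv_cancel₀ (by positivity), ENNReal.ofReal_one, one_pow]
  calc _ ≤ ∫⁻ x in Metric.closedBall 0 2, ((n + 1 : ℕ) : ℝ≥0∞) ^ 2 * (ENNReal.ofReal C ^ 2 *
        areaPullback h (Metric.closedBall x δ)) := by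
        refine lintegral_mono fun x => ?_
        simp only
        rw [diffQuot, mul_pow]
        gcongr
        refine hh.enorm_sq_le ?_
        rw [add_sub_cancel_left, norm_inv, Complex.norm_natCast]
    _ = ((n + 1 : ℕ) : ℝ≥0∞) ^ 2 * (ENNReal.ofReal C ^ 2 *
        ∫⁻ x in Metric.closedBall 0 2, areaPullback h (Metric.closedBall x δ)) := by
        rw [lintegral_const_mul', lintegral_const_mul']
        · exact ENNReal.pow_ne_top ENNReal.ofReal_ne_top
        · exact ENNReal.pow_ne_top (ENNReal.natCast_ne_top _)
    _ ≤ ((n + 1 : ℕ) : ℝ≥0∞) ^ 2 * (ENNReal.ofReal C ^ 2 *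
        ((ENNReal.ofReal δ ^ 2 * NNReal.pi) * areaPullback h (Metric.closedBall 0 3))) := by
        have := lintegral_areaPullback_le (h := h) 2 δ
        rw [Complex.volume_closedBall] at this
        gcongr
        refine this.trans ?_
        gcongr
        linarith
    _ = (((n + 1 : ℕ) : ℝ≥0∞) ^ 2 * ENNReal.ofReal δ ^ 2) * (ENNReal.ofReal C ^ 2 * NNReal.pi *
        areaPullback h (Metric.closedBall 0 3)) := by ring
    _ = _ := by rw [hnd, one_mul]

/-- Split the unit displacement into `n + 1` equal steps. Each step is a difference quotient
translated by at most one, which keeps the unit disc inside the disc of radius two. -/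
theorem lintegral_enorm_le (n : ℕ) :
    ∫⁻ x in Metric.closedBall 0 1, ‖h (x + 1) - h x‖ₑ ≤
      ∫⁻ x in Metric.closedBall 0 2, diffQuot h n x := by
  set N := n + 1 with hN
  have hN0 : (N : ℂ) ≠ 0 := by simp [hN]; exact Nat.cast_add_one_ne_zero n
  have hNe : (N : ℝ≥0∞) ≠ 0 := by simp [hN]
  have hNt : (N : ℝ≥0∞) ≠ ⊤ := ENNReal.natCast_ne_top _
  have htele : ∀ x, ‖h (x + 1) - h x‖ₑ ≤
      ∑ j ∈ Finset.range N, (N : ℝ≥0∞)⁻¹ * diffQuot h n (x + j * (N : ℂ)⁻¹) := by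
    intro x
    have h1 := Finset.sum_range_sub (fun j : ℕ => h (x + j * (N : ℂ)⁻¹)) N
    simp only [mul_inv_cancel₀ hN0, Nat.cast_zero, zero_mul, add_zero] at h1
    rw [← h1]
    refine (enorm_sum_le _ _).trans (le_of_eq (Finset.sum_congr rfl fun j _ => ?_))
    rw [diffQuot, ← mul_assoc, ENNReal.inv_mul_cancel hNe hNt, one_mul]
    congr 3
    rw [← hN]
    push_cast
    ring
  have htrans : ∀ j ∈ Finset.range N, ∫⁻ x in Metric.closedBall 0 1,
      (N : ℝ≥0∞)⁻¹ * diffQuot h n (x + j * (N : ℂ)⁻¹) ≤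
      (N : ℝ≥0∞)⁻¹ * ∫⁻ x in Metric.closedBall 0 2, diffQuot h n x := by
    intro j hj
    rw [lintegral_const_mul' _ _ (ENNReal.inv_ne_top.2 hNe)]
    refine mul_le_mul' le_rfl ?_
    rw [← lintegral_indicator Metric.isClosed_closedBall.measurableSet,
      ← lintegral_indicator Metric.isClosed_closedBall.measurableSet,
      ← lintegral_add_right_eq_self ((Metric.closedBall 0 2).indicator (diffQuot h n))
        (j * (N : ℂ)⁻¹)]
    refine lintegral_mono fun x => ?_
    simp only
    by_cases hx : x ∈ Metric.closedBall (0 : ℂ) 1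
    · rw [indicator_of_mem hx, indicator_of_mem]
      rw [mem_closedBall_zero_iff] at hx ⊢
      refine (norm_add_le _ _).trans ?_
      have : ‖(j : ℂ) * (N : ℂ)⁻¹‖ ≤ 1 := by
        rw [norm_mul, norm_inv, Complex.norm_natCast, Complex.norm_natCast]
        have hjN : (j : ℝ) ≤ N := by exact_mod_cast (Finset.mem_range.1 hj).le
        rw [← div_eq_mul_inv]
        exact div_le_one_of_le₀ hjN (by positivity)
      linarith
    · rw [indicator_of_notMem hx]
      exact zero_le
  calc _ ≤ ∫⁻ x in Metric.closedBall 0 1,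
        ∑ j ∈ Finset.range N, (N : ℝ≥0∞)⁻¹ * diffQuot h n (x + j * (N : ℂ)⁻¹) :=
        lintegral_mono htele
    _ = ∑ j ∈ Finset.range N, ∫⁻ x in Metric.closedBall 0 1,
        (N : ℝ≥0∞)⁻¹ * diffQuot h n (x + j * (N : ℂ)⁻¹) := by
        refine lintegral_finsetSum _ fun j _ => ?_
        exact ((measurable_diffQuot n).comp (measurable_add_const _)).const_mul _
    _ ≤ ∑ j ∈ Finset.range N, (N : ℝ≥0∞)⁻¹ * ∫⁻ x in Metric.closedBall 0 2, diffQuot h n x :=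
        Finset.sum_le_sum htrans
    _ = _ := by
        rw [Finset.sum_const, Finset.card_range, nsmul_eq_mul, ← mul_assoc,
          ENNReal.mul_inv_cancel hNe hNt, one_mul]

theorem tendsto_diffQuot {x : ℂ} (hx : HasFDerivAt h (0 : ℂ →L[ℝ] ℂ) x) :
    Tendsto (fun n => diffQuot h n x) atTop (𝓝 0) := by
  have h1 : Tendsto (fun n : ℕ => (n + 1 : ℕ) * ‖h (x + ((n + 1 : ℕ) : ℂ)⁻¹) - h x‖) atTop
      (𝓝 0) := by
    rw [hasFDerivAt_iff_tendsto] at hx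
    have hseq : Tendsto (fun n : ℕ => x + ((n + 1 : ℕ) : ℂ)⁻¹) atTop (𝓝 x) := by
      have := (tendsto_inv_atTop_nhds_zero_nat (𝕜 := ℂ)).comp (tendsto_add_atTop_nat 1)
      simpa using this.const_add x
    refine (hx.comp hseq).congr fun n => ?_
    simp only [Function.comp_apply, add_sub_cancel_left, norm_inv, Complex.norm_natCast, inv_inv,
      _root_.zero_apply, sub_zero]
  have h2 := (ENNReal.continuous_ofReal.tendsto 0).comp h1
  rw [ENNReal.ofReal_zero] at h2
  refine h2.congr fun n => ?_
  rw [Function.comp_apply, ENNReal.ofReal_mul (by positivity), ENNReal.ofReal_natCast,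
    ofReal_norm, diffQuot]

/-- A quasisymmetric homeomorphism of the plane has a nonzero derivative somewhere. -/
theorem exists_hasFDerivAt_ne_zero (hh : IsQuasisymmetric C h) :
    ∃ (z : ℂ) (A : ℂ →L[ℝ] ℂ), HasFDerivAt h A z ∧ A ≠ 0 := by
  by_contra! hcon
  -- If every derivative vanished, the difference quotients would tend to zero almost everywhere.
  -- Being bounded in `L²`, they would tend to zero in `L¹`, whereas `lintegral_enorm_le` bounds
  -- their integrals below by `I`, which is positive because `h` is injective.
  have hae : ∀ᵐ x : ℂ, Tendsto (fun n => diffQuot h n x) atTop (𝓝 0) := by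
    filter_upwards [hh.ae_differentiableAt] with x hx
    have h1 := hx.hasFDerivAt
    rw [hcon _ _ h1] at h1
    exact tendsto_diffQuot h1
  set B := ENNReal.ofReal C ^ 2 * NNReal.pi * areaPullback h (Metric.closedBall 0 3) with hB
  have hBtop : B ≠ ⊤ := by
    refine ENNReal.mul_ne_top (ENNReal.mul_ne_top (ENNReal.pow_ne_top ENNReal.ofReal_ne_top)
      ENNReal.coe_ne_top) ?_
    exact (isCompact_closedBall _ _).measure_lt_top.ne
  set I := ∫⁻ x in Metric.closedBall 0 1, ‖h (x + 1) - h x‖ₑ with hI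
  have hIpos : I ≠ 0 := by
    have hc : Continuous fun x => h (x + 1) - h x := by fun_prop
    rw [hI, ne_eq, lintegral_eq_zero_iff hc.measurable.enorm]
    intro h0
    have h1 : ∀ᵐ x ∂(volume.restrict (Metric.closedBall (0 : ℂ) 1)), False := by
      filter_upwards [h0] with x hx
      simp [sub_eq_zero] at hx
    rw [eventually_false_iff_eq_bot, ae_eq_bot, Measure.restrict_eq_zero] at h1
    exact (Metric.measure_closedBall_pos volume (0 : ℂ) one_pos).ne' h1
  have hkey : ∀ M : ℕ, I ≤ ((M + 1 : ℕ) : ℝ≥0∞)⁻¹ * B := by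
    intro M
    set m : ℝ≥0∞ := ((M + 1 : ℕ) : ℝ≥0∞) with hm
    have hm0 : m ≠ 0 := by simp [hm]
    have hmt : m ≠ ⊤ := ENNReal.natCast_ne_top _
    have hlim : Tendsto (fun n => ∫⁻ x in Metric.closedBall 0 2, min (diffQuot h n x) m) atTop
        (𝓝 (∫⁻ x in Metric.closedBall (0 : ℂ) 2, 0)) := by
      refine tendsto_lintegral_of_dominated_convergence (fun _ => m)
        (fun n => (measurable_diffQuot n).min measurable_const)
        (fun n => Eventually.of_forall fun x => min_le_right _ _) ?_ ?_
      · rw [setLIntegral_const]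
        exact ENNReal.mul_ne_top hmt measure_closedBall_lt_top.ne
      · filter_upwards [ae_restrict_of_ae hae] with x hx
        exact tendsto_of_tendsto_of_tendsto_of_le_of_le tendsto_const_nhds hx
          (fun _ => zero_le) fun _ => min_le_left _ _
    rw [lintegral_zero] at hlim
    have hbound : ∀ n, I ≤ (∫⁻ x in Metric.closedBall 0 2, min (diffQuot h n x) m) + m⁻¹ * B := by
      intro n
      refine (lintegral_enorm_le n).trans ?_
      -- Truncation at level `m`: dominated convergence handles the truncated part, and the excess
      -- is at most `g² / m`, with integral at most `B / m`.
      have hle : ∀ g : ℝ≥0∞, g ≤ min g m + m⁻¹ * g ^ 2 := by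
        intro g
        rcases le_total g m with hg | hg
        · rw [min_eq_left hg]
          exact le_self_add
        · refine le_add_left ?_
          calc g = m⁻¹ * (m * g) := by rw [← mul_assoc, ENNReal.inv_mul_cancel hm0 hmt, one_mul]
            _ ≤ m⁻¹ * g ^ 2 := by rw [sq]; gcongr
      calc _ ≤ ∫⁻ x in Metric.closedBall 0 2,
            (min (diffQuot h n x) m + m⁻¹ * diffQuot h n x ^ 2) :=
            lintegral_mono fun x => hle _
        _ = (∫⁻ x in Metric.closedBall 0 2, min (diffQuot h n x) m) +
            m⁻¹ * ∫⁻ x in Metric.closedBall 0 2, diffQuot h n x ^ 2 := by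
            rw [lintegral_add_left ((measurable_diffQuot n).min measurable_const),
              lintegral_const_mul' _ _ (ENNReal.inv_ne_top.2 hm0)]
        _ ≤ _ := by
            gcongr
            exact hh.lintegral_diffQuot_sq_le n
    have h3 := ge_of_tendsto' (hlim.add_const (m⁻¹ * B)) hbound
    rwa [zero_add] at h3
  have hlim0 : Tendsto (fun M : ℕ => ((M + 1 : ℕ) : ℝ≥0∞)⁻¹ * B) atTop (𝓝 (0 * B)) := by
    refine ENNReal.Tendsto.mul_const ?_ (Or.inr hBtop)
    exact (ENNReal.tendsto_inv_nat_nhds_zero).comp (tendsto_add_atTop_nat 1)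
  rw [zero_mul] at hlim0
  exact hIpos (le_antisymm (ge_of_tendsto' hlim0 hkey) zero_le)

end IsQuasisymmetric

end Quasisymmetric

end

noncomputable section

namespace Hyp3

/-! ### Boundary values are quasisymmetric -/

theorem bdry_fromBase_coe (p : Hyp3) (z : ℂ) : bdry (fromBase p) z = (p.z + p.t * z : ℂ) :=
  bdry_similarity_coe _ _ _ _ z

theorem bdry_fromBase_infty (p : Hyp3) : bdry (fromBase p) OnePoint.infty = OnePoint.infty :=
  bdry_similarity_infty _ _ _ _

theorem bdry_fromBase_symm_coe (p : Hyp3) (z : ℂ) :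
    bdry (fromBase p).symm z = ((z - p.z) / p.t : ℂ) := by
  have hp : (p.t : ℂ) ≠ 0 := Complex.ofReal_ne_zero.2 p.t_pos.ne'
  rw [← bdry_symm_bdry_isometry (fromBase p) ((z - p.z) / p.t : ℂ), bdry_fromBase_coe,
    mul_div_cancel₀ _ hp, add_sub_cancel]

theorem bdry_fromBase_symm_infty (p : Hyp3) :
    bdry (fromBase p).symm OnePoint.infty = OnePoint.infty := by
  conv_lhs => rw [← bdry_fromBase_infty p]
  exact bdry_symm_bdry_isometry _ _

/-- The map `H` seen from the points `p` in the source and `q` in the target. -/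
def rescale (H : Hyp3 ≃ Hyp3) (p q : Hyp3) : Hyp3 ≃ Hyp3 :=
  (fromBase p).toEquiv.trans (H.trans (fromBase q).symm.toEquiv)

theorem rescale_apply (H : Hyp3 ≃ Hyp3) (p q x : Hyp3) :
    rescale H p q x = (fromBase q).symm (H (fromBase p x)) := rfl

theorem BiLip.rescale {K : ℝ} {H : Hyp3 ≃ Hyp3} (hH : BiLip K H) (p q : Hyp3) :
    BiLip K (rescale H p q) :=
  (hH.trans_isometry _).isometry_trans _

theorem BiLip.bdry_rescale {K : ℝ} {H : Hyp3 ≃ Hyp3} (hH : BiLip K H) (p q : Hyp3)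
    (ξ : OnePoint ℂ) : bdry (Hyp3.rescale H p q) ξ =
      bdry (fromBase q).symm (bdry H (bdry (fromBase p) ξ)) := by
  have h1 : bdry (Hyp3.rescale H p q) ξ =
      bdry (H.trans (fromBase q).symm.toEquiv) (bdry (fromBase p) ξ) :=
    bdry_comp (H := H.trans (fromBase q).symm.toEquiv) (G := fromBase p)
      (tendsto_bdry_isometry _ _) ((hH.trans_isometry (fromBase q).symm).tendsto_bdry _)
  rw [h1]
  exact bdry_comp (H := (fromBase q).symm) (G := H) (hH.tendsto_bdry _)
    (tendsto_bdry_isometry _ _)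

namespace BiLip

variable {K : ℝ} {H : Hyp3 ≃ Hyp3}

theorem bdry_coe_ne_infty (hH : BiLip K H) (hinf : bdry H OnePoint.infty = OnePoint.infty)
    (z : ℂ) : bdry H z ≠ OnePoint.infty := fun h =>
  OnePoint.coe_ne_infty z (hH.bdry_injective (h.trans hinf.symm))

theorem bdry_symm_infty (hH : BiLip K H) (hinf : bdry H OnePoint.infty = OnePoint.infty) :
    bdry H.symm OnePoint.infty = OnePoint.infty := by
  conv_lhs => rw [← hinf]
  exact hH.bdry_symm_bdry _

/-- The boundary values in the plane, of a map that fixes `∞`. -/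
def planarFun (hH : BiLip K H) (hinf : bdry H OnePoint.infty = OnePoint.infty) (z : ℂ) : ℂ :=
  (OnePoint.ne_infty_iff_exists.1 (hH.bdry_coe_ne_infty hinf z)).choose

theorem coe_planarFun (hH : BiLip K H) (hinf : bdry H OnePoint.infty = OnePoint.infty) (z : ℂ) :
    (hH.planarFun hinf z : OnePoint ℂ) = bdry H z :=
  (OnePoint.ne_infty_iff_exists.1 (hH.bdry_coe_ne_infty hinf z)).choose_spec

theorem continuous_planarFun (hH : BiLip K H) (hinf : bdry H OnePoint.infty = OnePoint.infty) :
    Continuous (hH.planarFun hinf) := by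
  rw [OnePoint.isOpenEmbedding_coe.isInducing.continuous_iff]
  have : (fun z : ℂ => (z : OnePoint ℂ)) ∘ hH.planarFun hinf = fun z : ℂ => bdry H z :=
    funext fun z => hH.coe_planarFun hinf z
  rw [this]
  exact hH.continuous_bdry.comp OnePoint.continuous_coe

/-- The boundary homeomorphism of the plane, of a map that fixes `∞`. -/
def planar (hH : BiLip K H) (hinf : bdry H OnePoint.infty = OnePoint.infty) : ℂ ≃ₜ ℂ where
  toFun := hH.planarFun hinf
  invFun := hH.symm.planarFun (hH.bdry_symm_infty hinf)
  left_inv z := by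
    refine OnePoint.coe_injective ?_
    rw [coe_planarFun, coe_planarFun, hH.bdry_symm_bdry]
  right_inv z := by
    refine OnePoint.coe_injective ?_
    rw [coe_planarFun, coe_planarFun, hH.bdry_bdry_symm]
  continuous_toFun := hH.continuous_planarFun hinf
  continuous_invFun := hH.symm.continuous_planarFun _

theorem coe_planar (hH : BiLip K H) (hinf : bdry H OnePoint.infty = OnePoint.infty) (z : ℂ) :
    (hH.planar hinf z : OnePoint ℂ) = bdry H z := hH.coe_planarFun hinf z

theorem bdry_rescale_coe (hH : BiLip K H) (hinf : bdry H OnePoint.infty = OnePoint.infty)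
    (p q : Hyp3) (z : ℂ) : bdry (Hyp3.rescale H p q) z =
      ((hH.planar hinf (p.z + p.t * z) - q.z) / q.t : ℂ) := by
  rw [hH.bdry_rescale, bdry_fromBase_coe, ← hH.coe_planar hinf, bdry_fromBase_symm_coe]

theorem bdry_rescale_infty (hH : BiLip K H) (hinf : bdry H OnePoint.infty = OnePoint.infty)
    (p q : Hyp3) : bdry (Hyp3.rescale H p q) OnePoint.infty = OnePoint.infty := by
  rw [hH.bdry_rescale, bdry_fromBase_infty, hinf, bdry_fromBase_symm_infty]

end BiLip

/-! ### Uniform distortion bounds by compactness -/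

/-- A choice of a free ultrafilter on `ℕ` turns bounded sequences into convergent ones. -/
theorem exists_tendsto_hyperfilter {X : Type*} [PseudoMetricSpace X] [ProperSpace X] (a : X)
    {C : ℝ} {u : ℕ → X} (hu : ∀ n, dist (u n) a ≤ C) :
    ∃ v, dist v a ≤ C ∧ Tendsto u (hyperfilter ℕ) (𝓝 v) := by
  have hmem : ∀ᶠ n in (hyperfilter ℕ : Filter ℕ), u n ∈ Metric.closedBall a C :=
    Eventually.of_forall hu
  obtain ⟨v, hv, h⟩ := (isCompact_closedBall a C).ultrafilter_le_nhds
    ((hyperfilter ℕ : Ultrafilter ℕ).map u) (le_principal_iff.2 hmem)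
  exact ⟨v, hv, h⟩

/-- A sequence of counterexamples has a bi-Lipschitz limit whose boundary map sends both `∞` and a
point of the closed unit disc to `∞`, contrary to injectivity. -/
theorem exists_bound_bdry (K : ℝ) : ∃ C : ℝ, 0 < C ∧ ∀ F : Hyp3 ≃ Hyp3, BiLip K F →
    F base = base → bdry F OnePoint.infty = OnePoint.infty →
    ∀ η v : ℂ, ‖η‖ ≤ 1 → bdry F η = v → ‖v‖ ≤ C := by
  by_contra! hcon
  choose F hF hbase hinf η v hη hv hlarge using fun n : ℕ => hcon (n + 1) (by positivity)
  have hR : ∀ n, dist (F n base) base ≤ 0 := fun n => by rw [hbase, dist_self]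
  obtain ⟨G, hG, hlim⟩ := BiLip.exists_ultralimit (hyperfilter ℕ)
    (Eventually.of_forall hF) (Eventually.of_forall hR)
  have hGR : dist (G base) base ≤ 0 :=
    le_of_tendsto' ((hlim base).dist tendsto_const_nhds) hR
  obtain ⟨η₀, -, hη₀⟩ := exists_tendsto_hyperfilter (0 : ℂ) (C := 1) (u := η)
    (by simpa using hη)
  have h1 := tendsto_bdry_of_tendsto_coe (Eventually.of_forall hF) (Eventually.of_forall hR) hG
    hGR hlim hη₀
  have h2 := tendsto_bdry_of_tendsto_infty (Eventually.of_forall hF) (Eventually.of_forall hR) hG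
    hGR hlim
  simp only [hinf] at h2
  have hGinf : OnePoint.infty = bdry G OnePoint.infty :=
    tendsto_nhds_unique tendsto_const_nhds h2
  have hvinf : Tendsto (fun n => (v n : OnePoint ℂ)) (hyperfilter ℕ) (𝓝 OnePoint.infty) := by
    have h3 : Tendsto (fun n => ‖v n‖) (hyperfilter ℕ : Filter ℕ) atTop := by
      refine tendsto_atTop_mono (fun n => (hlarge n).le) ?_
      exact (tendsto_atTop_add_const_right _ _ tendsto_natCast_atTop_atTop).mono_left
        Nat.hyperfilter_le_atTop
    have h4 : Tendsto v (hyperfilter ℕ : Filter ℕ) (coclosedCompact ℂ) := by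
      rw [coclosedCompact_eq_cocompact, ← Metric.cobounded_eq_cocompact]
      exact tendsto_norm_atTop_iff_cobounded.1 h3
    rw [← OnePoint.comap_coe_nhds_infty] at h4
    exact tendsto_comap_iff.1 h4
  have h5 : bdry G η₀ = OnePoint.infty :=
    tendsto_nhds_unique (h1.congr fun n => hv n) hvinf
  exact OnePoint.coe_ne_infty _ (hG.bdry_injective (h5.trans hGinf))

/-- As before, a sequence of counterexamples would have a limit that identifies `0` with a point of
the unit circle. -/
theorem exists_lower_bound_bdry (K : ℝ) : ∃ C : ℝ, 0 < C ∧ ∀ F : Hyp3 ≃ Hyp3, BiLip K F →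
    F base = base → bdry F OnePoint.infty = OnePoint.infty →
    ∀ η v w : ℂ, ‖η‖ = 1 → bdry F η = v → bdry F (0 : ℂ) = w → 1 ≤ C * ‖v - w‖ := by
  obtain ⟨B, hB, hbound⟩ := exists_bound_bdry K
  by_contra! hcon
  choose F hF hbase hinf η v w hη hv hw hsmall using fun n : ℕ => hcon (n + 1) (by positivity)
  have hR : ∀ n, dist (F n base) base ≤ 0 := fun n => by rw [hbase, dist_self]
  obtain ⟨G, hG, hlim⟩ := BiLip.exists_ultralimit (hyperfilter ℕ)
    (Eventually.of_forall hF) (Eventually.of_forall hR)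
  have hGR : dist (G base) base ≤ 0 :=
    le_of_tendsto' ((hlim base).dist tendsto_const_nhds) hR
  obtain ⟨η₀, -, hη₀⟩ := exists_tendsto_hyperfilter (0 : ℂ) (C := 1) (u := η)
    (by simpa using fun n => (hη n).le)
  obtain ⟨v₀, -, hv₀⟩ := exists_tendsto_hyperfilter (0 : ℂ) (C := B) (u := v)
    (fun n => by simpa using hbound (F n) (hF n) (hbase n) (hinf n) (η n) (v n) (hη n).le (hv n))
  obtain ⟨w₀, -, hw₀⟩ := exists_tendsto_hyperfilter (0 : ℂ) (C := B) (u := w)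
    (fun n => by simpa using hbound (F n) (hF n) (hbase n) (hinf n) 0 (w n) (by simp) (hw n))
  have h1 := tendsto_bdry_of_tendsto_coe (Eventually.of_forall hF) (Eventually.of_forall hR) hG
    hGR hlim hη₀
  have h2 := tendsto_bdry_of_tendsto_coe (Eventually.of_forall hF) (Eventually.of_forall hR) hG
    hGR hlim (u := fun _ => 0) tendsto_const_nhds
  have h3 : bdry G η₀ = v₀ := tendsto_nhds_unique (h1.congr fun n => hv n)
    ((OnePoint.continuous_coe.tendsto v₀).comp hv₀)
  have h4 : bdry G (0 : ℂ) = w₀ := tendsto_nhds_unique (h2.congr fun n => hw n)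
    ((OnePoint.continuous_coe.tendsto w₀).comp hw₀)
  have h5 : ‖v₀ - w₀‖ = 0 := by
    refine tendsto_nhds_unique (hv₀.sub hw₀).norm ?_
    have h6 : Tendsto (fun n : ℕ => (n + 1 : ℝ)⁻¹) (hyperfilter ℕ : Filter ℕ) (𝓝 0) := by
      have := tendsto_one_div_add_atTop_nhds_zero_nat (𝕜 := ℝ)
      simp only [one_div] at this
      exact this.mono_left Nat.hyperfilter_le_atTop
    refine squeeze_zero (fun n => norm_nonneg _) (fun n => ?_) h6
    have hn : (0 : ℝ) < n + 1 := by positivity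
    rw [← one_div, le_div_iff₀' hn]
    exact (hsmall n).le
  rw [norm_eq_zero, sub_eq_zero] at h5
  have h6 : η₀ = 0 := OnePoint.coe_injective (hG.bdry_injective (by rw [h3, h4, h5]))
  have h7 : ‖η₀‖ = 1 := tendsto_nhds_unique hη₀.norm (by simp only [hη]; exact tendsto_const_nhds)
  rw [h6, norm_zero] at h7
  exact zero_ne_one h7

namespace BiLip

variable {K : ℝ} {H : Hyp3 ≃ Hyp3}

/-- The height of `H (x, r)` controls the distortion of the circle of radius `r` around `x`. -/
theorem exists_scale_bounds (hH : BiLip K H) (hinf : bdry H OnePoint.infty = OnePoint.infty) :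
    ∃ C : ℝ, 0 < C ∧ ∀ (x : ℂ) (r : ℝ), 0 < r →
      (∀ y, ‖y - x‖ ≤ r →
        ‖hH.planar hinf y - (H (above x r)).z‖ ≤ C * (H (above x r)).t) ∧
      ∀ w, ‖w - x‖ = r → (H (above x r)).t ≤ C * ‖hH.planar hinf w - hH.planar hinf x‖ := by
  obtain ⟨C₁, hC₁, h₁⟩ := exists_bound_bdry K
  obtain ⟨C₂, hC₂, h₂⟩ := exists_lower_bound_bdry K
  refine ⟨max C₁ C₂, lt_max_of_lt_left hC₁, fun x r hr => ?_⟩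
  set p := above x r
  set q := H p
  have hrt : p.t = r := above_t x hr
  have hpz : p.z = x := above_z x r
  have hq := q.t_pos
  have hr' : (r : ℂ) ≠ 0 := Complex.ofReal_ne_zero.2 hr.ne'
  -- Seen from `(x, r)` and its image, `H` fixes both the base point and `∞`, so the compactness
  -- bounds apply with constants independent of `x` and `r`.
  have hF := hH.rescale p q
  have hFb : Hyp3.rescale H p q base = base := by
    rw [rescale_apply, fromBase_base, fromBase_symm_self]
  have hFi := hH.bdry_rescale_infty hinf p q
  have hpt : ∀ y, bdry (Hyp3.rescale H p q) ((y - x) / r : ℂ) =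
      ((hH.planar hinf y - q.z) / q.t : ℂ) := by
    intro y
    rw [hH.bdry_rescale_coe hinf, hrt, hpz, mul_div_cancel₀ _ hr', add_sub_cancel]
  have hnorm : ∀ y, ‖(y - x) / (r : ℂ)‖ = ‖y - x‖ / r := fun y => by
    rw [norm_div, Complex.norm_real, Real.norm_of_nonneg hr.le]
  have hqn : ‖(q.t : ℂ)‖ = q.t := by rw [Complex.norm_real, Real.norm_of_nonneg hq.le]
  constructor
  · intro y hy
    have h := h₁ _ hF hFb hFi _ _ (by rw [hnorm]; exact div_le_one_of_le₀ hy hr.le) (hpt y)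
    rw [norm_div, hqn, div_le_iff₀ hq] at h
    refine h.trans ?_
    gcongr
    exact le_max_left _ _
  · intro w hw
    have hx := hpt x
    rw [sub_self, zero_div] at hx
    have h := h₂ _ hF hFb hFi _ _ _ (by rw [hnorm, hw, div_self hr.ne']) (hpt w) hx
    rw [← sub_div, sub_sub_sub_cancel_right, norm_div, hqn, mul_div_assoc', le_div_iff₀ hq,
      one_mul] at h
    refine h.trans ?_
    gcongr
    exact le_max_right _ _

/-- Compare through the height `t` of the image of `(x, ‖w - x‖)`: `‖h y - h x‖ ≤ 2 C t` and `t ≤ C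
‖h w - h x‖`. -/
theorem exists_isQuasisymmetric (hH : BiLip K H)
    (hinf : bdry H OnePoint.infty = OnePoint.infty) :
    ∃ C, IsQuasisymmetric C (hH.planar hinf) := by
  obtain ⟨C, hC, h⟩ := hH.exists_scale_bounds hinf
  refine ⟨2 * C * C, by positivity, fun x y w hyw => ?_⟩
  by_cases hwx : w = x
  · rw [hwx, sub_self, norm_zero] at hyw
    have : y = x := sub_eq_zero.1 (norm_eq_zero.1 (le_antisymm hyw (norm_nonneg _)))
    simp [this, hwx]
  have hr : 0 < ‖w - x‖ := norm_pos_iff.2 (sub_ne_zero.2 hwx)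
  obtain ⟨h1, h2⟩ := h x ‖w - x‖ hr
  have e1 := h1 y hyw
  have e2 := h1 x (by simp)
  have e3 := h2 w rfl
  have e4 := norm_sub_le_norm_sub_add_norm_sub (hH.planar hinf y) (H (above x ‖w - x‖)).z
    (hH.planar hinf x)
  rw [norm_sub_rev (H (above x ‖w - x‖)).z] at e4
  nlinarith

end BiLip

end Hyp3
end

noncomputable section

namespace Hyp3

/-! ### Zooming in at a point of differentiability -/

theorem dist_le_two_mul_cosh (p q : Hyp3) : dist p q ≤ 2 * Real.cosh (dist p q) := by
  rw [Real.cosh_eq]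
  have := Real.add_one_le_exp (dist p q)
  have := Real.exp_pos (-dist p q)
  linarith

/-- Points at comparable heights and horizontal distances are at a bounded distance. -/
theorem dist_le_of_comparable {p q : Hyp3} {C M : ℝ} (h1 : ‖p.z - q.z‖ ≤ C * p.t)
    (h2 : p.t ≤ M * q.t) (h3 : q.t ≤ M * p.t) : dist p q ≤ (C ^ 2 + 1) * M + M := by
  have hp := p.t_pos
  have hq := q.t_pos
  refine (dist_le_two_mul_cosh p q).trans ?_
  rw [cosh_dist, mul_div_assoc', div_le_iff₀ (by positivity)]
  have e1 : ‖p.z - q.z‖ ^ 2 ≤ C ^ 2 * p.t ^ 2 := by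
    rw [← mul_pow]
    gcongr
  have e2 : (C ^ 2 + 1) * p.t ^ 2 ≤ (C ^ 2 + 1) * M * (p.t * q.t) := by
    have : p.t ^ 2 ≤ M * (p.t * q.t) := by nlinarith
    calc _ ≤ (C ^ 2 + 1) * (M * (p.t * q.t)) := by gcongr
      _ = _ := by ring
  have e3 : q.t ^ 2 ≤ M * (p.t * q.t) := by nlinarith
  nlinarith

/-- Along zooms at a point of differentiability with a nonzero derivative, the rescaled maps move
the base point a bounded amount. -/
theorem BiLip.exists_zoom_bound {K : ℝ} {H : Hyp3 ≃ Hyp3} (hH : BiLip K H)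
    (hinf : bdry H OnePoint.infty = OnePoint.infty) {z : ℂ} {A : ℂ →L[ℝ] ℂ}
    (hA : HasFDerivAt (hH.planar hinf) A z) (hA0 : A ≠ 0) :
    ∃ R : ℝ, ∀ᶠ r in 𝓝[>] (0 : ℝ), dist (H (above z r)) (above (hH.planar hinf z) r) ≤ R := by
  obtain ⟨C, hC, hscale⟩ := hH.exists_scale_bounds hinf
  set h := hH.planar hinf
  obtain ⟨v, hv⟩ : ∃ v, A v ≠ 0 := by
    by_contra! hcon
    exact hA0 (ContinuousLinearMap.ext hcon)
  have hv0 : v ≠ 0 := fun h0 => hv (by rw [h0, map_zero])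
  set u : ℂ := (‖v‖⁻¹ : ℝ) • v with hu
  have hu1 : ‖u‖ = 1 := by
    rw [hu, norm_smul, Real.norm_of_nonneg (by positivity),
      inv_mul_cancel₀ (norm_ne_zero_iff.2 hv0)]
  have hAu : 0 < ‖A u‖ := by
    rw [norm_pos_iff, hu, map_smul]
    exact smul_ne_zero (inv_ne_zero (norm_ne_zero_iff.2 hv0)) hv
  set a := ‖A u‖
  have hlim : Tendsto (fun r : ℝ => ‖h (z + r * u) - h z‖ / r) (𝓝[>] 0) (𝓝 a) := by
    have h1 := (hA.hasLineDerivAt u).tendsto_slope_zero_right.norm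
    refine h1.congr' ?_
    filter_upwards [self_mem_nhdsWithin] with r hr
    have hr : 0 < r := hr
    rw [norm_smul, Real.norm_of_nonneg (inv_nonneg.2 hr.le), div_eq_inv_mul, Complex.real_smul]
  -- For small `r` the displacement in the direction `u` lies between `a r / 2` and `2 a r`. The
  -- scale bounds turn this into `q.t ≤ 2 C a r` and `r ≤ (4 C / a) q.t`; the second needs `a ≠ 0`.
  set M := max (2 * C * a) (4 * C / a) with hM
  refine ⟨(C ^ 2 + 1) * M + M, ?_⟩
  filter_upwards [self_mem_nhdsWithin, hlim.eventually (lt_mem_nhds (show a / 2 < a by linarith)),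
    hlim.eventually (gt_mem_nhds (show a < 2 * a by linarith))] with r hr h1 h2
  have hr : 0 < r := hr
  obtain ⟨s1, s2⟩ := hscale z r hr
  set q := H (above z r)
  have hq := q.t_pos
  have hnorm : ‖z + r * u - z‖ = r := by
    rw [add_sub_cancel_left, norm_mul, hu1, mul_one, Complex.norm_real,
      Real.norm_of_nonneg hr.le]
  rw [div_lt_iff₀ hr] at h2
  rw [lt_div_iff₀ hr] at h1
  have e1 := s1 z (by simpa using hr.le)
  have e2 := s1 (z + r * u) hnorm.le
  have e3 := s2 (z + r * u) hnorm
  refine dist_le_of_comparable (C := C) ?_ ?_ ?_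
  · rw [above_z, norm_sub_rev]
    exact e1
  · rw [above_t _ hr]
    calc q.t ≤ C * (2 * a * r) := e3.trans (by gcongr)
      _ = 2 * C * a * r := by ring
      _ ≤ M * r := by
        gcongr
        exact le_max_left _ _
  · rw [above_t _ hr]
    have e4 := norm_sub_le_norm_sub_add_norm_sub (h (z + r * u)) q.z (h z)
    rw [norm_sub_rev q.z] at e4
    have e5 : a / 2 * r ≤ 2 * C * q.t := by linarith
    calc r = (a / 2 * r) * (2 / a) := by field_simp
      _ ≤ (2 * C * q.t) * (2 / a) := by gcongr
      _ = 4 * C / a * q.t := by ring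
      _ ≤ M * q.t := by
        gcongr
        exact le_max_right _ _

/-- A bi-Lipschitz map that is equivariant for a cocompact family of isometries is, on the ideal
boundary, a real-linear map up to isometries. -/
theorem BiLip.exists_linear_bdry {K : ℝ} {H : Hyp3 ≃ Hyp3} (hH : BiLip K H)
    (hinf : bdry H OnePoint.infty = OnePoint.infty) {D : ℝ}
    (hco : ∀ p, ∃ γ δ : Hyp3 ≃ᵢ Hyp3, dist (γ base) p ≤ D ∧ ∀ x, H (γ x) = δ (H x)) :
    ∃ (A : ℂ →L[ℝ] ℂ) (ε κ : Hyp3 ≃ᵢ Hyp3),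
      ∀ ξ, bdry ε (bdry H (bdry κ ξ)) = OnePoint.map A ξ := by
  obtain ⟨C, hqs⟩ := hH.exists_isQuasisymmetric hinf
  obtain ⟨z, A, hA, hA0⟩ := hqs.exists_hasFDerivAt_ne_zero
  obtain ⟨R, hR⟩ := hH.exists_zoom_bound hinf hA hA0
  set h := hH.planar hinf
  choose γ δ hγ hγδ using hco
  let P : ℝ → Hyp3 := above z
  let Q : ℝ → Hyp3 := above (h z)
  let F : ℝ → Hyp3 ≃ Hyp3 := fun r => Hyp3.rescale H (P r) (Q r)
  -- Since `H ∘ γ = δ ∘ H`, the zoom `F r` equals `e r ∘ H ∘ k r`, with `H` itself in the middle.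
  -- Here `k r` stays bounded by cocompactness, and `e r` then does because `F r` does.
  let k : ℝ → Hyp3 ≃ᵢ Hyp3 := fun r => (fromBase (P r)).trans (γ (P r)).symm
  let e : ℝ → Hyp3 ≃ᵢ Hyp3 := fun r => (δ (P r)).trans (fromBase (Q r)).symm
  have hfac : ∀ r x, F r x = e r (H (k r x)) := by
    intro r x
    simp only [F, e, k, rescale_apply, IsometryEquiv.trans_apply]
    rw [← hγδ, IsometryEquiv.apply_symm_apply]
  let l : Ultrafilter ℝ := Ultrafilter.of (𝓝[>] (0 : ℝ))
  have hl : (l : Filter ℝ) ≤ 𝓝[>] (0 : ℝ) := Ultrafilter.of_le _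
  have hFR : ∀ᶠ r in l, dist (F r base) base ≤ R := by
    filter_upwards [hl hR] with r hr
    change dist (Hyp3.rescale H (P r) (Q r) base) base ≤ R
    rw [rescale_apply, fromBase_base, ← fromBase_symm_self (Q r), IsometryEquiv.dist_eq]
    exact hr
  have hkD : ∀ r, dist (k r base) base ≤ D := by
    intro r
    have h1 := hγ (P r)
    have : k r base = (γ (P r)).symm (P r) := by simp [k]
    rw [this, ← (γ (P r)).dist_eq, IsometryEquiv.apply_symm_apply, dist_comm]
    exact h1
  have heR : ∀ᶠ r in l, dist (e r base) base ≤ dist (H base) base + K * D + R := by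
    filter_upwards [hFR] with r hr
    rw [hfac] at hr
    have h1 := dist_triangle (e r base) (e r (H (k r base))) base
    rw [(e r).dist_eq] at h1
    have h2 := dist_triangle base (H base) (H (k r base))
    have h3 := hH.le base (k r base)
    have h4 : K * dist base (k r base) ≤ K * D := by
      have := hH.pos
      rw [dist_comm]
      gcongr
      exact hkD r
    rw [dist_comm base (H base)] at h2
    linarith
  obtain ⟨κ', hκ', hκlim⟩ := BiLip.exists_ultralimit l (F := fun r => (k r).toEquiv)
    (Eventually.of_forall fun r => BiLip.of_isometry (k r)) (Eventually.of_forall hkD)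
  obtain ⟨ε', hε', hεlim⟩ := BiLip.exists_ultralimit l (F := fun r => (e r).toEquiv)
    (Eventually.of_forall fun r => BiLip.of_isometry (e r)) heR
  let κ := hκ'.toIsometry
  let ε := hε'.toIsometry
  let G : Hyp3 ≃ Hyp3 := κ.toEquiv.trans (H.trans ε.toEquiv)
  have hG : BiLip K G := (hH.trans_isometry ε).isometry_trans κ
  have hF : ∀ r, BiLip K (F r) := fun r => hH.rescale _ _
  have hFG : ∀ x, Tendsto (fun r => F r x) l (𝓝 (G x)) := by
    intro x
    have h1 : Tendsto (fun r => H (k r x)) l (𝓝 (H (κ x))) :=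
      (hH.continuous.tendsto _).comp (hκlim x)
    have h2 : Tendsto (fun r => e r (H (κ x))) l (𝓝 (ε (H (κ x)))) := hεlim (H (κ x))
    rw [tendsto_iff_dist_tendsto_zero] at h1 h2 ⊢
    refine squeeze_zero (fun _ => dist_nonneg) (fun r => ?_) (by simpa using h1.add h2)
    rw [hfac]
    have h3 := dist_triangle (e r (H (k r x))) (e r (H (κ x))) (ε (H (κ x)))
    rwa [(e r).dist_eq] at h3
  have hGR : dist (G base) base ≤ R := le_of_tendsto ((hFG base).dist tendsto_const_nhds) hFR
  have hGb : ∀ ξ, bdry G ξ = bdry ε (bdry H (bdry κ ξ)) := by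
    intro ξ
    have h1 : bdry G ξ = bdry (H.trans ε.toEquiv) (bdry κ ξ) :=
      bdry_comp (H := H.trans ε.toEquiv) (G := κ) (tendsto_bdry_isometry _ _)
        ((hH.trans_isometry ε).tendsto_bdry _)
    rw [h1]
    exact bdry_comp (H := ε) (G := H) (hH.tendsto_bdry _) (tendsto_bdry_isometry _ _)
  refine ⟨A, ε, κ, fun ξ => ?_⟩
  rw [← hGb]
  induction ξ using OnePoint.rec with
  | infty =>
    have h1 := tendsto_bdry_of_tendsto_infty (Eventually.of_forall hF) hFR hG hGR hFG
    refine tendsto_nhds_unique h1 (tendsto_const_nhds.congr fun r => ?_)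
    exact (hH.bdry_rescale_infty hinf _ _).symm
  | coe η =>
    have h1 := tendsto_bdry_of_tendsto_coe (Eventually.of_forall hF) hFR hG hGR hFG
      (u := fun _ => η) tendsto_const_nhds
    refine tendsto_nhds_unique h1 ?_
    -- At `η` the boundary value of the zoom is the difference quotient of `h` at `z` with step `r
    -- η`, which tends to `A η`.
    have h2 := ((hA.hasLineDerivAt η).tendsto_slope_zero_right).mono_left hl
    refine ((OnePoint.continuous_coe.tendsto _).comp h2).congr' ?_
    filter_upwards [hl self_mem_nhdsWithin] with r hr
    have hr : 0 < r := hr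
    change _ = bdry (Hyp3.rescale H (P r) (Q r)) η
    rw [hH.bdry_rescale_coe hinf]
    simp only [P, Q, above_z, above_t _ hr, Function.comp_apply, Complex.real_smul,
      Complex.ofReal_inv]
    rw [div_eq_inv_mul]

/-! ### Linear conjugations between isometries -/

theorem normSq_linear (A : ℂ →L[ℝ] ℂ) (v : ℂ) : ‖A v‖ ^ 2 = v.re ^ 2 * ‖A 1‖ ^ 2 +
    v.im ^ 2 * ‖A Complex.I‖ ^ 2 + 2 * v.re * v.im *
      ((A 1).re * (A Complex.I).re + (A 1).im * (A Complex.I).im) := by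
  have hv : A v = v.re * A 1 + v.im * A Complex.I := by
    conv_lhs => rw [← Complex.re_add_im v]
    rw [map_add]
    congr 1
    · rw [← mul_one (v.re : ℂ), ← Complex.real_smul, map_smul, Complex.real_smul]
      simp
    · rw [← Complex.real_smul, map_smul, Complex.real_smul]
  rw [hv]
  simp only [Complex.sq_norm, Complex.normSq_apply, Complex.add_re, Complex.add_im,
    Complex.re_ofReal_mul, Complex.im_ofReal_mul]
  ring

/-- For orthonormal vectors, the sum of the squared norms of the images is the trace. -/
theorem normSq_linear_add (A : ℂ →L[ℝ] ℂ) {v w : ℂ} (hv : ‖v‖ = 1) (hw : ‖w‖ = 1)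
    (hvw : ‖v - w‖ ^ 2 = 2) : ‖A v‖ ^ 2 + ‖A w‖ ^ 2 = ‖A 1‖ ^ 2 + ‖A Complex.I‖ ^ 2 := by
  rw [normSq_linear A v, normSq_linear A w]
  have hv' : v.re ^ 2 + v.im ^ 2 = 1 := by
    have := Complex.sq_norm v
    rw [hv, Complex.normSq_apply] at this
    linarith
  have hw' : w.re ^ 2 + w.im ^ 2 = 1 := by
    have := Complex.sq_norm w
    rw [hw, Complex.normSq_apply] at this
    linarith
  rw [norm_sub_sq_complex, hv, hw] at hvw
  have horth : v.re * w.re + v.im * w.im = 0 := by linarith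
  set a := v.re
  set b := v.im
  set c := w.re
  set d := w.im
  -- This is the determinant of the frame; orthonormality gives `w = e i v` with `e² = 1`.
  set e := a * d - b * c with he
  have hc : c = -b * e := by
    rw [he]
    linear_combination (-c) * hv' + a * horth
  have hd : d = a * e := by
    rw [he]
    linear_combination (-d) * hv' + b * horth
  have he2 : e ^ 2 = 1 := by
    rw [he]
    linear_combination (a ^ 2 + b ^ 2) * hw' + hv' - (a * c + b * d) * horth
  rw [hc, hd]
  linear_combination (‖A 1‖ ^ 2 + ‖A Complex.I‖ ^ 2) * hv' + (b ^ 2 * ‖A 1‖ ^ 2 +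
    a ^ 2 * ‖A Complex.I‖ ^ 2 - 2 * a * b *
      ((A 1).re * (A Complex.I).re + (A 1).im * (A Complex.I).im)) * he2

/-- A real-linear map that conjugates an isometry not fixing `∞` to an isometry is a
similarity. -/
theorem exists_norm_eq_of_conj {A : ℂ →L[ℝ] ℂ} (hA : Function.Injective A)
    {g g' : Hyp3 ≃ᵢ Hyp3}
    (hconj : ∀ ξ, bdry g' (OnePoint.map A ξ) = OnePoint.map A (bdry g ξ))
    (hg : bdry g OnePoint.infty ≠ OnePoint.infty) : ∃ l : ℝ, 0 < l ∧ ∀ v, ‖A v‖ = l * ‖v‖ := by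
  obtain ⟨c, hc⟩ := OnePoint.ne_infty_iff_exists.1 hg
  obtain ⟨w, hw⟩ : ∃ w : ℂ, bdry g w = OnePoint.infty := by
    have h1 : bdry g.symm OnePoint.infty ≠ OnePoint.infty := fun h =>
      hg (by conv_lhs => rw [← h]
             exact bdry_bdry_symm_isometry g _)
    obtain ⟨w, hw⟩ := OnePoint.ne_infty_iff_exists.1 h1
    exact ⟨w, by rw [hw]; exact bdry_bdry_symm_isometry g _⟩
  have hc' : bdry g' OnePoint.infty = (A c : ℂ) := by
    have := hconj OnePoint.infty
    rwa [← hc, OnePoint.map_infty, OnePoint.map_some] at this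
  have hw' : bdry g' (A w : ℂ) = OnePoint.infty := by
    have := hconj w
    rwa [hw, OnePoint.map_infty, OnePoint.map_some] at this
  obtain ⟨m, hm, f, hf, hfc, hff⟩ := exists_norm_bdry g hc.symm hw
  obtain ⟨m', hm', f', hf', hfc', -⟩ := exists_norm_bdry g' hc' hw'
  have hff' : ∀ x, x ≠ w → f' (A x) = A (f x) := by
    intro x hx
    have h1 := hconj x
    rw [OnePoint.map_some, hf x hx, OnePoint.map_some, hf' (A x) (hA.ne hx)] at h1
    exact OnePoint.coe_injective h1
  -- The isometry `g` carries the unit circle about its pole `w` to the circle of radius `m` about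
  -- `c`, preserving chords up to the factor `m`. Thus `V` preserves distances on the unit circle,
  -- and in particular orthonormal pairs.
  let V : ℂ → ℂ := fun u => (m⁻¹ : ℝ) • (f (w + u) - c)
  have hne : ∀ {u : ℂ}, ‖u‖ = 1 → w + u ≠ w := fun hu h => by
    have : ‖(0 : ℂ)‖ = 1 := by rwa [add_eq_left.1 h] at hu
    simp at this
  have hV1 : ∀ u, ‖u‖ = 1 → ‖V u‖ = 1 := by
    intro u hu
    simp only [V]
    rw [norm_smul, hfc _ (hne hu), add_sub_cancel_left, hu, div_one,
      Real.norm_of_nonneg (by positivity), inv_mul_cancel₀ hm.ne']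
  have hV2 : ∀ u u', ‖u‖ = 1 → ‖u'‖ = 1 → ‖V u - V u'‖ = ‖u - u'‖ := by
    intro u u' hu hu'
    simp only [V]
    rw [← smul_sub, sub_sub_sub_cancel_right, norm_smul, hff _ _ (hne hu) (hne hu'),
      add_sub_cancel_left, add_sub_cancel_left, hu, hu', Real.norm_of_nonneg (by positivity),
      add_sub_add_left_eq_sub]
    field_simp
  have hApos : ∀ u, ‖u‖ = 1 → 0 < ‖A u‖ := fun u hu => by
    refine norm_pos_iff.2 fun h => ?_
    have h0 : u = 0 := hA (by rw [h, map_zero])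
    simp [h0] at hu
  -- Conjugation by `A` carries the pole `w` and centre `c` of `g` to those of `g'`, so the
  -- distortion formula for `g'` relates `‖A (V u)‖` to the inverse of `‖A u‖`.
  have hprod : ∀ u, ‖u‖ = 1 → ‖A (V u)‖ * ‖A u‖ = m' / m := by
    intro u hu
    have h1 := hfc' (A (w + u)) (hA.ne (hne hu))
    rw [hff' _ (hne hu), ← map_sub, ← map_sub, add_sub_cancel_left] at h1
    simp only [V]
    rw [map_smul, norm_smul, h1, Real.norm_of_nonneg (by positivity)]
    have := (hApos u hu).ne'
    field_simp
  set T := ‖A 1‖ ^ 2 + ‖A Complex.I‖ ^ 2 with hT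
  have hTpos : 0 < T := by
    have := hApos 1 norm_one
    positivity
  have horth : ∀ u : ℂ, ‖u‖ = 1 → ‖u - Complex.I * u‖ ^ 2 = 2 := by
    intro u hu
    have : u - Complex.I * u = (1 - Complex.I) * u := by ring
    rw [this, norm_mul, hu, mul_one, Complex.sq_norm, Complex.normSq_apply]
    norm_num
  -- Let `a`, `b` be the squared norms of `A u` and `A (i u)`. Both `a + b` and `(m' / m)² (1 / a +
  -- 1 / b)` equal the trace `T`, since `V` preserves orthonormal pairs. Hence `a b = (m' / m)²` for
  -- every frame.
  have hkey : ∀ u : ℂ, ‖u‖ = 1 → ‖A u‖ ^ 2 * ‖A (Complex.I * u)‖ ^ 2 = (m' / m) ^ 2 := by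
    intro u hu
    have hIu : ‖Complex.I * u‖ = 1 := by simp [hu]
    have h1 := normSq_linear_add A hu hIu (horth u hu)
    have h2 := normSq_linear_add A (hV1 u hu) (hV1 _ hIu)
      (by rw [hV2 _ _ hu hIu]; exact horth u hu)
    have p1 := hprod u hu
    have p2 := hprod _ hIu
    have a1 := hApos u hu
    have a2 := hApos _ hIu
    rw [← eq_div_iff a1.ne'] at p1
    rw [← eq_div_iff a2.ne'] at p2
    rw [p1, p2, ← h1, div_pow _ ‖A u‖, div_pow _ ‖A (Complex.I * u)‖] at h2
    have h3 : (m' / m) ^ 2 * (‖A u‖ ^ 2 + ‖A (Complex.I * u)‖ ^ 2) =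
        ‖A u‖ ^ 2 * ‖A (Complex.I * u)‖ ^ 2 * (‖A u‖ ^ 2 + ‖A (Complex.I * u)‖ ^ 2) := by
      have hx : ‖A u‖ ^ 2 ≠ 0 := by positivity
      have hy : ‖A (Complex.I * u)‖ ^ 2 ≠ 0 := by positivity
      rw [div_add_div _ _ hx hy, div_eq_iff (mul_ne_zero hx hy)] at h2
      linear_combination h2
    have h4 : ‖A u‖ ^ 2 + ‖A (Complex.I * u)‖ ^ 2 ≠ 0 := by positivity
    exact (mul_right_cancel₀ h4 h3).symm
  -- The product is the same in all orthonormal frames. Comparing the standard frame with two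
  -- rational rotations of it gives `Z (X - Y) = 0` and `(X - Y)² = 4 Z²`, so that `X = Y` and `Z =
  -- 0`.
  have k0 := hkey 1 norm_one
  have k1 := hkey ⟨3 / 5, 4 / 5⟩ (by
    rw [← sq_eq_sq₀ (norm_nonneg _) zero_le_one, Complex.sq_norm, Complex.normSq_apply]
    norm_num)
  have k2 := hkey ⟨4 / 5, 3 / 5⟩ (by
    rw [← sq_eq_sq₀ (norm_nonneg _) zero_le_one, Complex.sq_norm, Complex.normSq_apply]
    norm_num)
  rw [mul_one] at k0
  rw [normSq_linear A ⟨3 / 5, 4 / 5⟩, normSq_linear A (Complex.I * _)] at k1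
  rw [normSq_linear A ⟨4 / 5, 3 / 5⟩, normSq_linear A (Complex.I * _)] at k2
  simp only [Complex.I_mul_re, Complex.I_mul_im] at k1 k2
  set X := ‖A 1‖ ^ 2 with hX
  set Y := ‖A Complex.I‖ ^ 2 with hY
  set Z := (A 1).re * (A Complex.I).re + (A 1).im * (A Complex.I).im with hZ
  have hZ1 : Z * (X - Y) = 0 := by linear_combination (625 / 336) * (k1 - k2)
  have hZ2 : (X - Y) ^ 2 = 4 * Z ^ 2 := by
    linear_combination (625 / 288) * (k1 + k2) - (625 / 144) * k0
  have hZ0 : Z = 0 := by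
    rcases mul_eq_zero.1 hZ1 with h | h
    · exact h
    · rw [h] at hZ2
      nlinarith
  have hXY : X = Y := by
    rw [hZ0] at hZ2
    have : (X - Y) ^ 2 = 0 := by rw [hZ2]; ring
    exact sub_eq_zero.1 (pow_eq_zero_iff two_ne_zero |>.1 this)
  refine ⟨‖A 1‖, hApos 1 norm_one, fun v => ?_⟩
  rw [← sq_eq_sq₀ (norm_nonneg _) (by positivity), normSq_linear, ← hX, ← hY, ← hZ, hZ0, ← hXY,
    mul_pow, Complex.sq_norm v, Complex.normSq_apply, ← hX]
  ring

end Hyp3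
end

noncomputable section

open Hyp3

/-! ### Lattices -/

namespace NiceLattice

/-- The compact quotient has finite diameter, and distances there are distances between orbits. -/
theorem exists_dist_le (L : NiceLattice) :
    ∃ D : ℝ, ∀ p, ∃ γ ∈ L.Γ, dist (γ base) p ≤ D := by
  obtain ⟨D, hD⟩ := Metric.isBounded_iff.1 (isCompact_univ (X := L.Manifold)).isBounded
  refine ⟨D + 1, fun p => ?_⟩
  have h := hD (mem_univ (L.proj p)) (mem_univ (L.proj base))
  rw [dist_eq_infDist] at h
  have hne : (L.proj ⁻¹' {L.proj base}).Nonempty := ⟨base, rfl⟩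
  obtain ⟨q, hq, hpq⟩ := (Metric.infDist_lt_iff hne).1 (h.trans_lt (lt_add_one D))
  have hq' : L.proj q = L.proj base := hq
  obtain ⟨γ, hγ⟩ := L.proj_eq_iff.1 hq'
  rw [← hγ, dist_comm] at hpq
  exact ⟨γ.1, γ.2, hpq.le⟩

end NiceLattice

theorem Hyp3.exists_bdry_infty_eq (ξ : OnePoint ℂ) :
    ∃ α : Hyp3 ≃ᵢ Hyp3, bdry α OnePoint.infty = ξ := by
  induction ξ using OnePoint.rec with
  | infty => exact ⟨translation 0, bdry_translation_infty 0⟩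
  | coe z =>
    refine ⟨inversion.trans (translation z), ?_⟩
    rw [bdry_trans, bdry_inversion_infty, bdry_translation_coe, zero_add]

namespace NiceLattice

/-- A cocompact lattice has no common fixed point at infinity. -/
theorem exists_bdry_ne (L : NiceLattice) (ξ : OnePoint ℂ) : ∃ γ ∈ L.Γ, bdry γ ξ ≠ ξ := by
  by_contra! hfix
  obtain ⟨α, hα⟩ := exists_bdry_infty_eq ξ
  obtain ⟨D, hD⟩ := L.exists_dist_le
  -- With the common fixed point moved to `∞` by `α`, the whole lattice acts by similarities.
  have hsim : ∀ γ ∈ L.Γ, ∃ (Ψ : ℂ ≃ ℂ) (l : ℝ), 0 < l ∧ (∀ z w, ‖Ψ z - Ψ w‖ = l * ‖z - w‖) ∧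
      ∀ p, (α.symm (γ p)).z = Ψ (α.symm p).z ∧ (α.symm (γ p)).t = l * (α.symm p).t := by
    intro γ hγ
    obtain ⟨Ψ, l, hl, hΨ, h⟩ := exists_eq_similarity ((α.trans γ).trans α.symm) (by
      rw [bdry_trans, bdry_trans, hα, hfix γ hγ, ← hα, bdry_symm_bdry_isometry])
    refine ⟨Ψ, l, hl, hΨ, fun p => ?_⟩
    have h1 : α.symm (γ p) = similarity Ψ l hl hΨ (α.symm p) := by
      rw [← h]
      simp
    rw [h1]
    exact ⟨rfl, rfl⟩
  have hco : ∀ p, ∃ γ ∈ L.Γ, dist (α.symm (γ base)) p ≤ D := by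
    intro p
    obtain ⟨γ, hγ, h⟩ := hD (α p)
    exact ⟨γ, hγ, by rwa [← α.dist_eq, α.apply_symm_apply]⟩
  -- An element carrying the base point within `D` of a target so low that `exp D` times its height
  -- is only half the original height must contract.
  obtain ⟨γ, hγ, Ψ, l, hl, hl1, hΨ, hγα⟩ : ∃ γ ∈ L.Γ, ∃ (Ψ : ℂ ≃ ℂ) (l : ℝ), 0 < l ∧ l < 1 ∧
      (∀ z w, ‖Ψ z - Ψ w‖ = l * ‖z - w‖) ∧
      ∀ p, (α.symm (γ p)).z = Ψ (α.symm p).z ∧ (α.symm (γ p)).t = l * (α.symm p).t := by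
    have hb := (α.symm base).t_pos
    have hx : 0 < (α.symm base).t * Real.exp (-D) / 2 := by positivity
    obtain ⟨γ, hγ, h⟩ := hco (above 0 ((α.symm base).t * Real.exp (-D) / 2))
    obtain ⟨Ψ, l, hl, hΨ, hγα⟩ := hsim γ hγ
    refine ⟨γ, hγ, Ψ, l, hl, ?_, hΨ, hγα⟩
    have h1 := height_le (α.symm (γ base)) (above 0 ((α.symm base).t * Real.exp (-D) / 2))
    rw [above_t _ hx, (hγα base).2] at h1
    have h2 : (α.symm base).t * Real.exp (-D) / 2 * Real.exp (dist (α.symm (γ base))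
        (above 0 ((α.symm base).t * Real.exp (-D) / 2))) ≤
        (α.symm base).t * Real.exp (-D) / 2 * Real.exp D := by gcongr
    have h3 : Real.exp (-D) * Real.exp D = 1 := by rw [← Real.exp_add]; simp
    have h4 : (α.symm base).t * Real.exp (-D) / 2 * Real.exp D = (α.symm base).t / 2 := by
      linear_combination ((α.symm base).t / 2) * h3
    nlinarith
  obtain ⟨w, hw⟩ : ∃ w, Ψ w = w := by
    have hcontr : ContractingWith ⟨l, hl.le⟩ Ψ := by
      refine ⟨by exact_mod_cast hl1, LipschitzWith.of_dist_le_mul fun z w => ?_⟩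
      rw [dist_eq_norm, dist_eq_norm, hΨ]
      rfl
    exact ⟨hcontr.fixedPoint, hcontr.fixedPoint_isFixedPt⟩
  have hiter : ∀ (n : ℕ) (p : Hyp3), ‖(α.symm ((γ ^ n) p)).z - w‖ =
      l ^ n * ‖(α.symm p).z - w‖ ∧ (α.symm ((γ ^ n) p)).t = l ^ n * (α.symm p).t := by
    intro n
    induction n with
    | zero =>
      intro p
      simp
    | succ n ih =>
      intro p
      have h1 : (γ ^ (n + 1)) p = γ ((γ ^ n) p) := by
        rw [pow_succ']
        rfl
      rw [h1, (hγα _).1, (hγα _).2, (ih p).2]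
      refine ⟨?_, by ring⟩
      conv_lhs => rw [← hw]
      rw [hΨ, (ih p).1]
      ring
  set b := α (above w 1) with hb
  have hball : ∀ g ∈ L.Γ, (α.symm (g b)).z = w := by
    intro g hg
    obtain ⟨Θ, m, hm, hΘ, hgα⟩ := hsim g hg
    have hpt : ∀ n : ℕ, ‖(α.symm ((γ ^ n * g * (γ ^ n)⁻¹) b)).z - w‖ = l ^ n * ‖Θ w - w‖ ∧
        (α.symm ((γ ^ n * g * (γ ^ n)⁻¹) b)).t = m := by
      intro n
      have hln : (0 : ℝ) < l ^ n := by positivity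
      set y := (γ ^ n)⁻¹ b with hy
      have hyb : (γ ^ n) y = b := by
        rw [hy]
        exact (γ ^ n).apply_symm_apply b
      have h1 := hiter n y
      rw [hyb, hb, α.symm_apply_apply, above_z, sub_self, norm_zero, above_t _ one_pos] at h1
      have hyz : (α.symm y).z = w := by
        have := (mul_eq_zero.1 h1.1.symm).resolve_left hln.ne'
        exact sub_eq_zero.1 (norm_eq_zero.1 this)
      have h2 := hiter n (g y)
      rw [(hgα y).1, (hgα y).2, hyz] at h2
      refine ⟨h2.1, h2.2.trans ?_⟩
      linear_combination (-m) * h1.2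
    set d := ‖Θ w - w‖ with hd
    set M := max m m⁻¹
    set R := ((d / m) ^ 2 + 1) * M + M with hRdef
    have hRb : ∀ n : ℕ, dist ((γ ^ n * g * (γ ^ n)⁻¹) b) b ≤ R := by
      intro n
      rw [← α.symm.dist_eq, hb, α.symm_apply_apply, ← hb]
      obtain ⟨h1, h2⟩ := hpt n
      refine dist_le_of_comparable ?_ ?_ ?_
      · rw [above_z, h1, h2, div_mul_cancel₀ _ hm.ne']
        exact mul_le_of_le_one_left (norm_nonneg _) (pow_le_one₀ hl.le hl1.le)
      · rw [h2, above_t _ one_pos, mul_one]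
        exact le_max_left _ _
      · rw [h2, above_t _ one_pos, ← div_le_iff₀ hm, one_div]
        exact le_max_right _ _
    have hK : IsCompact (Metric.closedBall b R) := isCompact_closedBall b R
    have hR0 : 0 ≤ R := dist_nonneg.trans (hRb 0)
    have hfin := ProperlyDiscontinuousSMul.finite_disjoint_inter_image (Γ := L.Γ) hK hK
    have hmem : ∀ n : ℕ, (⟨γ ^ n * g * (γ ^ n)⁻¹, L.Γ.mul_mem (L.Γ.mul_mem (L.Γ.pow_mem hγ n) hg)
        (L.Γ.inv_mem (L.Γ.pow_mem hγ n))⟩ : L.Γ) ∈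
        {γ : L.Γ | (((γ • ·) '' Metric.closedBall b R) ∩ Metric.closedBall b R).Nonempty} := by
      intro n
      refine ⟨(γ ^ n * g * (γ ^ n)⁻¹) b, ⟨b, ?_, rfl⟩, hRb n⟩
      exact Metric.mem_closedBall_self hR0
    -- The conjugates `γ ^ n * g * (γ ^ n)⁻¹` all move `b` by at most `R`, so there are only
    -- finitely many of them. If `d ≠ 0`, their horizontal displacements `l ^ n * d` would all
    -- differ.
    have hd0 : d = 0 := by
      by_contra hd0
      refine Set.infinite_of_injective_forall_mem (fun n k heq => ?_) hmem hfin
      have heq' : γ ^ n * g * (γ ^ n)⁻¹ = γ ^ k * g * (γ ^ k)⁻¹ := congrArg Subtype.val heq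
      have h1 := (hpt n).1
      rw [heq', (hpt k).1] at h1
      exact (pow_right_injective₀ hl hl1.ne (mul_right_cancel₀ hd0 h1)).symm
    rw [(hgα b).1, hb, α.symm_apply_apply, above_z]
    exact sub_eq_zero.1 (norm_eq_zero.1 hd0)
  -- The orbit of `b` lies on the vertical line over `w`. Cocompactness would bring it within `D'`
  -- of the point of height one over `w + N`, but that allows a horizontal offset of at most `exp
  -- D'`.
  set D' := dist b base + D
  set N : ℂ := ((Real.exp D' + 1 : ℝ) : ℂ)
  obtain ⟨g, hg, h⟩ := hco (above (w + N) 1)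
  have h1 : dist (α.symm (g b)) (above (w + N) 1) ≤ D' := by
    refine (dist_triangle _ (α.symm (g base)) _).trans ?_
    rw [α.symm.dist_eq, g.dist_eq]
    simp only [D']
    gcongr
  have h2 := norm_z_sub_le (α.symm (g b)) (above (w + N) 1)
  rw [hball g hg, above_z, above_t _ one_pos, one_mul, sub_add_cancel_left, norm_neg,
    Complex.norm_real, Real.norm_of_nonneg (by positivity)] at h2
  have h3 := Real.exp_le_exp.2 h1
  linarith

end NiceLattice

/-! ### From boundary values to an equivariant isometry -/

/-- The boundary values of a bi-Lipschitz map between lattices are those of an isometry. -/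
theorem Hyp3.BiLip.exists_isometry_bdry_eq {L₁ L₂ : NiceLattice} {K : ℝ} {H : Hyp3 ≃ Hyp3}
    (hH : BiLip K H) (hconj : Conjugates L₁ L₂ H) :
    ∃ Φ : Hyp3 ≃ᵢ Hyp3, ∀ ξ, bdry Φ ξ = bdry H ξ := by
  obtain ⟨β', hβ'⟩ := exists_bdry_infty_eq (bdry H OnePoint.infty)
  set β := β'.symm
  have hβ : bdry β (bdry H OnePoint.infty) = OnePoint.infty := by
    rw [← hβ']
    exact bdry_symm_bdry_isometry β' _
  set G := H.trans β.toEquiv with hGdef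
  have hG : BiLip K G := hH.trans_isometry β
  have hGb : ∀ ξ, bdry G ξ = bdry β (bdry H ξ) := fun ξ =>
    bdry_comp (H := β) (G := H) (hH.tendsto_bdry _) (tendsto_bdry_isometry _ _)
  have hGinf : bdry G OnePoint.infty = OnePoint.infty := by rw [hGb, hβ]
  have hequi : ∀ γ ∈ L₁.Γ, ∃ δ : Hyp3 ≃ᵢ Hyp3, ∀ x, G (γ x) = δ (G x) := by
    intro γ hγ
    obtain ⟨γ₂, -, h⟩ := hconj.1 γ hγ
    refine ⟨(β.symm.trans γ₂).trans β, fun x => ?_⟩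
    have h1 : H (γ x) = γ₂ (H x) := congrFun h x
    change β (H (γ x)) = β (γ₂ (β.symm (β (H x))))
    rw [h1, β.symm_apply_apply]
  obtain ⟨D, hD⟩ := L₁.exists_dist_le
  obtain ⟨A, ε, κ, hA⟩ := hG.exists_linear_bdry hGinf (D := D) (fun p => by
    obtain ⟨γ, hγ, h⟩ := hD p
    obtain ⟨δ, hδ⟩ := hequi γ hγ
    exact ⟨γ, δ, h, hδ⟩)
  have hinj : Function.Injective A := by
    intro x y hxy
    have h1 : OnePoint.map A (x : OnePoint ℂ) = OnePoint.map A (y : OnePoint ℂ) := by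
      rw [OnePoint.map_some, OnePoint.map_some, hxy]
    rw [← hA, ← hA] at h1
    exact OnePoint.coe_injective ((BiLip.of_isometry κ).bdry_injective
      (hG.bdry_injective ((BiLip.of_isometry ε).bdry_injective h1)))
  -- An element moving the boundary point `κ ∞` becomes, after conjugation by `κ`, an isometry that
  -- does not fix `∞`.
  obtain ⟨γ, hγ, hne⟩ := L₁.exists_bdry_ne (bdry κ OnePoint.infty)
  obtain ⟨δ, hδ⟩ := hequi γ hγ
  have hδb : ∀ ξ, bdry G (bdry γ ξ) = bdry δ (bdry G ξ) := by
    intro ξ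
    have h1 := bdry_comp (H := G) (tendsto_bdry_isometry γ ξ) (hG.tendsto_bdry _)
    have h2 := bdry_comp (H := δ) (hG.tendsto_bdry ξ) (tendsto_bdry_isometry δ _)
    rw [← h1, ← h2]
    congr 1
    exact funext hδ
  obtain ⟨l, hl, hAl⟩ := exists_norm_eq_of_conj hinj (g := (κ.trans γ).trans κ.symm)
    (g' := (ε.symm.trans δ).trans ε)
    (fun ξ => by
      rw [← hA, ← hA, bdry_trans, bdry_trans, bdry_trans, bdry_trans, bdry_symm_bdry_isometry,
        bdry_bdry_symm_isometry, hδb])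
    (fun h => by
      rw [bdry_trans, bdry_trans] at h
      refine hne ?_
      have h2 := congrArg (bdry κ) h
      rwa [bdry_bdry_symm_isometry] at h2)
  let Ψ : ℂ ≃ ℂ := (LinearEquiv.ofInjectiveEndo A.toLinearMap hinj).toEquiv
  have hΨ : ∀ z, Ψ z = A z := fun z => rfl
  let Θ := similarity Ψ l hl fun z w => by rw [hΨ, hΨ, ← map_sub, hAl]
  have hΘ : ∀ ξ, bdry Θ ξ = OnePoint.map A ξ := by
    intro ξ
    induction ξ using OnePoint.rec with
    | infty => exact bdry_similarity_infty _ _ _ _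
    | coe z => exact bdry_similarity_coe _ _ _ _ z
  refine ⟨((κ.symm.trans Θ).trans ε.symm).trans β.symm, fun ξ => ?_⟩
  rw [bdry_trans, bdry_trans, bdry_trans, hΘ, ← hA, bdry_symm_bdry_isometry,
    bdry_bdry_symm_isometry, hGb, bdry_symm_bdry_isometry]

/-- An isometry with the boundary values of an equivariant map is equivariant. -/
theorem Hyp3.BiLip.conjugates_isometry {L₁ L₂ : NiceLattice} {K : ℝ} {H : Hyp3 ≃ Hyp3}
    (hH : BiLip K H) (hconj : Conjugates L₁ L₂ H) {Φ : Hyp3 ≃ᵢ Hyp3}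
    (hΦ : ∀ ξ, bdry Φ ξ = bdry H ξ) : Conjugates L₁ L₂ Φ := by
  have key : ∀ γ₁ γ₂ : Hyp3 ≃ᵢ Hyp3, H ∘ γ₁ = γ₂ ∘ H → Φ ∘ γ₁ = γ₂ ∘ Φ := by
    intro γ₁ γ₂ h
    have hb : ∀ ξ, bdry H (bdry γ₁ ξ) = bdry γ₂ (bdry H ξ) := by
      intro ξ
      have h1 := bdry_comp (H := H) (tendsto_bdry_isometry γ₁ ξ) (hH.tendsto_bdry _)
      have h2 := bdry_comp (H := γ₂) (hH.tendsto_bdry ξ) (tendsto_bdry_isometry γ₂ _)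
      rw [← h1, ← h2, h]
    funext p
    -- The commutator-like product `Φ⁻¹ γ₂⁻¹ Φ γ₁` is trivial at infinity, hence trivial.
    have h1 := eq_one_of_bdry_eq (((γ₁.trans Φ).trans γ₂.symm).trans Φ.symm) (fun ξ => by
      rw [bdry_trans, bdry_trans, bdry_trans, hΦ, hb, ← hΦ, bdry_symm_bdry_isometry,
        bdry_symm_bdry_isometry]) p
    simp only [IsometryEquiv.trans_apply] at h1
    rw [IsometryEquiv.symm_apply_eq, IsometryEquiv.symm_apply_eq] at h1
    exact h1
  refine ⟨fun γ₁ h₁ => ?_, fun γ₂ h₂ => ?_⟩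
  · obtain ⟨γ₂, h₂, h⟩ := hconj.1 γ₁ h₁
    exact ⟨γ₂, h₂, key _ _ h⟩
  · obtain ⟨γ₁, h₁, h⟩ := hconj.2 γ₂ h₂
    exact ⟨γ₁, h₁, key _ _ h⟩

/-- An equivariant isometry descends to an isometry of the quotients. -/
theorem Conjugates.nonempty_isometryEquiv {L₁ L₂ : NiceLattice} {Φ : Hyp3 ≃ᵢ Hyp3}
    (h : Conjugates L₁ L₂ Φ) : Nonempty (L₁.Manifold ≃ᵢ L₂.Manifold) := by
  have hiff : ∀ p q, L₁.proj p = L₁.proj q ↔ L₂.proj (Φ p) = L₂.proj (Φ q) := by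
    intro p q
    rw [L₁.proj_eq_iff, L₂.proj_eq_iff]
    constructor
    · rintro ⟨γ, rfl⟩
      obtain ⟨γ₂, h₂, he⟩ := h.1 γ.1 γ.2
      exact ⟨⟨γ₂, h₂⟩, (congrFun he q).symm⟩
    · rintro ⟨γ, hγ⟩
      obtain ⟨γ₁, h₁, he⟩ := h.2 γ.1 γ.2
      exact ⟨⟨γ₁, h₁⟩, Φ.injective ((congrFun he q).trans hγ)⟩
  let F : L₁.Manifold → L₂.Manifold := fun a =>
    L₂.proj (Φ (Function.surjInv L₁.proj_surjective a))
  have hF : ∀ p, F (L₁.proj p) = L₂.proj (Φ p) := fun p =>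
    (hiff _ _).1 (Function.surjInv_eq L₁.proj_surjective _)
  have hfib : ∀ q, L₂.proj ⁻¹' {L₂.proj (Φ q)} = Φ '' (L₁.proj ⁻¹' {L₁.proj q}) := by
    intro q
    ext x
    constructor
    · intro hx
      refine ⟨Φ.symm x, (hiff _ _).2 ?_, Φ.apply_symm_apply x⟩
      rw [Φ.apply_symm_apply]
      exact hx
    · rintro ⟨p, hp, rfl⟩
      exact (hiff _ _).1 hp
  have hiso : Isometry F := by
    refine Isometry.of_dist_eq fun a b => ?_
    obtain ⟨p, rfl⟩ := L₁.proj_surjective a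
    obtain ⟨q, rfl⟩ := L₁.proj_surjective b
    rw [hF, hF, NiceLattice.dist_eq_infDist, NiceLattice.dist_eq_infDist, hfib,
      Metric.infDist_image Φ.isometry]
  have hsurj : Function.Surjective F := by
    intro b
    obtain ⟨q, rfl⟩ := L₂.proj_surjective b
    exact ⟨L₁.proj (Φ.symm q), by rw [hF, Φ.apply_symm_apply]⟩
  exact ⟨⟨Equiv.ofBijective F ⟨hiso.injective, hsurj⟩, hiso⟩⟩

end

noncomputable section

namespace Hyp3

/-! ### Geodesics -/

theorem isometry_vertical (z : ℂ) :
    Isometry fun σ : ℝ => (⟨z, Real.exp σ, Real.exp_pos σ⟩ : Hyp3) := by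
  refine Isometry.of_dist_eq fun σ τ => ?_
  have h : Real.cosh (dist (⟨z, Real.exp σ, Real.exp_pos σ⟩ : Hyp3)
      ⟨z, Real.exp τ, Real.exp_pos τ⟩) = Real.cosh (σ - τ) := by
    rw [cosh_dist, Real.cosh_eq, neg_sub, Real.exp_sub, Real.exp_sub]
    have h1 := Real.exp_pos σ
    have h2 := Real.exp_pos τ
    simp only [sub_self, norm_zero]
    field_simp
    ring
  have h1 := Real.cosh_le_cosh.1 h.le
  have h2 := Real.cosh_le_cosh.1 h.ge
  rw [abs_of_nonneg dist_nonneg] at h1 h2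
  rw [Real.dist_eq]
  exact le_antisymm h1 h2

/-- Any two points are carried to a vertical line by an isometry. -/
theorem exists_isometry_z_eq (p q : Hyp3) : ∃ φ : Hyp3 ≃ᵢ Hyp3, (φ p).z = (φ q).z := by
  by_cases hz : p.z = q.z
  · exact ⟨IsometryEquiv.refl _, hz⟩
  set a := ‖q.z - p.z‖ with ha
  have ha0 : 0 < a := norm_pos_iff.2 (sub_ne_zero.2 (Ne.symm hz))
  set u : ℂ := (q.z - p.z) / (a : ℂ) with hu
  have ha0' : (a : ℂ) ≠ 0 := Complex.ofReal_ne_zero.2 ha0.ne'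
  have hu1 : ‖u‖ = 1 := by
    rw [hu, norm_div, Complex.norm_real, Real.norm_of_nonneg ha0.le, ← ha, div_self ha0.ne']
  have hq : q.z = p.z + (a : ℂ) * u := by
    rw [hu]
    field_simp
    ring
  have hp0 := p.t_pos
  have hq0 := q.t_pos
  -- The geodesic through the two points is a semicircle centred at `p.z + c u` with radius `ρ`.
  -- Translating its endpoint `p.z + (c + ρ) u` to `0` and inverting makes it the vertical line over
  -- `-u / (2 ρ)`.
  set c := (a ^ 2 + q.t ^ 2 - p.t ^ 2) / (2 * a) with hc
  have hc2 : 2 * a * c = a ^ 2 + q.t ^ 2 - p.t ^ 2 := by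
    rw [hc]
    field_simp
  set ρ := √(c ^ 2 + p.t ^ 2) with hρ
  have hρ2 : ρ ^ 2 = c ^ 2 + p.t ^ 2 := Real.sq_sqrt (by positivity)
  have hρ0 : 0 < ρ := Real.sqrt_pos.2 (by positivity)
  have h1 : 0 < ρ + c := by
    have := abs_lt_of_sq_lt_sq (show c ^ 2 < ρ ^ 2 by nlinarith) hρ0.le
    linarith [neg_abs_le c]
  have h2 : 0 < ρ - (a - c) := by
    have := abs_lt_of_sq_lt_sq (show (a - c) ^ 2 < ρ ^ 2 by nlinarith) hρ0.le
    linarith [le_abs_self (a - c)]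
  have hcalc : ∀ (x : Hyp3) (k m : ℝ), x.z = (k : ℂ) * u → 0 < m →
      k ^ 2 + x.t ^ 2 = 2 * ρ * m → k = -m → (inversion x).z = -u / (2 * ρ : ℝ) := by
    intro x k m hx hm hk hkm
    rw [inversion_apply]
    have hn : ‖x.z‖ ^ 2 + x.t ^ 2 = 2 * ρ * m := by
      rw [hx, norm_mul, hu1, mul_one, Complex.norm_real, Real.norm_eq_abs, sq_abs, hk]
    simp only [inversionFun]
    rw [hn, hx, hkm]
    have hm' : (m : ℂ) ≠ 0 := Complex.ofReal_ne_zero.2 hm.ne'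
    have hρ' : (ρ : ℂ) ≠ 0 := Complex.ofReal_ne_zero.2 hρ0.ne'
    push_cast
    field_simp
  refine ⟨(translation (-(p.z + ((c + ρ : ℝ) : ℂ) * u))).trans inversion, ?_⟩
  rw [IsometryEquiv.trans_apply, IsometryEquiv.trans_apply]
  refine (hcalc _ (-(ρ + c)) (ρ + c) ?_ h1 ?_ rfl).trans
    (hcalc _ (a - c - ρ) (ρ - (a - c)) ?_ h2 ?_ (by ring)).symm
  · change p.z + -(p.z + ((c + ρ : ℝ) : ℂ) * u) = _
    push_cast
    ring
  · change (-(ρ + c)) ^ 2 + (1 * p.t) ^ 2 = _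
    linear_combination (-1) * hρ2
  · change q.z + -(p.z + ((c + ρ : ℝ) : ℂ) * u) = _
    rw [hq]
    push_cast
    ring
  · change (a - c - ρ) ^ 2 + (1 * q.t) ^ 2 = _
    linear_combination (-1) * hρ2 - hc2

/-- Any two points lie on a geodesic line. -/
theorem exists_isometry_real (p q : Hyp3) :
    ∃ γ : ℝ → Hyp3, Isometry γ ∧ ∃ a b, γ a = p ∧ γ b = q := by
  obtain ⟨φ, hφ⟩ := exists_isometry_z_eq p q
  refine ⟨_, φ.symm.isometry.comp (isometry_vertical (φ p).z), Real.log (φ p).t,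
    Real.log (φ q).t, ?_, ?_⟩
  · rw [Function.comp_apply, IsometryEquiv.symm_apply_eq]
    exact Hyp3.ext rfl (Real.exp_log (φ p).t_pos)
  · rw [Function.comp_apply, IsometryEquiv.symm_apply_eq]
    exact Hyp3.ext hφ (Real.exp_log (φ q).t_pos)

/-- A map of hyperbolic space that is `K`-Lipschitz at every point is `K`-Lipschitz. -/
theorem dist_le_of_eventually {X : Type*} [PseudoMetricSpace X] {f : Hyp3 → X} {K : ℝ}
    (hf : Continuous f) (h : ∀ p, ∀ᶠ q in 𝓝 p, dist (f q) (f p) ≤ K * dist q p) (p q : Hyp3) :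
    dist (f p) (f q) ≤ K * dist p q := by
  obtain ⟨γ, hγ, a, b, rfl, rfl⟩ := exists_isometry_real p q
  wlog hab : a ≤ b generalizing a b
  · rw [dist_comm, dist_comm (γ a)]
    exact this b a (le_of_not_ge hab)
  -- Along a geodesic from `p`, the distance from the image of `p` has upper right slope at most
  -- `K`; the mean value inequality integrates this.
  have key := image_le_of_liminf_slope_right_le_deriv_boundary (a := a) (b := b)
    (f := fun s => dist (f (γ a)) (f (γ s))) (B := fun s => K * (s - a)) (B' := fun _ => K)
    (by
      have := hγ.continuous
      fun_prop) (by simp) (by fun_prop)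
    (fun x _ => by simpa using (((hasDerivAt_id x).sub_const a).const_mul K).hasDerivWithinAt)
    (fun x _ r hr => Eventually.frequently <| by
      have h1 : ∀ᶠ s in 𝓝[>] x, dist (f (γ s)) (f (γ x)) ≤ K * dist (γ s) (γ x) :=
        (hγ.continuous.continuousAt.tendsto.eventually (h (γ x))).filter_mono
          nhdsWithin_le_nhds
      filter_upwards [h1, self_mem_nhdsWithin] with s hs hsx
      have hsx' : 0 < s - x := sub_pos.2 hsx
      rw [hγ.dist_eq, Real.dist_eq, abs_of_pos hsx'] at hs
      rw [slope_def_field, div_lt_iff₀ hsx']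
      have := dist_triangle (f (γ a)) (f (γ x)) (f (γ s))
      rw [dist_comm (f (γ x))] at this
      nlinarith)
    (right_mem_Icc.2 hab)
  rw [hγ.dist_eq, Real.dist_eq, abs_sub_comm, abs_of_nonneg (sub_nonneg.2 hab)]
  exact key

/-! ### Hyperbolic space as a simply connected manifold -/

instance : ContractibleSpace Hyp3 := by
  have hc : Convex ℝ (range coord) := by
    rw [range_coord]
    exact convex_halfSpace_gt ⟨fun _ _ => rfl, fun _ _ => rfl⟩ 0
  have := hc.contractibleSpace (range_nonempty coord)
  exact isOpenEmbedding_coord.toIsEmbedding.toHomeomorph.contractibleSpace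

instance : LocallyPathConnectedSpace Hyp3 := isOpenEmbedding_coord.locallyPathConnectedSpace

end Hyp3

namespace NiceLattice

variable (L : NiceLattice)

theorem dist_proj_le (p q : Hyp3) : dist (L.proj p) (L.proj q) ≤ dist p q := by
  rw [dist_eq_infDist]
  exact Metric.infDist_le_dist_of_mem rfl

/-- The covering map is a local isometry. -/
theorem exists_dist_proj_eq (p : Hyp3) : ∃ r > 0, ∀ x ∈ Metric.ball p r, ∀ y ∈ Metric.ball p r,
    dist (L.proj x) (L.proj y) = dist x y := by
  have hloc : IsLocalHomeomorph L.proj :=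
    L.isQuotientCoveringMap_proj.isCoveringMap.isLocalHomeomorph
  obtain ⟨R, hR, hball⟩ := Metric.isOpen_iff.1 (hloc.localInverseAt p).open_target p
    hloc.self_mem_localInverseAt_target
  have hinj : InjOn L.proj (Metric.ball p R) := hloc.injOn_localInverseAt_target.mono hball
  -- A point `q` over the image of `y` and closer to `x` than `y` would be within `2 R / 3 + R / 3`
  -- of `p`. The projection is injective at that range, so `q = y`.
  refine ⟨R / 3, by positivity, fun x hx y hy => le_antisymm (L.dist_proj_le x y) ?_⟩
  have hne : (L.proj ⁻¹' {L.proj y}).Nonempty := ⟨y, rfl⟩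
  rw [dist_eq_infDist, Metric.le_infDist hne]
  intro q hq
  by_contra! hlt
  rw [Metric.mem_ball] at hx hy
  have h1 : dist x y < R / 3 + R / 3 := (dist_triangle_right x y p).trans_lt (add_lt_add hx hy)
  have h2 : dist q p < R := by
    have := dist_triangle_left q p x
    linarith
  have h3 : q = y := hinj h2 (show dist y p < R by linarith) hq
  rw [h3] at hlt
  exact lt_irrefl _ hlt

end NiceLattice

end

noncomputable section

/-! ### Lifting bi-Lipschitz maps to hyperbolic space -/

namespace NiceLattice

variable {L₁ L₂ : NiceLattice}

theorem eq_of_proj_comp_eq {F G : Hyp3 → Hyp3} (hF : Continuous F) (hG : Continuous G)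
    (h : ∀ p, L₁.proj (F p) = L₁.proj (G p)) (p₀ : Hyp3) (h₀ : F p₀ = G p₀) : F = G :=
  L₁.isQuotientCoveringMap_proj.isCoveringMap.eq_of_comp_eq hF hG (funext h) p₀ h₀

theorem exists_lift {f : L₁.Manifold → L₂.Manifold} (hf : Continuous f) {p₀ q₀ : Hyp3}
    (h₀ : L₂.proj q₀ = f (L₁.proj p₀)) :
    ∃ H : Hyp3 → Hyp3, Continuous H ∧ H p₀ = q₀ ∧ ∀ p, L₂.proj (H p) = f (L₁.proj p) := by
  obtain ⟨F, ⟨h1, h2⟩, -⟩ :=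
    L₂.isQuotientCoveringMap_proj.isCoveringMap.existsUnique_continuousMap_lifts
      ⟨f ∘ L₁.proj, hf.comp L₁.continuous_proj⟩ p₀ q₀ h₀
  exact ⟨F, F.continuous, h1, congrFun h2⟩

theorem continuous_isometry_smul {L : NiceLattice} (γ : L.Γ) : Continuous fun p : Hyp3 => γ • p :=
  γ.1.continuous

/-- A lift carries deck transformations to deck transformations. -/
theorem exists_comp_eq_of_lift {f : L₁.Manifold → L₂.Manifold} {H : Hyp3 → Hyp3}
    (hH : Continuous H) (h : ∀ p, L₂.proj (H p) = f (L₁.proj p)) (γ₁ : L₁.Γ) :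
    ∃ γ₂ : L₂.Γ, ∀ p, H (γ₁ • p) = γ₂ • H p := by
  obtain ⟨γ₂, hγ₂⟩ := L₂.proj_eq_iff.1
    (show L₂.proj (H (γ₁ • Hyp3.base)) = L₂.proj (H Hyp3.base) by rw [h, h, L₁.proj_smul])
  refine ⟨γ₂, congrFun (eq_of_proj_comp_eq (L₁ := L₂) (hH.comp (continuous_isometry_smul γ₁))
    ((continuous_isometry_smul γ₂).comp hH) (fun p => ?_) Hyp3.base hγ₂.symm)⟩
  rw [L₂.proj_smul, h, h, L₁.proj_smul]

/-- The covering maps are contracting upstairs in the source and locally isometric in the target, so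
the lift has constant `K` near every point. Geodesics make this global without loss in the constant.
-/
theorem dist_lift_le {f : L₁.Manifold → L₂.Manifold} {K : ℝ}
    (hf : ∀ x y, dist (f x) (f y) ≤ K * dist x y) (hK : 0 ≤ K) {H : Hyp3 → Hyp3}
    (hH : Continuous H) (h : ∀ p, L₂.proj (H p) = f (L₁.proj p)) (p q : Hyp3) :
    dist (H p) (H q) ≤ K * dist p q := by
  refine Hyp3.dist_le_of_eventually hH (fun p => ?_) p q
  obtain ⟨r, hr, hiso⟩ := L₂.exists_dist_proj_eq (H p)
  filter_upwards [hH.continuousAt.preimage_mem_nhds (Metric.ball_mem_nhds (H p) hr)] with q hq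
  rw [← hiso _ hq _ (Metric.mem_ball_self hr), h, h]
  exact (hf _ _).trans (mul_le_mul_of_nonneg_left (L₁.dist_proj_le q p) hK)

end NiceLattice

theorem IsBL.continuous {X Y : Type*} [MetricSpace X] [MetricSpace Y] {f : X → Y} (hf : IsBL f) :
    Continuous f := by
  obtain ⟨-, K, -, h⟩ := hf
  exact (LipschitzWith.of_dist_le' fun x y => (h x y).2).continuous

theorem isBL_of_dist_le {X Y : Type*} [MetricSpace X] [MetricSpace Y] {f : X → Y} {g : Y → X}
    {K : ℝ} (hK : 1 ≤ K) (hgf : Function.LeftInverse g f) (hfg : Function.RightInverse g f)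
    (hf : ∀ x y, dist (f x) (f y) ≤ K * dist x y) (hg : ∀ x y, dist (g x) (g y) ≤ K * dist x y) :
    IsBL f := by
  refine ⟨⟨hgf.injective, hfg.surjective⟩, K, hK, fun x y => ⟨?_, hf x y⟩⟩
  rw [inv_mul_le_iff₀ (by linarith)]
  simpa only [hgf _] using hg (f x) (f y)

/-- Bi-Lipschitz maps of compact hyperbolic manifolds have equivariant lifts. -/
theorem IsBL.exists_isEquivariantLift {L₁ L₂ : NiceLattice} {f : L₁.Manifold → L₂.Manifold}
    (hf : IsBL f) : ∃ H, IsEquivariantLift f H := by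
  have hcont := hf.continuous
  obtain ⟨hbij, K, hK, hKf⟩ := hf
  have hK0 : 0 < K := by linarith
  set e := Equiv.ofBijective f hbij with he
  have hg : ∀ x y, dist (e.symm x) (e.symm y) ≤ K * dist x y := by
    intro x y
    have := (hKf (e.symm x) (e.symm y)).1
    rw [inv_mul_le_iff₀ hK0] at this
    rwa [← Equiv.ofBijective_apply f hbij, ← Equiv.ofBijective_apply f hbij, ← he,
      e.apply_symm_apply, e.apply_symm_apply] at this
  have hgc : Continuous e.symm := (LipschitzWith.of_dist_le' hg).continuous
  obtain ⟨q₀, hq₀⟩ := L₂.proj_surjective (f (L₁.proj Hyp3.base))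
  obtain ⟨H, hHc, hH0, hH⟩ := NiceLattice.exists_lift hcont hq₀
  -- The inverse is lifted with matching base points, so that both composites are lifts of the
  -- identity fixing a point, hence the identity.
  obtain ⟨G, hGc, hG0, hG⟩ := NiceLattice.exists_lift (p₀ := q₀) (q₀ := Hyp3.base) hgc
    (show L₁.proj Hyp3.base = e.symm (L₂.proj q₀) by
      rw [hq₀]
      exact (e.symm_apply_apply _).symm)
  have hGH : G ∘ H = id := NiceLattice.eq_of_proj_comp_eq (L₁ := L₁) (hGc.comp hHc) continuous_id
    (fun p => by
      rw [Function.comp_apply, hG, hH]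
      exact e.symm_apply_apply _) Hyp3.base (by rw [Function.comp_apply, hH0, hG0, id])
  have hHG : H ∘ G = id := NiceLattice.eq_of_proj_comp_eq (L₁ := L₂) (hHc.comp hGc) continuous_id
    (fun p => by
      rw [Function.comp_apply, hH, hG]
      exact e.apply_symm_apply _) q₀ (by rw [Function.comp_apply, hG0, hH0, id])
  refine ⟨H, isBL_of_dist_le hK (congrFun hGH) (congrFun hHG)
    (NiceLattice.dist_lift_le (fun x y => (hKf x y).2) hK0.le hHc hH)
    (NiceLattice.dist_lift_le hg hK0.le hGc hG), hH, fun γ hγ => ?_, fun γ hγ => ?_⟩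
  · obtain ⟨γ₂, h⟩ := NiceLattice.exists_comp_eq_of_lift hHc hH ⟨γ, hγ⟩
    exact ⟨γ₂.1, γ₂.2, funext h⟩
  · obtain ⟨γ₁, h⟩ := NiceLattice.exists_comp_eq_of_lift hGc hG ⟨γ, hγ⟩
    refine ⟨γ₁.1, γ₁.2, funext fun p => ?_⟩
    have h1 : G (γ (H p)) = γ₁.1 (G (H p)) := h (H p)
    rw [show G (H p) = p from congrFun hGH p] at h1
    rw [Function.comp_apply, Function.comp_apply, ← h1]
    exact congrFun hHG _

/-! ### Diffeomorphisms are bi-Lipschitz -/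

namespace Hyp3

/-- The hyperbolic and the Euclidean distance are locally comparable. -/
theorem exists_dist_coord_le (p : Hyp3) : ∃ C : ℝ, 0 ≤ C ∧ ∃ U ∈ 𝓝 p, ∀ x ∈ U, ∀ y ∈ U,
    dist x.coord y.coord ≤ C * dist x y ∧ dist x y ≤ C * dist x.coord y.coord := by
  have hp := p.t_pos
  -- The first constant comes from `exp x - 1 ≤ 2 x` on `[0, 1]` and heights below `2 * p.t`; the
  -- second from `arsinh v ≤ v`, heights above `p.t / 2`, and the bound `2` for the ratio of the
  -- Euclidean to the product norm.
  refine ⟨max (2 * (2 * p.t)) (2 / (p.t / 2)), by positivity,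
    Metric.ball p (1 / 2) ∩ Hyp3.t ⁻¹' Ioo (p.t / 2) (2 * p.t),
    inter_mem (Metric.ball_mem_nhds _ (by norm_num)) (continuous_t.continuousAt.preimage_mem_nhds
      (Ioo_mem_nhds (by linarith) (by linarith))), ?_⟩
  rintro x ⟨hx, hx1, hx2⟩ y ⟨hy, hy1, hy2⟩
  rw [Metric.mem_ball] at hx hy
  have hd : dist x y ≤ 1 := by linarith [dist_triangle_right x y p]
  have hx0 := x.t_pos
  have hy0 := y.t_pos
  constructor
  · refine le_trans ?_ (mul_le_mul_of_nonneg_right (le_max_left _ _) dist_nonneg)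
    have h1 := Real.abs_exp_sub_one_le (x := dist x y) (by rwa [abs_of_nonneg dist_nonneg])
    rw [abs_of_nonneg (dist_nonneg (x := x))] at h1
    have h2 := (le_abs_self _).trans h1
    have h3 : 0 ≤ dist x y := dist_nonneg
    have h4 := euclidean_le x y
    calc _ ≤ _ := h4
      _ ≤ y.t * (2 * dist x y) := mul_le_mul_of_nonneg_left h2 hy0.le
      _ ≤ (2 * p.t) * (2 * dist x y) := mul_le_mul_of_nonneg_right hy2.le (by positivity)
      _ = _ := by ring
  · refine le_trans ?_ (mul_le_mul_of_nonneg_right (le_max_right _ _) dist_nonneg)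
    set D := dist x.coord y.coord with hD
    have hD0 : 0 ≤ D := dist_nonneg
    have hz : ‖x.z - y.z‖ ≤ D := by
      rw [← dist_eq_norm]
      exact le_max_left _ _
    have ht : |x.t - y.t| ≤ D := le_max_right _ _
    have hs : √(‖x.z - y.z‖ ^ 2 + (x.t - y.t) ^ 2) ≤ 2 * D := by
      refine Real.sqrt_le_iff.2 ⟨by positivity, ?_⟩
      rw [← sq_abs (x.t - y.t)]
      nlinarith [norm_nonneg (x.z - y.z), abs_nonneg (x.t - y.t)]
    have hden : p.t / 2 ≤ √(x.t * y.t) := by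
      refine Real.le_sqrt_of_sq_le ?_
      nlinarith [mul_le_mul hx1.le hy1.le (by positivity) hx0.le]
    have har : ∀ v : ℝ, 0 ≤ v → Real.arsinh v ≤ v := fun v hv => by
      rw [← Real.sinh_le_sinh, Real.sinh_arsinh]
      exact Real.self_le_sinh_iff.2 hv
    rw [dist_def]
    calc _ ≤ 2 * (√(‖x.z - y.z‖ ^ 2 + (x.t - y.t) ^ 2) / (2 * √(x.t * y.t))) := by
          gcongr
          exact har _ (by positivity)
      _ = √(‖x.z - y.z‖ ^ 2 + (x.t - y.t) ^ 2) / √(x.t * y.t) := by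
          have : 0 < √(x.t * y.t) := by positivity
          field_simp
      _ ≤ 2 * D / (p.t / 2) := by gcongr
      _ = _ := by ring

end Hyp3

namespace NiceLattice

/-- The charts of a compact hyperbolic manifold are locally bi-Lipschitz. -/
theorem exists_dist_chartAt_le (L : NiceLattice) (a : L.Manifold) :
    ∃ C : ℝ, 0 ≤ C ∧ ∃ U ∈ 𝓝 a, ∀ x ∈ U, ∀ y ∈ U,
      dist (chartAt (ℂ × ℝ) a x) (chartAt (ℂ × ℝ) a y) ≤ C * dist x y ∧
        dist x y ≤ C * dist (chartAt (ℂ × ℝ) a x) (chartAt (ℂ × ℝ) a y) := by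
  have hloc : IsLocalHomeomorph L.proj :=
    L.isQuotientCoveringMap_proj.isCoveringMap.isLocalHomeomorph
  obtain ⟨b, hb⟩ : ∃ b : Hyp3, chartAt (ℂ × ℝ) a = (hloc.localInverseAt b).trans
      (Hyp3.isOpenEmbedding_coord.toOpenPartialHomeomorph Hyp3.coord) := by
    obtain ⟨x, hx⟩ := chart_mem_atlas (ℂ × ℝ) a
    exact ⟨_, hx.symm⟩
  have ha : a ∈ (hloc.localInverseAt b).source := by
    have := mem_chart_source (ℂ × ℝ) a
    rw [hb, OpenPartialHomeomorph.trans_source] at this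
    exact this.1
  have hchart : ∀ x, chartAt (ℂ × ℝ) a x = (hloc.localInverseAt b x).coord := fun x => by
    rw [hb]
    rfl
  simp only [hchart]
  set s := hloc.localInverseAt b with hs
  obtain ⟨C, hC, V, hV, h⟩ := Hyp3.exists_dist_coord_le (s a)
  obtain ⟨r, hr, hiso⟩ := L.exists_dist_proj_eq (s a)
  refine ⟨C, hC, s.source ∩ s ⁻¹' (V ∩ Metric.ball (s a) r),
    inter_mem (s.open_source.mem_nhds ha) ((s.continuousAt ha).preimage_mem_nhds
      (inter_mem hV (Metric.ball_mem_nhds _ hr))), ?_⟩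
  rintro x ⟨hx, hxV, hxr⟩ y ⟨hy, hyV, hyr⟩
  have hxy : dist x y = dist (s x) (s y) := by
    rw [← hiso _ hxr _ hyr, hloc.apply_localInverseAt_of_mem hx,
      hloc.apply_localInverseAt_of_mem hy]
  rw [hxy]
  exact h _ hxV _ hyV

/-- Smooth maps of compact hyperbolic manifolds are Lipschitz. -/
theorem exists_dist_le_of_contMDiff {L₁ L₂ : NiceLattice} {f : L₁.Manifold → L₂.Manifold}
    (hf : ContMDiff 𝓘(ℝ, ℂ × ℝ) 𝓘(ℝ, ℂ × ℝ) ∞ f) :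
    ∃ K : ℝ, ∀ x y, dist (f x) (f y) ≤ K * dist x y := by
  -- A smooth map is locally Lipschitz in charts, and the charts are locally bi-Lipschitz;
  -- compactness then gives one constant.
  have hloc : LocallyLipschitz f := by
    intro a
    obtain ⟨hc, hd⟩ := contMDiffAt_iff.1 (hf a)
    rw [modelWithCornersSelf_coe, range_id, contDiffWithinAt_univ] at hd
    obtain ⟨K, t, ht, hK⟩ := (hd.of_le (m := 1) (by exact_mod_cast le_top)).exists_lipschitzOnWith
    obtain ⟨C₁, hC₁, U₁, hU₁, h₁⟩ := L₁.exists_dist_chartAt_le a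
    obtain ⟨C₂, hC₂, U₂, hU₂, h₂⟩ := L₂.exists_dist_chartAt_le (f a)
    have hmem : (chartAt (ℂ × ℝ) a) ⁻¹' t ∈ 𝓝 a :=
      ((chartAt (ℂ × ℝ) a).continuousAt (mem_chart_source _ a)).preimage_mem_nhds
        (by simpa using ht)
    refine ⟨Real.toNNReal (C₂ * (K * C₁)), U₁ ∩ f ⁻¹' U₂ ∩
      ((chartAt (ℂ × ℝ) a).source ∩ (chartAt (ℂ × ℝ) a) ⁻¹' t),
      inter_mem (inter_mem hU₁ (hc.preimage_mem_nhds hU₂))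
        (inter_mem ((chartAt (ℂ × ℝ) a).open_source.mem_nhds (mem_chart_source _ a)) hmem), ?_⟩
    refine LipschitzOnWith.of_dist_le_mul ?_
    rintro x ⟨⟨hx1, hx2⟩, hxs, hxt⟩ y ⟨⟨hy1, hy2⟩, hys, hyt⟩
    rw [Real.coe_toNNReal _ (by positivity)]
    have h3 := hK.dist_le_mul _ hxt _ hyt
    simp only [extChartAt, mfld_simps, OpenPartialHomeomorph.left_inv _ hxs,
      OpenPartialHomeomorph.left_inv _ hys] at h3
    calc _ ≤ _ := (h₂ _ hx2 _ hy2).2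
      _ ≤ C₂ * (K * (C₁ * dist x y)) := by
          gcongr
          exact h3.trans (mul_le_mul_of_nonneg_left (h₁ _ hx1 _ hy1).1 K.2)
      _ = _ := by ring
  obtain ⟨K, hK⟩ := hloc.locallyLipschitzOn.exists_lipschitzOnWith_of_compact
    (s := univ) isCompact_univ
  exact ⟨K, fun x y => hK.dist_le_mul x (mem_univ x) y (mem_univ y)⟩

end NiceLattice

theorem Diffeomorph.isBL {L₁ L₂ : NiceLattice}
    (f : L₁.Manifold ≃ₘ^∞⟮𝓘(ℝ, ℂ × ℝ), 𝓘(ℝ, ℂ × ℝ)⟯ L₂.Manifold) : IsBL f := by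
  obtain ⟨K, hK⟩ := NiceLattice.exists_dist_le_of_contMDiff f.contMDiff
  obtain ⟨K', hK'⟩ := NiceLattice.exists_dist_le_of_contMDiff f.symm.contMDiff
  refine isBL_of_dist_le (K := max 1 (max K K')) (le_max_left _ _) f.symm_apply_apply
    f.apply_symm_apply (fun x y => (hK x y).trans ?_) (fun x y => (hK' x y).trans ?_)
  · exact mul_le_mul_of_nonneg_right ((le_max_left _ _).trans (le_max_right _ _)) dist_nonneg
  · exact mul_le_mul_of_nonneg_right ((le_max_right _ _).trans (le_max_right _ _)) dist_nonneg

/-! ### Rigidity -/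

theorem IsEquivariantLift.exists_biLip {L₁ L₂ : NiceLattice} {f : L₁.Manifold → L₂.Manifold}
    {H : Hyp3 → Hyp3} (hH : IsEquivariantLift f H) :
    ∃ (e : Hyp3 ≃ Hyp3) (K : ℝ), (e : Hyp3 → Hyp3) = H ∧ Hyp3.BiLip K e := by
  obtain ⟨hbij, K, hK, h⟩ := hH.isBL
  refine ⟨Equiv.ofBijective H hbij, K, rfl, hK, fun p q => (h p q).2, fun p q => ?_⟩
  exact (inv_mul_le_iff₀ (by linarith)).1 (h p q).1

theorem IsEquivariantLift.nonempty_isometryEquiv {L₁ L₂ : NiceLattice}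
    {f : L₁.Manifold → L₂.Manifold} {H : Hyp3 → Hyp3} (hH : IsEquivariantLift f H) :
    Nonempty (L₁.Manifold ≃ᵢ L₂.Manifold) := by
  obtain ⟨e, K, rfl, he⟩ := hH.exists_biLip
  obtain ⟨Φ, hΦ⟩ := he.exists_isometry_bdry_eq hH.conjugates
  exact (he.conjugates_isometry hH.conjugates hΦ).nonempty_isometryEquiv

theorem IsEquivariantLift.exists_isMoebius {L₁ L₂ : NiceLattice}
    {f : L₁.Manifold → L₂.Manifold} {H : Hyp3 → Hyp3} (hH : IsEquivariantLift f H) :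
    ∃ h : OnePoint ℂ ≃ₜ OnePoint ℂ, IsBoundaryExtension H h ∧ IsMoebius h := by
  obtain ⟨e, K, rfl, he⟩ := hH.exists_biLip
  obtain ⟨Φ, hΦ⟩ := he.exists_isometry_bdry_eq hH.conjugates
  refine ⟨he.bdryHomeo, he.isBoundaryExtension, ?_⟩
  have h : (he.bdryHomeo : OnePoint ℂ → OnePoint ℂ) = Hyp3.bdry Φ := funext fun ξ => (hΦ ξ).symm
  rw [h]
  exact Hyp3.isMoebius_bdry Φ

end

theorem theorem1 (L₁ L₂ : NiceLattice) :
    (∀ f : L₁.Manifold → L₂.Manifold, IsBL f →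
      Nonempty (L₁.Manifold ≃ᵢ L₂.Manifold) ∧
      (∃ H : Hyp3 → Hyp3, IsEquivariantLift f H) ∧
      ∀ H : Hyp3 → Hyp3, IsEquivariantLift f H →
        ∃ h : OnePoint ℂ ≃ₜ OnePoint ℂ, IsBoundaryExtension H h ∧ IsMoebius h) ∧
    (Nonempty (L₁.Manifold ≃ₘ^∞⟮𝓘(ℝ, ℂ × ℝ), 𝓘(ℝ, ℂ × ℝ)⟯ L₂.Manifold) →
      Nonempty (L₁.Manifold ≃ᵢ L₂.Manifold)) := by
  refine ⟨fun f hf => ⟨?_, hf.exists_isEquivariantLift, fun H hH => hH.exists_isMoebius⟩, ?_⟩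
  · obtain ⟨H, hH⟩ := hf.exists_isEquivariantLift
    exact hH.nonempty_isometryEquiv
  · rintro ⟨f⟩
    obtain ⟨H, hH⟩ := f.isBL.exists_isEquivariantLift
    exact hH.nonempty_isometryEquiv
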